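/- **Theorem 1 (mean).** Let $0<p<1$, $q=1-p$, $h=-p\log p-q\log q$. Let $T_n$ ($n\ge 0$) be real random variables with finite means and $T_0=T_1=0$, and let $X_n$ ($n\ge 0$) be real random variables with $X_0=X_1=0$ and $$X_n\stackrel{d}{=}X_{I_n}+X^*_{n-I_n}+T_n\qquad(n\ge 2),$$ where $I_n$ is binomial with parameters $n,p$, $X^*_k\stackrel{d}{=}X_k$ for all $k$, and $(X_k)_k$, $(X_k^*)_k$, $I_n$, $T_n$ are independent. Suppose that $\sum_{n\ge 0}\mathbb E(T_n)z^n/n!$ converges for all $z\in\mathbb C$, and let $$\tilde g_1(z)=e^{-z}\sum_{n\ge 0}\frac{\mathbb E(T_n)}{n!}z^n .$$ For $\alpha,\beta\in\mathbb R$, an entire function $\tilde f$ is called JS-admissible with exponents $(\alpha,\beta)$ if, for some $0<\theta_0<\pi/2$ and some $\varepsilon>0$, uniformly for $|z|\ge 1$, (I) $\tilde f(z)=O\big(|z|^{\alpha}(\log(1+|z|))^{\beta}\big)$ for $|\arg z|\le\theta_0$, and (O) $e^z\tilde f(z)=O\big(e^{(1-\varepsilon)|z|}\big)$ for $\theta_0\le|\arg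 z|\le\pi$. It is called JS-admissible if it is so for some exponents. Let $0<\theta<\pi/2$, $\alpha<1$, $\beta\in\mathbb R$ and $c\in\mathbb R$, and assume that one of the following holds: - $\tilde g_1$ is JS-admissible with exponents $(\alpha,\beta)$, and $c=0$; - $\tilde g_1$ is JS-admissible and $\tilde g_1(z)=cz+O\big(|z|^{\alpha}(\log(1+|z|))^{\beta}\big)$ uniformly as $|z|\to\infty$, $|\arg z|\le\theta$. Then each $X_n$ has a finite mean. The Mellin transform $\int_0^\infty \tilde g_1(z)z^{s-1}\,dz$ converges for $-2<\Re s<-1$ (for $-2<\Re s<-\alpha$ if $c=0$) and has a meromorphic continuation $G_1$ to the strip $-2<\Re s<-\alpha$; the limit $c_0=\lim_{s\to-1}\big(G_1(s)+\frac{c}{s+1}\big)$ exists; and, as $n\to\infty$, $$\frac{\mathbb E(X_n)}{n}=\frac{c}{h}\log n+d+\mathscr F[G_1](r\log_{1/p}n)+o(1),$$ where $$d=\frac{G_1(-1)}{h}\ \text{ if } c=0,\qquad d=\frac{c_0}{h}+\frac{c\,(p\log^2p+q\log^2q)}{2h^2}\ \text{ if } c\ne 0.$$ Here $\mathscr F[G_1]=0$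 if $\log p/\log q$ is irrational. If $\log p/\log q=r/\ell$ with coprime positive integers $r,\ell$, then $$\mathscr F[G_1](x)=\frac1h\sum_{k\in\mathbb Z\setminus\{0\}}G_1(-1+\chi_k)\,e^{2k\pi i x},\qquad \chi_k=\frac{2rk\pi i}{\log p},$$ and $\sum_{k\neq0}|G_1(-1+\chi_k)|<\infty$. -/

import Mathlib

open MeasureTheory ProbabilityTheory Filter Topology

noncomputable section

namespace TrieMean

/-- The entropy `h = -p log p - q log q` of the Bernoulli distribution, `q = 1 - p`. -/
def entropy (p : ℝ) : ℝ := -p * Real.log p - (1 - p) * Real.log (1 - p)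

open Classical in
/-- The integer `r` with `log p / log q = r / ℓ` in lowest terms, when `log p / log q` is rational
(`q = 1 - p`).  In the irrational case it has no meaning, and is set to `0`. -/
def ratioNum (p : ℝ) : ℤ :=
  if h : ∃ ρ : ℚ, (ρ : ℝ) = Real.log p / Real.log (1 - p) then h.choose.num else 0

/-- `χ_k = 2 r k π i / log p`. -/
def chi (p : ℝ) (k : ℤ) : ℂ :=
  2 * (ratioNum p : ℂ) * (k : ℂ) * (Real.pi : ℂ) * Complex.I / (Real.log p : ℂ)

open Classical in
/-- The periodic function `F[G](x)`: the Fourier series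
`h⁻¹ ∑_{k ≠ 0} G (-1 + χ_k) exp (2 k π i x)` if `log p / log q` is rational, and `0` otherwise. -/
def fluct (p : ℝ) (G : ℂ → ℂ) (x : ℝ) : ℂ :=
  if Irrational (Real.log p / Real.log (1 - p)) then 0
  else (entropy p : ℂ)⁻¹ * ∑' k : {k : ℤ // k ≠ 0},
    G (-1 + chi p k) * Complex.exp (2 * ((k : ℤ) : ℂ) * (Real.pi : ℂ) * Complex.I * (x : ℂ))

/-- `f` is JS-admissible with exponents `α, β`: `f` is entire and, for some `0 < θ < π / 2`,
`f z = O (|z| ^ α * log (1 + |z|) ^ β)` for `|z| ≥ 1`, `|arg z| ≤ θ`, and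
`exp z * f z = O (exp ((1 - ε) |z|))` for some `ε > 0`, for `|z| ≥ 1`, `θ ≤ |arg z| ≤ π`. -/
def JSAdmissibleWith (α β : ℝ) (f : ℂ → ℂ) : Prop :=
  Differentiable ℂ f ∧ ∃ θ : ℝ, 0 < θ ∧ θ < Real.pi / 2 ∧
    (∃ C : ℝ, ∀ z : ℂ, 1 ≤ ‖z‖ → |z.arg| ≤ θ →
      ‖f z‖ ≤ C * (‖z‖ ^ α * Real.log (1 + ‖z‖) ^ β)) ∧
    (∃ ε : ℝ, 0 < ε ∧ ∃ C : ℝ, ∀ z : ℂ, 1 ≤ ‖z‖ → θ ≤ |z.arg| →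
      ‖Complex.exp z * f z‖ ≤ C * Real.exp ((1 - ε) * ‖z‖))

/-- `f` is JS-admissible: it is so for some exponents. -/
def JSAdmissible (f : ℂ → ℂ) : Prop := ∃ α β : ℝ, JSAdmissibleWith α β f

/-- `f z = c z + O (|z| ^ α * log (1 + |z|) ^ β)` uniformly as `|z| → ∞`, `|arg z| ≤ θ`. -/
def LinearInSector (θ c α β : ℝ) (f : ℂ → ℂ) : Prop :=
  ∃ C R : ℝ, ∀ z : ℂ, R ≤ ‖z‖ → |z.arg| ≤ θ →
    ‖f z - (c : ℂ) * z‖ ≤ C * (‖z‖ ^ α * Real.log (1 + ‖z‖) ^ β)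

/-- `f` is the Poisson generating function of the sequence `a`: the series `∑ aₙ zⁿ / n!` converges
for all complex `z`, and `f z` is `exp (-z)` times its sum. -/
def IsPoissonGF (a : ℕ → ℝ) (f : ℂ → ℂ) : Prop :=
  ∀ z : ℂ, HasSum (fun n : ℕ => (a n : ℂ) / (n.factorial : ℂ) * z ^ n) (Complex.exp z * f z)

/-- `G` is the meromorphic continuation to the strip `a < Re s < b'` of the Mellin transform
`∫₀^∞ f t t ^ (s - 1) dt` of `f`, which converges in the strip `a < Re s < b`.  The normal form of
a meromorphic function takes its true value at each point that is not a pole. -/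
def IsMellinContinuation (f : ℂ → ℂ) (a b b' : ℝ) (G : ℂ → ℂ) : Prop :=
  (∀ s : ℂ, a < s.re → s.re < b →
    MellinConvergent (fun t : ℝ => f t) s ∧ G s = mellin (fun t : ℝ => f t) s) ∧
  MeromorphicNFOn G {s : ℂ | a < s.re ∧ s.re < b'}

/-- `h₀ = c₀ / h + c (p log² p + q log² q) / (2 h²)`. -/
def h0 (p c : ℝ) (c₀ : ℂ) : ℂ :=
  c₀ / (entropy p : ℂ) +
    ((c * (p * Real.log p ^ 2 + (1 - p) * Real.log (1 - p) ^ 2) / (2 * entropy p ^ 2) : ℝ) : ℂ)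

/-- The distributional recurrence `Xₙ = X_{Iₙ} + X*_{n - Iₙ} + Tₙ` in law (`n ≥ 2`) of an additive
parameter of random tries, with zero initial conditions: `Iₙ` is binomial with parameters `n, p`,
`X*ₖ` has the law of `Xₖ`, and `X, X*, Iₙ, Tₙ` are independent (this is only asked for the
variables that enter). -/
structure TrieRecurrence {Ω : Type*} [MeasurableSpace Ω] (P : Measure Ω) (p : unitInterval)
    (X Xs : ℕ → Ω → ℝ) (I : ℕ → Ω → ℕ) (T : ℕ → Ω → ℝ) : Prop where
  X_zero : X 0 =ᵐ[P] 0
  X_one : X 1 =ᵐ[P] 0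
  T_zero : T 0 =ᵐ[P] 0
  T_one : T 1 =ᵐ[P] 0
  copy : ∀ n, IdentDistrib (Xs n) (X n) P P
  splitting : ∀ n, 2 ≤ n → HasLaw (I n) (ProbabilityTheory.binomial n p) P
  indep : ∀ n, 2 ≤ n → ∀ j ≤ n, ∀ k ≤ n,
    iIndepFun ![X j, Xs k, fun ω => (I n ω : ℝ), T n] P
  recurrence : ∀ n, 2 ≤ n →
    IdentDistrib (X n) (fun ω => X (I n ω) ω + Xs (n - I n ω) ω + T n ω) P P

end TrieMean

end

/-! Write q = 1 - p, a = -log p, b = -log q, κ = c/h, and let A be the exponential generating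
function of the means (`exists_egf`). The binomial recurrence becomes a functional equation for A.
In the variable t = log z, the function U(t) = exp(-t) exp(-z) A(z) - κ t solves the renewal
equation U(t) = p U(t - a) + q U(t - b) + W(t) (`stripFun_eq`). Here W decays exponentially at +∞,
because the term κ t absorbs the linear part c z of the toll. U is bounded and Lipschitz
(`exists_strip_bounds`), and a renewal theorem is proved directly, without Mellin inversion.

The weighted window integral p ∫_{t-a}^t + q ∫_{t-b}^t obeys a conservation law
(`window_integral_sub`). Applied to |U|² together with `norm_sq_convex_comb`, it bounds ∫ |U(s - a)
- U(s - b)|² ds. Since U is Lipschitz, this difference tends to 0, so a and b are asymptotic periods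
of U. Such periods form a closed group. If a/b is irrational the group is ℝ, the window integral of
U is asymptotically h U(t), and U converges. If a/b is rational, U is asymptotic to a Lipschitz
periodic function. Its Fourier series converges absolutely, and its coefficients are read off from
the window integrals of U(s) exp(-iωs).

The limits of these window integrals come from the conservation law on the whole line
(`tendsto_windowSum_stripFun`). Without the κ t term the window integral vanishes at -∞, since A has
a double zero at 0. The limit at +∞ is therefore a Fourier integral of the toll, that is, its Mellin
transform on Re s = -1 with the linear part removed. The term κ t contributes the polar part c/(s +
1) if ω ≠ 0, and the constant with p log² p + q log² q if ω = 0.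

Finally, Cauchy's estimate on |z| = n (`depoissonization`), with the bound on A outside a sector
(`exists_outer_bound`), gives E(X_n)/n = U(log n) + κ log n + o(1). -/

namespace TrieMean

set_option linter.unusedSectionVars false

/-! ### Finiteness and recurrence of the means -/

/-- The binomial weight `C(n,k) p^k (1-p)^(n-k)`. -/
noncomputable def binWeight (p : ℝ) (n k : ℕ) : ℝ := n.choose k * p ^ k * (1 - p) ^ (n - k)

lemma binWeight_nonneg {p : ℝ} (hp : p ∈ Set.Ioo (0 : ℝ) 1) (n k : ℕ) : 0 ≤ binWeight p n k := by
  have h1 := hp.1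
  have h2 : 0 < 1 - p := sub_pos.2 hp.2
  unfold binWeight; positivity

lemma sum_binWeight (p : ℝ) (n : ℕ) : ∑ k ∈ Finset.range (n + 1), binWeight p n k = 1 := by
  have := add_pow p (1 - p) n
  rw [add_sub_cancel, one_pow] at this
  rw [this]
  exact Finset.sum_congr rfl fun k _ => by unfold binWeight; ring

lemma binWeight_zero_right (p : ℝ) (n : ℕ) : binWeight p n 0 = (1 - p) ^ n := by simp [binWeight]

lemma binWeight_self (p : ℝ) (n : ℕ) : binWeight p n n = p ^ n := by simp [binWeight]

lemma pow_add_pow_lt_one {p : ℝ} (hp : p ∈ Set.Ioo (0 : ℝ) 1) {n : ℕ} (hn : 2 ≤ n) :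
    p ^ n + (1 - p) ^ n < 1 := by
  have h2 : 0 < 1 - p := sub_pos.2 hp.2
  have e1 : p ^ n < p := pow_lt_self_of_lt_one₀ hp.1 hp.2 hn
  have e2 : (1 - p) ^ n < 1 - p := pow_lt_self_of_lt_one₀ h2 (by linarith [hp.1]) hn
  linarith

/-- The indicator of the integer `k`, as a function on the reals. -/
noncomputable def deltaFun (k : ℕ) (x : ℝ) : ℝ := Set.indicator {(k : ℝ)} 1 x

lemma measurable_deltaFun (k : ℕ) : Measurable (deltaFun k) :=
  measurable_one.indicator (measurableSet_singleton _)

lemma deltaFun_natCast (k j : ℕ) : deltaFun k (j : ℝ) = if j = k then 1 else 0 := by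
  simp [deltaFun, Set.indicator_apply]

section Prob

variable {Ω : Type*} [MeasurableSpace Ω] {P : Measure Ω} [IsProbabilityMeasure P] {p : ℝ}
  {hp : p ∈ Set.Ioo (0 : ℝ) 1} {X Xs : ℕ → Ω → ℝ} {I : ℕ → Ω → ℕ} {T : ℕ → Ω → ℝ}

lemma integral_deltaFun_of_hasLaw {n k : ℕ} {N : Ω → ℕ}
    (hN : HasLaw N (ProbabilityTheory.binomial n ⟨p, Set.Ioo_subset_Icc_self hp⟩) P) :
    ∫ ω, deltaFun k (N ω) ∂P = binWeight p n k := by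
  have h1 := hN.integral_comp (f := fun j : ℕ => deltaFun k (j : ℝ))
    (measurable_from_nat.aestronglyMeasurable)
  have h2 : (fun j : ℕ => deltaFun k (j : ℝ)) = Set.indicator {k} 1 := by
    ext j; simp [deltaFun_natCast, Set.indicator_apply]
  have h3 := binomial_real_singleton n k ⟨p, Set.Ioo_subset_Icc_self hp⟩
  rw [h2, integral_indicator_one (measurableSet_singleton k), h3] at h1
  rw [← h2] at h1
  exact h1

lemma integrable_deltaFun {N : Ω → ℝ} (hN : AEMeasurable N P) (k : ℕ) :
    Integrable (fun ω => deltaFun k (N ω)) P := by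
  refine Integrable.of_bound ((measurable_deltaFun k).comp_aemeasurable hN).aestronglyMeasurable 1
    (ae_of_all _ fun ω => ?_)
  unfold deltaFun
  by_cases h : N ω ∈ ({(k : ℝ)} : Set ℝ) <;> simp [h]

lemma deltaFun_nonneg (k : ℕ) (x : ℝ) : 0 ≤ deltaFun k x := by
  unfold deltaFun
  exact Set.indicator_nonneg (fun _ _ => zero_le_one) _

lemma lintegral_deltaFun_mul {N Y : Ω → ℝ} (hN : AEMeasurable N P) (hY : AEMeasurable Y P)
    (hi : IndepFun N Y P) (k : ℕ) {φ : ℝ → ENNReal} (hφ : Measurable φ) :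
    ∫⁻ ω, ENNReal.ofReal (deltaFun k (N ω)) * φ (Y ω) ∂P =
      ENNReal.ofReal (∫ ω, deltaFun k (N ω) ∂P) * ∫⁻ ω, φ (Y ω) ∂P := by
  have hm : Measurable fun x : ℝ => ENNReal.ofReal (deltaFun k x) :=
    (measurable_deltaFun k).ennreal_ofReal
  rw [ofReal_integral_eq_lintegral_ofReal (integrable_deltaFun hN k)
    (ae_of_all _ fun ω => deltaFun_nonneg _ _)]
  exact lintegral_mul_eq_lintegral_mul_lintegral_of_indepFun'' (hm.comp_aemeasurable hN)
    (hφ.comp_aemeasurable hY) (hi.comp hm hφ)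

/-- Expectations are linear, so what matters is the independence of I_n from each summand
separately. -/
lemma TrieRecurrence.indepFuns (hX : TrieRecurrence P ⟨p, Set.Ioo_subset_Icc_self hp⟩ X Xs I T)
    {n k : ℕ} (hn : 2 ≤ n) (hk : k ≤ n) :
    IndepFun (fun ω => (I n ω : ℝ)) (X k) P ∧ IndepFun (fun ω => (I n ω : ℝ)) (Xs (n - k)) P ∧
      IndepFun (fun ω => (I n ω : ℝ)) (T n) P := by
  have h := hX.indep n hn k hk (n - k) (Nat.sub_le _ _)
  exact ⟨h.indepFun (i := 2) (j := 0) (by decide), h.indepFun (i := 2) (j := 1) (by decide),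
    h.indepFun (i := 2) (j := 3) (by decide)⟩

/-- Truncated absolute value. -/
noncomputable def truncAbs (M : ℕ) (x : ℝ) : ENNReal := min ‖x‖ₑ M

lemma measurable_truncAbs (M : ℕ) : Measurable (truncAbs M) := by
  unfold truncAbs; fun_prop

/-- If one of the first two truncations is active, the right side already reaches M. The third term
is left untruncated because it will be the integrable toll. -/
lemma truncAbs_add_le (M : ℕ) (x y z : ℝ) :
    truncAbs M (x + y + z) ≤ truncAbs M x + truncAbs M y + ‖z‖ₑ := by
  unfold truncAbs
  have h1 : ‖x + y + z‖ₑ ≤ ‖x‖ₑ + ‖y‖ₑ + ‖z‖ₑ :=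
    (enorm_add_le _ _).trans (add_le_add_left (enorm_add_le _ _) _)
  rcases le_total ‖x‖ₑ (M : ENNReal) with hx | hx
  · rcases le_total ‖y‖ₑ (M : ENNReal) with hy | hy
    · rw [min_eq_left hx, min_eq_left hy]
      exact (min_le_left _ _).trans h1
    · rw [min_eq_right hy]
      exact (min_le_right _ _).trans (le_add_right (le_add_left le_rfl))
  · rw [min_eq_right hx]
    exact (min_le_right _ _).trans (le_add_right (le_add_right le_rfl))

lemma TrieRecurrence.ae_le (hX : TrieRecurrence P ⟨p, Set.Ioo_subset_Icc_self hp⟩ X Xs I T)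
    {n : ℕ} (hn : 2 ≤ n) : ∀ᵐ ω ∂P, I n ω ≤ n :=
  ae_le_of_hasLaw_binomial (hX.splitting n hn)

lemma TrieRecurrence.aemeasurable_natCast
    (hX : TrieRecurrence P ⟨p, Set.Ioo_subset_Icc_self hp⟩ X Xs I T)
    {n : ℕ} (hn : 2 ≤ n) : AEMeasurable (fun ω => (I n ω : ℝ)) P :=
  (measurable_from_nat (f := fun j : ℕ => (j : ℝ))).comp_aemeasurable
    (hX.splitting n hn).aemeasurable

/-- The mean recurrence cannot be written down before integrability is known. Truncation gives a
version of it, as an inequality, in which every term containing X is finite. -/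
lemma TrieRecurrence.lintegral_truncAbs_le
    (hX : TrieRecurrence P ⟨p, Set.Ioo_subset_Icc_self hp⟩ X Xs I T)
    (hT : ∀ n, Integrable (T n) P) {n : ℕ} (hn : 2 ≤ n) (M : ℕ) :
    ∫⁻ ω, truncAbs M (X n ω) ∂P ≤ ∑ k ∈ Finset.range (n + 1), ENNReal.ofReal (binWeight p n k) *
      (∫⁻ ω, truncAbs M (X k ω) ∂P + ∫⁻ ω, truncAbs M (X (n - k) ω) ∂P + ∫⁻ ω, ‖T n ω‖ₑ ∂P) := by
  have hN := hX.aemeasurable_natCast (hp := hp) hn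
  have hXm : ∀ k, AEMeasurable (X k) P := fun k => (hX.copy k).aemeasurable_snd
  have hXsm : ∀ k, AEMeasurable (Xs k) P := fun k => (hX.copy k).aemeasurable_fst
  have hφ := measurable_truncAbs M
  have hm : ∀ k, Measurable fun x : ℝ => ENNReal.ofReal (deltaFun k x) := fun k =>
    (measurable_deltaFun k).ennreal_ofReal
  calc ∫⁻ ω, truncAbs M (X n ω) ∂P
      = ∫⁻ ω, truncAbs M (X (I n ω) ω + Xs (n - I n ω) ω + T n ω) ∂P :=
        ((hX.recurrence n hn).comp hφ).lintegral_eq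
    _ ≤ ∫⁻ ω, ∑ k ∈ Finset.range (n + 1), (ENNReal.ofReal (deltaFun k (I n ω)) * truncAbs M (X k ω)
          + ENNReal.ofReal (deltaFun k (I n ω)) * truncAbs M (Xs (n - k) ω)
          + ENNReal.ofReal (deltaFun k (I n ω)) * ‖T n ω‖ₑ) ∂P := by
        refine lintegral_mono_ae ?_
        filter_upwards [hX.ae_le (hp := hp) hn] with ω hω
        -- Since I_n ≤ n almost surely, exactly one indicator is 1. This replaces the random index
        -- by a fixed k in each summand.
        rw [Finset.sum_eq_single_of_mem (I n ω) (by simpa [Nat.lt_succ_iff] using hω)]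
        · simpa [deltaFun_natCast] using truncAbs_add_le M _ _ _
        · intro k _ hk
          simp [deltaFun_natCast, hk.symm]
    _ = _ := by
        have a1 : ∀ k, AEMeasurable (fun ω => ENNReal.ofReal (deltaFun k (I n ω)) *
            truncAbs M (X k ω)) P := fun k =>
          ((hm k).comp_aemeasurable hN).mul (hφ.comp_aemeasurable (hXm k))
        have a2 : ∀ k, AEMeasurable (fun ω => ENNReal.ofReal (deltaFun k (I n ω)) *
            truncAbs M (Xs (n - k) ω)) P := fun k =>
          ((hm k).comp_aemeasurable hN).mul (hφ.comp_aemeasurable (hXsm _))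
        have a3 : ∀ k, AEMeasurable (fun ω => ENNReal.ofReal (deltaFun k (I n ω)) *
            ‖T n ω‖ₑ) P := fun k =>
          ((hm k).comp_aemeasurable hN).mul (hT n).aemeasurable.enorm
        have a123 : ∀ k, AEMeasurable (fun ω => ENNReal.ofReal (deltaFun k (I n ω)) *
            truncAbs M (X k ω) + ENNReal.ofReal (deltaFun k (I n ω)) * truncAbs M (Xs (n - k) ω)
            + ENNReal.ofReal (deltaFun k (I n ω)) * ‖T n ω‖ₑ) P := fun k =>
          ((a1 k).add (a2 k)).add (a3 k)
        rw [lintegral_finsetSum' _ fun k _ => a123 k]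
        refine Finset.sum_congr rfl fun k hk => ?_
        have hk' : k ≤ n := Nat.lt_succ_iff.1 (Finset.mem_range.1 hk)
        obtain ⟨i1, i2, i3⟩ := hX.indepFuns (hp := hp) hn hk'
        rw [lintegral_add_right' _ (a3 k), lintegral_add_right' _ (a2 k),
          lintegral_deltaFun_mul hN (hXm k) i1 k hφ,
          lintegral_deltaFun_mul hN (hXsm _) i2 k hφ,
          lintegral_deltaFun_mul hN (hT n).aemeasurable i3 k measurable_enorm,
          integral_deltaFun_of_hasLaw (hp := hp) (hX.splitting n hn), ← mul_add, ← mul_add]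
        congr 3
        exact ((hX.copy (n - k)).comp hφ).lintegral_eq

lemma lintegral_truncAbs_le_enorm (Y : Ω → ℝ) (M : ℕ) :
    ∫⁻ ω, truncAbs M (Y ω) ∂P ≤ ∫⁻ ω, ‖Y ω‖ₑ ∂P :=
  lintegral_mono fun _ => min_le_left _ _

/-- Monotone convergence in M. -/
lemma integrable_of_lintegral_truncAbs_le {Y : Ω → ℝ} (hY : AEMeasurable Y P) {C : ENNReal}
    (hC : C ≠ ⊤) (h : ∀ M, ∫⁻ ω, truncAbs M (Y ω) ∂P ≤ C) : Integrable Y P := by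
  refine ⟨hY.aestronglyMeasurable, ?_⟩
  have hsup : ∀ x : ℝ, ⨆ M : ℕ, truncAbs M x = ‖x‖ₑ := fun x => by
    unfold truncAbs
    rw [← inf_iSup_eq, ENNReal.iSup_natCast, inf_top_eq]
  have h1 : ∫⁻ ω, ‖Y ω‖ₑ ∂P = ⨆ M : ℕ, ∫⁻ ω, truncAbs M (Y ω) ∂P := by
    have h2 := lintegral_iSup' (μ := P) (f := fun (M : ℕ) ω => truncAbs M (Y ω))
      (fun M => (measurable_truncAbs M).comp_aemeasurable hY)
      (ae_of_all _ fun ω M M' hM => min_le_min le_rfl (by exact_mod_cast hM))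
    simpa only [hsup] using h2
  rw [hasFiniteIntegral_iff_enorm, h1]
  exact (iSup_le h).trans_lt (lt_top_iff_ne_top.2 hC)

/-- Solving for m requires subtracting ρ m, which is legitimate only for finite m. This is why the
truncated integrals are needed. -/
lemma le_of_le_ofReal_mul_add {m C : ENNReal} {ρ : ℝ} (hm : m ≠ ⊤) (hC : C ≠ ⊤) (h0 : 0 ≤ ρ)
    (h1 : ρ < 1) (h : m ≤ ENNReal.ofReal ρ * m + C) : m ≤ ENNReal.ofReal (C.toReal / (1 - ρ)) := by
  have h2 : m.toReal ≤ ρ * m.toReal + C.toReal := by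
    have := ENNReal.toReal_mono (ENNReal.add_ne_top.2 ⟨ENNReal.mul_ne_top ENNReal.ofReal_ne_top hm,
      hC⟩) h
    rwa [ENNReal.toReal_add (ENNReal.mul_ne_top ENNReal.ofReal_ne_top hm) hC, ENNReal.toReal_mul,
      ENNReal.toReal_ofReal h0] at this
  rw [← ENNReal.ofReal_toReal hm]
  refine ENNReal.ofReal_le_ofReal ?_
  rw [le_div_iff₀ (by linarith)]
  linarith

/-- All the variables of the recurrence have finite means. -/
theorem TrieRecurrence.integrable
    (hX : TrieRecurrence P ⟨p, Set.Ioo_subset_Icc_self hp⟩ X Xs I T)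
    (hT : ∀ n, Integrable (T n) P) (n : ℕ) : Integrable (X n) P := by
  induction n using Nat.strong_induction_on with
  | _ n ih =>
  by_cases hn : 2 ≤ n
  · set τ := ∫⁻ ω, ‖T n ω‖ₑ ∂P
    set B := ∑ k ∈ Finset.range n, ∫⁻ ω, ‖X k ω‖ₑ ∂P
    have hτ : τ ≠ ⊤ := (hT n).2.ne
    have hB : B ≠ ⊤ := ENNReal.sum_ne_top.2 fun k hk => (ih k (Finset.mem_range.1 hk)).2.ne
    have hC : B + B + τ ≠ ⊤ := ENNReal.add_ne_top.2 ⟨ENNReal.add_ne_top.2 ⟨hB, hB⟩, hτ⟩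
    have hρ := pow_add_pow_lt_one hp hn
    have hq : 0 < 1 - p := sub_pos.2 hp.2
    have hp0 := hp.1
    refine integrable_of_lintegral_truncAbs_le (hX.copy n).aemeasurable_snd
      (C := ENNReal.ofReal ((B + B + τ).toReal / (1 - (p ^ n + (1 - p) ^ n))))
      ENNReal.ofReal_ne_top fun M => ?_
    set m := ∫⁻ ω, truncAbs M (X n ω) ∂P with hmdef
    have hm : m ≠ ⊤ := by
      have : m ≤ ∫⁻ _, (M : ENNReal) ∂P := lintegral_mono fun _ => min_le_right _ _
      rw [lintegral_const, measure_univ, mul_one] at this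
      exact ne_top_of_le_ne_top (ENNReal.natCast_ne_top M) this
    refine le_of_le_ofReal_mul_add hm hC (by positivity) hρ ?_
    -- X_n occurs on both sides of its own recurrence, through k = n and k = 0, with total weight
    -- p^n + q^n < 1. The other terms are covered by the induction hypothesis, uniformly in M.
    have hk : ∀ k ≤ n, ∫⁻ ω, truncAbs M (X k ω) ∂P ≤ (if k = n then m else 0) + B := fun k hk => by
      by_cases hkn : k = n
      · subst hkn; simp [hmdef]
      · simp only [hkn, if_false, zero_add]
        exact (lintegral_truncAbs_le_enorm _ _).trans (Finset.single_le_sum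
          (f := fun k => ∫⁻ ω, ‖X k ω‖ₑ ∂P) (fun _ _ => zero_le)
          (Finset.mem_range.2 (lt_of_le_of_ne hk hkn)))
    calc m ≤ _ := hX.lintegral_truncAbs_le (hp := hp) hT hn M
      _ ≤ ∑ k ∈ Finset.range (n + 1), ENNReal.ofReal (binWeight p n k) *
          ((if k = n then m else 0) + (if k = 0 then m else 0) + (B + B + τ)) := by
          refine Finset.sum_le_sum fun k hkm => ?_
          have hk' : k ≤ n := Nat.lt_succ_iff.1 (Finset.mem_range.1 hkm)
          refine mul_le_mul' le_rfl ?_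
          have e : (n - k = n) ↔ k = 0 := by omega
          have h2 := hk (n - k) (Nat.sub_le _ _)
          simp only [e] at h2
          calc _ ≤ ((if k = n then m else 0) + B) + ((if k = 0 then m else 0) + B) + τ := by
                exact add_le_add (add_le_add (hk k hk') h2) le_rfl
            _ = _ := by abel
      _ = ENNReal.ofReal (p ^ n + (1 - p) ^ n) * m + (B + B + τ) := by
          simp_rw [mul_add (ENNReal.ofReal _) _ (B + B + τ), Finset.sum_add_distrib,
            ← Finset.sum_mul]
          rw [← ENNReal.ofReal_sum_of_nonneg fun k _ => binWeight_nonneg hp n k, sum_binWeight,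
            ENNReal.ofReal_one, one_mul]
          congr 1
          simp_rw [mul_add, Finset.sum_add_distrib, mul_ite, mul_zero]
          rw [Finset.sum_ite_eq' , Finset.sum_ite_eq', if_pos (by simp), if_pos (by simp),
            binWeight_self, binWeight_zero_right, ENNReal.ofReal_add (by positivity)
            (by positivity), add_mul]
  · have : n = 0 ∨ n = 1 := by omega
    rcases this with rfl | rfl
    · exact (integrable_zero _ _ _).congr hX.X_zero.symm
    · exact (integrable_zero _ _ _).congr hX.X_one.symm

lemma integral_deltaFun_mul {N Y : Ω → ℝ} (hN : AEMeasurable N P) (hY : Integrable Y P)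
    (hi : IndepFun N Y P) (k : ℕ) :
    Integrable (fun ω => deltaFun k (N ω) * Y ω) P ∧
    ∫ ω, deltaFun k (N ω) * Y ω ∂P = (∫ ω, deltaFun k (N ω) ∂P) * ∫ ω, Y ω ∂P := by
  have hi' : IndepFun (fun ω => deltaFun k (N ω)) Y P :=
    hi.comp (measurable_deltaFun k) measurable_id
  exact ⟨hi'.integrable_mul (integrable_deltaFun hN k) hY,
    hi'.integral_mul_eq_mul_integral (integrable_deltaFun hN k).aestronglyMeasurable
      hY.aestronglyMeasurable⟩

/-- The recurrence of the means. -/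
theorem TrieRecurrence.integral_eq
    (hX : TrieRecurrence P ⟨p, Set.Ioo_subset_Icc_self hp⟩ X Xs I T)
    (hT : ∀ n, Integrable (T n) P) {n : ℕ} (hn : 2 ≤ n) :
    ∫ ω, X n ω ∂P = ∑ k ∈ Finset.range (n + 1), binWeight p n k *
      (∫ ω, X k ω ∂P + ∫ ω, X (n - k) ω ∂P) + ∫ ω, T n ω ∂P := by
  have hN := hX.aemeasurable_natCast (hp := hp) hn
  have hXi := hX.integrable (hp := hp) hT
  have hXsi : ∀ k, Integrable (Xs k) P := fun k => (hX.copy k).integrable_iff.2 (hXi k)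
  have key : ∀ k ∈ Finset.range (n + 1), Integrable (fun ω => deltaFun k (I n ω) * X k ω +
      deltaFun k (I n ω) * Xs (n - k) ω + deltaFun k (I n ω) * T n ω) P ∧
      ∫ ω, (deltaFun k (I n ω) * X k ω +
      deltaFun k (I n ω) * Xs (n - k) ω + deltaFun k (I n ω) * T n ω) ∂P = binWeight p n k *
      (∫ ω, X k ω ∂P + ∫ ω, X (n - k) ω ∂P) + binWeight p n k * ∫ ω, T n ω ∂P := by
    intro k hk
    have hk' : k ≤ n := Nat.lt_succ_iff.1 (Finset.mem_range.1 hk)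
    obtain ⟨i1, i2, i3⟩ := hX.indepFuns (hp := hp) hn hk'
    obtain ⟨j1, e1⟩ := integral_deltaFun_mul hN (hXi k) i1 k
    obtain ⟨j2, e2⟩ := integral_deltaFun_mul hN (hXsi (n - k)) i2 k
    obtain ⟨j3, e3⟩ := integral_deltaFun_mul hN (hT n) i3 k
    refine ⟨(j1.add j2).add j3, ?_⟩
    have j12 : Integrable (fun ω => deltaFun k (I n ω) * X k ω +
      deltaFun k (I n ω) * Xs (n - k) ω) P := j1.add j2
    rw [integral_add j12 j3, integral_add j1 j2, e1, e2, e3,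
      integral_deltaFun_of_hasLaw (hp := hp) (hX.splitting n hn), (hX.copy (n - k)).integral_eq]
    ring
  calc ∫ ω, X n ω ∂P = ∫ ω, X (I n ω) ω + Xs (n - I n ω) ω + T n ω ∂P :=
        (hX.recurrence n hn).integral_eq
    _ = ∫ ω, ∑ k ∈ Finset.range (n + 1), (deltaFun k (I n ω) * X k ω +
      deltaFun k (I n ω) * Xs (n - k) ω + deltaFun k (I n ω) * T n ω) ∂P := by
        refine integral_congr_ae ?_
        filter_upwards [hX.ae_le (hp := hp) hn] with ω hω
        rw [Finset.sum_eq_single_of_mem (I n ω) (by simpa [Nat.lt_succ_iff] using hω)]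
        · simp [deltaFun_natCast]
        · intro k _ hk
          simp [deltaFun_natCast, hk.symm]
    _ = _ := by
        rw [integral_finsetSum _ fun k hk => (key k hk).1,
          Finset.sum_congr rfl fun k hk => (key k hk).2, Finset.sum_add_distrib, ← Finset.sum_mul,
          sum_binWeight, one_mul]

end Prob

/-! ### The entire generating function of the means -/

/-- The coefficients of an everywhere convergent power series decay faster than geometrically. -/
def EntireCoeff (a : ℕ → ℂ) : Prop := ∀ ρ : ℝ, 0 < ρ → ∃ C : ℝ, ∀ n, ‖a n‖ * ρ ^ n ≤ C

lemma EntireCoeff.summable_norm {a : ℕ → ℂ} (ha : EntireCoeff a) (r : ℝ) :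
    Summable fun n => ‖a n‖ * |r| ^ n := by
  -- The summand 1 keeps the comparison radius positive when r = 0.
  obtain ⟨C, hC⟩ := ha (2 * |r| + 1) (by positivity)
  have hlt : |r| / (2 * |r| + 1) < 1 := by
    rw [div_lt_one (by positivity)]; linarith [abs_nonneg r]
  refine Summable.of_nonneg_of_le (fun n => by positivity) (fun n => ?_)
    ((summable_geometric_of_lt_one (by positivity) hlt).mul_left C)
  calc ‖a n‖ * |r| ^ n = (‖a n‖ * (2 * |r| + 1) ^ n) * (|r| / (2 * |r| + 1)) ^ n := by
        rw [div_pow]; field_simp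
    _ ≤ C * (|r| / (2 * |r| + 1)) ^ n := by gcongr; exact hC n

lemma EntireCoeff.summable_norm_term {a : ℕ → ℂ} (ha : EntireCoeff a) (z : ℂ) :
    Summable fun n => ‖a n * z ^ n‖ := by
  simpa [norm_mul, norm_pow] using ha.summable_norm ‖z‖

lemma entireCoeff_of_summable {a : ℕ → ℂ} (h : ∀ z : ℂ, Summable fun n => a n * z ^ n) :
    EntireCoeff a := fun ρ hρ => by
  obtain ⟨C, hC⟩ := (h ρ).tendsto_atTop_zero.norm.bddAbove_range
  refine ⟨C, fun n => ?_⟩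
  have := hC ⟨n, rfl⟩
  simpa [norm_mul, norm_pow, abs_of_pos hρ] using this

lemma EntireCoeff.differentiable {a : ℕ → ℂ} (ha : EntireCoeff a) :
    Differentiable ℂ fun z => ∑' n, a n * z ^ n := by
  intro z
  have hd : DifferentiableOn ℂ (fun w => ∑' n, a n * w ^ n) (Metric.ball 0 (‖z‖ + 1)) := by
    refine Complex.differentiableOn_tsum_of_summable_norm (ha.summable_norm (‖z‖ + 1))
      (fun n => by fun_prop) Metric.isOpen_ball fun n w hw => ?_
    rw [norm_mul, norm_pow, abs_of_nonneg (by positivity)]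
    gcongr
    exact (mem_ball_zero_iff.1 hw).le
  exact hd.differentiableAt (Metric.isOpen_ball.mem_nhds (by simp))

/-- The factor |z|² comes out of every term. The resulting double zero fixes the left edge -2 of the
Mellin strip and makes the window sums vanish at -∞. -/
lemma EntireCoeff.norm_tsum_le_sq {a : ℕ → ℂ} (ha : EntireCoeff a) (h0 : a 0 = 0) (h1 : a 1 = 0) :
    ∃ C : ℝ, 0 ≤ C ∧ ∀ z : ℂ, ‖z‖ ≤ 1 → ‖∑' n, a n * z ^ n‖ ≤ C * ‖z‖ ^ 2 := by
  have hs : Summable fun n => ‖a n‖ := by simpa using ha.summable_norm 1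
  refine ⟨∑' n, ‖a n‖, tsum_nonneg fun n => norm_nonneg _, fun z hz => ?_⟩
  rw [← tsum_mul_right]
  refine tsum_of_norm_bounded (hs.mul_right _).hasSum fun n => ?_
  rw [norm_mul, norm_pow]
  match n with
  | 0 => simp [h0]
  | 1 => simp [h1]
  | n + 2 =>
    have := pow_le_pow_of_le_one (norm_nonneg z) hz (show 2 ≤ n + 2 by omega)
    gcongr

/-- A Cauchy product with an exponential series. -/
lemma EntireCoeff.hasSum_mul_exp {a : ℕ → ℂ} (ha : EntireCoeff a) (u v z : ℂ) :
    HasSum (fun n => (∑ ij ∈ Finset.HasAntidiagonal.antidiagonal n, u ^ ij.1 * a ij.1 *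
      (v ^ ij.2 / (ij.2.factorial : ℂ))) * z ^ n)
      ((∑' n, a n * (u * z) ^ n) * Complex.exp (v * z)) := by
  have h1 := ha.summable_norm_term (u * z)
  have h2 : Summable fun n => ‖(v * z) ^ n / (n.factorial : ℂ)‖ :=
    NormedSpace.norm_expSeries_div_summable (v * z)
  have h3 : ∑' n, (v * z) ^ n / (n.factorial : ℂ) = Complex.exp (v * z) := by
    rw [Complex.exp_eq_exp_ℂ, NormedSpace.exp_eq_tsum_div]
  have h4 := summable_norm_sum_mul_antidiagonal_of_summable_norm h1 h2
  have h5 := tsum_mul_tsum_eq_tsum_sum_antidiagonal_of_summable_norm h1 h2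
  rw [h3] at h5
  rw [h5]
  have h6 := h4.of_norm.hasSum
  refine h6.congr_fun fun n => ?_
  rw [Finset.sum_mul]
  refine Finset.sum_congr rfl fun ij hij => ?_
  rw [← Finset.HasAntidiagonal.mem_antidiagonal.1 hij]
  ring

/-- A sequence that is bounded by a small multiple of its running maximum plus a constant is
bounded. -/
lemma exists_bound_of_le_half {A s : ℕ → ℝ} {C : ℝ} (hs : Tendsto s atTop (𝓝 0))
    (h : ∀ n D, 0 ≤ D → (∀ k ≤ n, A k ≤ D) → A n ≤ s n * D + C) (hA : ∀ n, 0 ≤ A n) :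
    ∃ D, ∀ n, A n ≤ D := by
  obtain ⟨N, hN⟩ := eventually_atTop.1 (hs.eventually (ge_mem_nhds (show (0 : ℝ) < 1 / 2 by norm_num)))
  set D := ∑ k ∈ Finset.range N, A k + 2 * |C|
  have hD : 0 ≤ D := add_nonneg (Finset.sum_nonneg fun k _ => hA k) (by positivity)
  refine ⟨D, fun n => ?_⟩
  induction n using Nat.strong_induction_on with
  | _ n ih =>
  by_cases hn : n < N
  · exact (Finset.single_le_sum (fun k _ => hA k) (Finset.mem_range.2 hn)).trans
      (le_add_of_nonneg_right (by positivity))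
  · by_contra hlt
    push Not at hlt hn
    -- If A n exceeded D it would be the running maximum up to n, so the hypothesis may be applied
    -- with A n in place of D.
    have h1 := h n (A n) (hA n) fun k hk => by
      rcases hk.lt_or_eq with hk | rfl
      · exact (ih k hk).trans hlt.le
      · exact le_rfl
    have h2 : s n * A n ≤ 1 / 2 * A n := mul_le_mul_of_nonneg_right (hN n hn) (hA n)
    have h3 : 2 * |C| ≤ D := le_add_of_nonneg_left (Finset.sum_nonneg fun k _ => hA k)
    linarith [le_abs_self C]

/-- Taking out u^n leaves a partial sum of the exponential series at v / u. -/
lemma sum_antidiagonal_pow_le {u v : ℝ} (hu : 0 < u) (hv : 0 ≤ v) (n : ℕ) :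
    ∑ ij ∈ Finset.HasAntidiagonal.antidiagonal n, u ^ ij.1 * (v ^ ij.2 / (ij.2.factorial : ℝ)) ≤
      u ^ n * Real.exp (v / u) := by
  have h1 : ∀ ij ∈ Finset.HasAntidiagonal.antidiagonal n, u ^ ij.1 * (v ^ ij.2 / (ij.2.factorial : ℝ)) =
      u ^ n * ((v / u) ^ ij.2 / (ij.2.factorial : ℝ)) := fun ij hij => by
    rw [← Finset.HasAntidiagonal.mem_antidiagonal.1 hij, pow_add, div_pow]
    field_simp
  rw [Finset.sum_congr rfl h1, ← Finset.mul_sum]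
  refine mul_le_mul_of_nonneg_left ?_ (by positivity)
  rw [Finset.Nat.sum_antidiagonal_eq_sum_range_succ_mk, ← Finset.sum_range_reflect]
  refine le_trans (le_of_eq ?_) (Real.sum_le_exp_of_nonneg (by positivity : 0 ≤ v / u) (n + 1))
  refine Finset.sum_congr rfl fun k hk => ?_
  have : k ≤ n := Nat.lt_succ_iff.1 (Finset.mem_range.1 hk)
  have e : n - (n + 1 - 1 - k) = k := by omega
  simp only [e]

/-- The coefficients of the solution of the Poissonized recurrence. -/
lemma entireCoeff_of_recurrence {p : ℝ} (hp : p ∈ Set.Ioo (0 : ℝ) 1) {a τ : ℕ → ℂ}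
    (hτ : EntireCoeff τ)
    (h : ∀ n, a n = ∑ ij ∈ Finset.HasAntidiagonal.antidiagonal n, (p : ℂ) ^ ij.1 * a ij.1 *
        ((1 - p : ℂ) ^ ij.2 / (ij.2.factorial : ℂ)) +
      ∑ ij ∈ Finset.HasAntidiagonal.antidiagonal n, (1 - p : ℂ) ^ ij.1 * a ij.1 *
        ((p : ℂ) ^ ij.2 / (ij.2.factorial : ℂ)) + τ n) : EntireCoeff a := by
  intro ρ hρ
  obtain ⟨C, hC⟩ := hτ ρ hρ
  have hp0 := hp.1
  have hq : 0 < 1 - p := sub_pos.2 hp.2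
  have hnp : ‖(p : ℂ)‖ = p := by rw [Complex.norm_real, Real.norm_of_nonneg hp0.le]
  have hnq : ‖(1 - p : ℂ)‖ = 1 - p := by
    rw [← Complex.ofReal_one, ← Complex.ofReal_sub, Complex.norm_real, Real.norm_of_nonneg hq.le]
  have key : ∀ (u v : ℝ) (u' v' : ℂ), 0 < u → 0 < v → ‖u'‖ = u → ‖v'‖ = v → ∀ n D, 0 ≤ D →
      (∀ k ≤ n, ‖a k‖ * ρ ^ k ≤ D) →
      ‖∑ ij ∈ Finset.HasAntidiagonal.antidiagonal n, u' ^ ij.1 * a ij.1 * (v' ^ ij.2 / (ij.2.factorial : ℂ))‖ *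
        ρ ^ n ≤ u ^ n * Real.exp (v * ρ / u) * D := by
    intro u v u' v' hu hv hu' hv' n D hD hk
    calc _ ≤ (∑ ij ∈ Finset.HasAntidiagonal.antidiagonal n, ‖u' ^ ij.1 * a ij.1 *
            (v' ^ ij.2 / (ij.2.factorial : ℂ))‖) * ρ ^ n :=
          mul_le_mul_of_nonneg_right (norm_sum_le _ _) (by positivity)
      _ ≤ (∑ ij ∈ Finset.HasAntidiagonal.antidiagonal n, u ^ ij.1 * ((v * ρ) ^ ij.2 / (ij.2.factorial : ℝ))) *
            D := by
          rw [Finset.sum_mul, Finset.sum_mul]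
          refine Finset.sum_le_sum fun ij hij => ?_
          have hle : ij.1 ≤ n := by have := Finset.HasAntidiagonal.mem_antidiagonal.1 hij; omega
          have e : ‖u' ^ ij.1 * a ij.1 * (v' ^ ij.2 / (ij.2.factorial : ℂ))‖ * ρ ^ n =
              u ^ ij.1 * ((v * ρ) ^ ij.2 / (ij.2.factorial : ℝ)) * (‖a ij.1‖ * ρ ^ ij.1) := by
            rw [← Finset.HasAntidiagonal.mem_antidiagonal.1 hij, norm_mul, norm_mul, norm_div, norm_pow, norm_pow,
              hu', hv', Complex.norm_natCast]
            ring
          rw [e]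
          exact mul_le_mul_of_nonneg_left (hk _ hle) (by positivity)
      _ ≤ _ := mul_le_mul_of_nonneg_right (sum_antidiagonal_pow_le hu (by positivity) n) hD
  -- The two convolutions multiply the running maximum of |a_k| ρ^k by a factor that tends to 0,
  -- whatever ρ is. Hence no radius of convergence is lost.
  have hs : Tendsto (fun n => p ^ n * Real.exp ((1 - p) * ρ / p) +
      (1 - p) ^ n * Real.exp (p * ρ / (1 - p))) atTop (𝓝 0) := by
    have e1 := (tendsto_pow_atTop_nhds_zero_of_lt_one hp0.le hp.2).mul_const
      (Real.exp ((1 - p) * ρ / p))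
    have e2 := (tendsto_pow_atTop_nhds_zero_of_lt_one hq.le (by linarith)).mul_const
      (Real.exp (p * ρ / (1 - p)))
    simpa using e1.add e2
  refine exists_bound_of_le_half hs (C := C) (fun n D hD hk => ?_) (fun n => by positivity)
  have k1 := key p (1 - p) p (1 - p) hp0 hq hnp hnq n D hD hk
  have k2 := key (1 - p) p (1 - p) p hq hp0 hnq hnp n D hD hk
  have k3 := hC n
  have hρn : 0 ≤ ρ ^ n := by positivity
  calc ‖a n‖ * ρ ^ n ≤ _ := mul_le_mul_of_nonneg_right
        ((congrArg norm (h n)).le.trans (norm_add₃_le)) hρn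
    _ ≤ _ := by
      rw [add_mul, add_mul, add_mul]
      exact add_le_add (add_le_add k1 k2) k3

/-- The binomial recurrence for a sequence in terms of `a n = x n / n!`. -/
lemma div_factorial_recurrence {p : ℝ} {x t : ℕ → ℝ}
    (h : ∀ n, x n = ∑ k ∈ Finset.range (n + 1), binWeight p n k * (x k + x (n - k)) + t n) (n : ℕ) :
    ((x n : ℂ) / (n.factorial : ℂ)) =
      ∑ ij ∈ Finset.HasAntidiagonal.antidiagonal n, (p : ℂ) ^ ij.1 * ((x ij.1 : ℂ) / (ij.1.factorial : ℂ)) *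
        ((1 - p : ℂ) ^ ij.2 / (ij.2.factorial : ℂ)) +
      ∑ ij ∈ Finset.HasAntidiagonal.antidiagonal n, (1 - p : ℂ) ^ ij.1 * ((x ij.1 : ℂ) / (ij.1.factorial : ℂ)) *
        ((p : ℂ) ^ ij.2 / (ij.2.factorial : ℂ)) + (t n : ℂ) / (n.factorial : ℂ) := by
  -- Swapping the second sum aligns its factor x_{n-k} with the same binomial weight as x_k.
  rw [← Finset.Nat.sum_antidiagonal_swap (n := n) (f := fun ij => (1 - p : ℂ) ^ ij.1 *
    ((x ij.1 : ℂ) / (ij.1.factorial : ℂ)) * ((p : ℂ) ^ ij.2 / (ij.2.factorial : ℂ))),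
    ← Finset.sum_add_distrib, Finset.Nat.sum_antidiagonal_eq_sum_range_succ_mk, h n]
  push_cast
  rw [add_div, Finset.sum_div]
  congr 1
  refine Finset.sum_congr rfl fun k hk => ?_
  have hk' : k ≤ n := Nat.lt_succ_iff.1 (Finset.mem_range.1 hk)
  have f1 : (n.factorial : ℂ) ≠ 0 := by exact_mod_cast n.factorial_ne_zero
  have f2 : (k.factorial : ℂ) ≠ 0 := by exact_mod_cast k.factorial_ne_zero
  have f3 : ((n - k).factorial : ℂ) ≠ 0 := by exact_mod_cast (n - k).factorial_ne_zero
  have hc : (n.choose k : ℂ) * k.factorial * (n - k).factorial = n.factorial := by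
    exact_mod_cast Nat.choose_mul_factorial_mul_factorial hk'
  unfold binWeight
  push_cast
  simp only [Prod.swap_prod_mk]
  field_simp
  rw [← hc]
  ring

/-- The exponential generating function of the means. -/
theorem exists_egf {p : ℝ} (hp : p ∈ Set.Ioo (0 : ℝ) 1) {x t : ℕ → ℝ} (hx0 : x 0 = 0)
    (hx1 : x 1 = 0)
    (h : ∀ n, x n = ∑ k ∈ Finset.range (n + 1), binWeight p n k * (x k + x (n - k)) + t n)
    {g : ℂ → ℂ} (hg : IsPoissonGF t g) :
    ∃ A : ℂ → ℂ, Differentiable ℂ A ∧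
      (∀ z, HasSum (fun n : ℕ => (x n : ℂ) / (n.factorial : ℂ) * z ^ n) (A z)) ∧
      (∀ z, A z = A (p * z) * Complex.exp ((1 - p) * z) + A ((1 - p) * z) * Complex.exp (p * z) +
        Complex.exp z * g z) ∧
      ∃ C : ℝ, 0 ≤ C ∧ ∀ z, ‖z‖ ≤ 1 → ‖A z‖ ≤ C * ‖z‖ ^ 2 := by
  have hτ : EntireCoeff fun n => (t n : ℂ) / (n.factorial : ℂ) :=
    entireCoeff_of_summable fun z => (hg z).summable
  have ha : EntireCoeff fun n => (x n : ℂ) / (n.factorial : ℂ) :=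
    entireCoeff_of_recurrence hp hτ (div_factorial_recurrence h)
  refine ⟨fun z => ∑' n, (x n : ℂ) / (n.factorial : ℂ) * z ^ n, ha.differentiable,
    fun z => (ha.summable_norm_term z).of_norm.hasSum, fun z => ?_,
    ha.norm_tsum_le_sq (by simp [hx0]) (by simp [hx1])⟩
  have h1 := ((ha.hasSum_mul_exp p (1 - p) z).add (ha.hasSum_mul_exp (1 - p) p z)).add (hg z)
  rw [← h1.tsum_eq]
  refine tsum_congr fun n => ?_
  rw [← add_mul, ← add_mul, ← div_factorial_recurrence h n]

lemma IsPoissonGF.norm_le_sq {t : ℕ → ℝ} {g : ℂ → ℂ} (hg : IsPoissonGF t g) (h0 : t 0 = 0)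
    (h1 : t 1 = 0) : ∃ C : ℝ, 0 ≤ C ∧ ∀ z, ‖z‖ ≤ 1 → ‖Complex.exp z * g z‖ ≤ C * ‖z‖ ^ 2 := by
  have hτ : EntireCoeff fun n => (t n : ℂ) / (n.factorial : ℂ) :=
    entireCoeff_of_summable fun z => (hg z).summable
  obtain ⟨C, hC0, hC⟩ := hτ.norm_tsum_le_sq (by simp [h0]) (by simp [h1])
  exact ⟨C, hC0, fun z hz => by rw [← (hg z).tsum_eq]; exact hC z hz⟩

/-- The recurrence of the means, for all indices. -/
lemma TrieRecurrence.means {Ω : Type*} [MeasurableSpace Ω] {P : Measure Ω} [IsProbabilityMeasure P]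
    {p : ℝ} (hp : p ∈ Set.Ioo (0 : ℝ) 1) {X Xs : ℕ → Ω → ℝ} {I : ℕ → Ω → ℕ} {T : ℕ → Ω → ℝ}
    (hX : TrieRecurrence P ⟨p, Set.Ioo_subset_Icc_self hp⟩ X Xs I T)
    (hT : ∀ n, Integrable (T n) P) :
    ∫ ω, X 0 ω ∂P = 0 ∧ ∫ ω, X 1 ω ∂P = 0 ∧ ∫ ω, T 0 ω ∂P = 0 ∧ ∫ ω, T 1 ω ∂P = 0 ∧
    ∀ n, ∫ ω, X n ω ∂P = ∑ k ∈ Finset.range (n + 1), binWeight p n k *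
      (∫ ω, X k ω ∂P + ∫ ω, X (n - k) ω ∂P) + ∫ ω, T n ω ∂P := by
  have hx0 : ∫ ω, X 0 ω ∂P = 0 := by rw [integral_congr_ae hX.X_zero]; simp
  have hx1 : ∫ ω, X 1 ω ∂P = 0 := by rw [integral_congr_ae hX.X_one]; simp
  have ht0 : ∫ ω, T 0 ω ∂P = 0 := by rw [integral_congr_ae hX.T_zero]; simp
  have ht1 : ∫ ω, T 1 ω ∂P = 0 := by rw [integral_congr_ae hX.T_one]; simp
  refine ⟨hx0, hx1, ht0, ht1, fun n => ?_⟩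
  -- The recurrence is given only for n ≥ 2. For n = 0, 1 both sides vanish by the initial
  -- conditions.
  match n with
  | 0 => simp [hx0, ht0]
  | 1 => simp [Finset.sum_range_succ, hx0, hx1, ht1]
  | n + 2 => exact hX.integral_eq (hp := hp) hT (by omega)

/-! ### Renewal equation: asymptotic periods and the nonarithmetic case -/

/-- A bounded Lipschitz solution `U` on `[-B, ∞)` of a renewal equation with two jumps `a, b`, taken
with probabilities `p, 1 - p`, and an exponentially small inhomogeneity `W` on `[0, ∞)`. -/
structure RenewalEq (p a b B K L C δ : ℝ) (U W : ℝ → ℂ) : Prop where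
  p_mem : p ∈ Set.Ioo (0 : ℝ) 1
  a_pos : 0 < a
  b_pos : 0 < b
  a_le : a ≤ B
  b_le : b ≤ B
  δ_pos : 0 < δ
  continuous_U : Continuous U
  continuous_W : Continuous W
  eq : ∀ t, U t = p * U (t - a) + (1 - p) * U (t - b) + W t
  bound : ∀ t, -B ≤ t → ‖U t‖ ≤ K
  lip : ∀ s t, -B ≤ s → -B ≤ t → ‖U s - U t‖ ≤ L * |s - t|
  decay : ∀ t, 0 ≤ t → ‖W t‖ ≤ C * Real.exp (-δ * t)

/-- The conservation law of the renewal equation. -/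
lemma window_integral_sub {E : Type*} [NormedAddCommGroup E] [NormedSpace ℝ E] [CompleteSpace E]
    {φ : ℝ → E} (hφ : Continuous φ) (p a b T t : ℝ) :
    (p • (∫ s in (t - a)..t, φ s) + (1 - p) • ∫ s in (t - b)..t, φ s) -
      (p • (∫ s in (T - a)..T, φ s) + (1 - p) • ∫ s in (T - b)..T, φ s) =
    ∫ s in T..t, (φ s - p • φ (s - a) - (1 - p) • φ (s - b)) := by
  have hi : ∀ x y, IntervalIntegrable φ volume x y := fun x y => hφ.intervalIntegrable x y
  have hs : ∀ d, (∫ s in (t - d)..t, φ s) - ∫ s in (T - d)..T, φ s =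
      (∫ s in T..t, φ s) - ∫ s in T..t, φ (s - d) := fun d => by
    rw [intervalIntegral.integral_comp_sub_right (fun x => φ x),
      ← intervalIntegral.integral_add_adjacent_intervals (hi (t - d) T) (hi T t),
      ← intervalIntegral.integral_add_adjacent_intervals (hi (T - d) (t - d)) (hi (t - d) T)]
    abel
  have hia : IntervalIntegrable (fun s => p • φ (s - a)) volume T t :=
    Continuous.intervalIntegrable (by fun_prop) _ _
  have hib : IntervalIntegrable (fun s => (1 - p) • φ (s - b)) volume T t :=
    Continuous.intervalIntegrable (by fun_prop) _ _
  rw [intervalIntegral.integral_sub ((hi T t).sub hia) hib, intervalIntegral.integral_sub (hi T t) hia,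
    intervalIntegral.integral_smul, intervalIntegral.integral_smul]
  have ea := hs a
  have eb := hs b
  calc _ = p • ((∫ s in (t - a)..t, φ s) - ∫ s in (T - a)..T, φ s) +
        (1 - p) • ((∫ s in (t - b)..t, φ s) - ∫ s in (T - b)..T, φ s) := by
        rw [smul_sub, smul_sub]; abel
    _ = _ := by rw [ea, eb]; module

/-- A nonnegative Lipschitz function with bounded primitive tends to zero. -/
lemma tendsto_zero_of_integral_bounded {φ : ℝ → ℝ} (hc : Continuous φ) {L M : ℝ}
    (h0 : ∀ t, 0 ≤ t → 0 ≤ φ t) (hL : ∀ s t, 0 ≤ s → 0 ≤ t → |φ s - φ t| ≤ L * |s - t|)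
    (hM : ∀ t, 0 ≤ t → ∫ s in (0 : ℝ)..t, φ s ≤ M) : Tendsto φ atTop (𝓝 0) := by
  have hi : ∀ x y, IntervalIntegrable φ volume x y := fun x y => hc.intervalIntegrable x y
  -- Cutting off at 0 makes the primitive monotone and bounded on the whole line, hence convergent
  -- at +∞.
  set V : ℝ → ℝ := fun t => ∫ s in (0 : ℝ)..(max t 0), φ s with hV
  have hmono : Monotone V := fun s t hst => by
    have h1 : max s 0 ≤ max t 0 := max_le_max hst le_rfl
    have h2 := intervalIntegral.integral_add_adjacent_intervals (hi 0 (max s 0))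
      (hi (max s 0) (max t 0))
    have h3 : 0 ≤ ∫ u in (max s 0)..(max t 0), φ u :=
      intervalIntegral.integral_nonneg h1 fun u hu => h0 u ((le_max_right _ _).trans hu.1)
    simp only [hV]
    linarith
  have hlim : Tendsto V atTop (𝓝 (⨆ t, V t)) :=
    tendsto_atTop_ciSup hmono ⟨M, by rintro _ ⟨t, rfl⟩; exact hM _ (le_max_right _ _)⟩
  have hL0 : 0 ≤ L := by simpa using (abs_nonneg _).trans (hL 1 0 zero_le_one le_rfl)
  rw [Metric.tendsto_atTop]
  intro ε hε
  -- Over a length η the function drops by less than ε/2. A value of at least ε at t would thus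
  -- force the primitive to grow by at least η ε/2 on [t, t + η].
  set η : ℝ := ε / (2 * (L + 1)) with hη
  have hη0 : 0 < η := by positivity
  have hdiff : Tendsto (fun t => V (t + η) - V t) atTop (𝓝 0) := by
    simpa using (hlim.comp (tendsto_atTop_add_const_right _ η tendsto_id)).sub hlim
  obtain ⟨N, hN⟩ := Metric.tendsto_atTop.1 hdiff (η * (ε / 2)) (by positivity)
  refine ⟨max N 0, fun t ht => ?_⟩
  have ht0 : 0 ≤ t := (le_max_right _ _).trans ht
  have h1 := hN t ((le_max_left _ _).trans ht)
  have h2 : V (t + η) - V t = ∫ s in t..(t + η), φ s := by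
    simp only [hV]
    rw [max_eq_left ht0, max_eq_left (by linarith),
      ← intervalIntegral.integral_add_adjacent_intervals (hi 0 t) (hi t (t + η))]
    ring
  have h3 : ∫ _ in t..(t + η), (φ t - L * η) ≤ ∫ s in t..(t + η), φ s := by
    refine intervalIntegral.integral_mono_on (by linarith) (by simp) (hi _ _) fun s hs => ?_
    have h4 := (abs_le.1 (hL s t (ht0.trans hs.1) ht0)).1
    have h5 : |s - t| ≤ η := by rw [abs_of_nonneg (by linarith [hs.1])]; linarith [hs.2]
    nlinarith
  rw [intervalIntegral.integral_const, add_sub_cancel_left, smul_eq_mul, ← h2] at h3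
  rw [Real.dist_eq, sub_zero] at h1
  have h6 : η * (φ t - L * η) < η * (ε / 2) := h3.trans_lt ((le_abs_self _).trans_lt h1)
  have h7 := lt_of_mul_lt_mul_left h6 hη0.le
  have h8 : L * η < ε / 2 := by
    rw [hη, ← mul_div_assoc, div_lt_div_iff₀ (by positivity) (by positivity)]; nlinarith
  rw [Real.dist_eq, sub_zero, abs_of_nonneg (h0 t ht0)]
  linarith

/-- The variance identity for a two-point law. The last term is the energy lost in one averaging
step. -/
lemma norm_sq_convex_comb (p : ℝ) (A B : ℂ) :
    ‖(p : ℂ) * A + (1 - p) * B‖ ^ 2 =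
      p * ‖A‖ ^ 2 + (1 - p) * ‖B‖ ^ 2 - p * (1 - p) * ‖A - B‖ ^ 2 := by
  simp only [Complex.sq_norm, Complex.normSq_apply, Complex.add_re, Complex.add_im, Complex.mul_re,
    Complex.mul_im, Complex.sub_re, Complex.sub_im, Complex.ofReal_re, Complex.ofReal_im,
    Complex.one_re, Complex.one_im]
  ring

lemma norm_sq_sub_ge (u w : ℂ) : ‖u‖ ^ 2 - 2 * ‖u‖ * ‖w‖ ≤ ‖u - w‖ ^ 2 := by
  have h1 := norm_sub_norm_le u w
  have h2 := norm_sub_norm_le w u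
  rw [norm_sub_rev w u] at h2
  nlinarith [norm_nonneg w, norm_nonneg (u - w), sq_abs (‖u‖ - ‖w‖),
    abs_le_abs h1 (by linarith), sq_nonneg ‖w‖]

namespace RenewalEq

variable {p a b B K L C δ : ℝ} {U W : ℝ → ℂ}

lemma K_nonneg (h : RenewalEq p a b B K L C δ U W) : 0 ≤ K :=
  (norm_nonneg _).trans (h.bound 0 (by linarith [h.a_pos, h.a_le]))

lemma C_nonneg (h : RenewalEq p a b B K L C δ U W) : 0 ≤ C := by
  simpa using (norm_nonneg _).trans (h.decay 0 le_rfl)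

lemma L_nonneg (h : RenewalEq p a b B K L C δ U W) : 0 ≤ L := by
  have hB : 0 < B := h.a_pos.trans_le h.a_le
  simpa using (norm_nonneg _).trans (h.lip 1 0 (by linarith) (by linarith))

lemma tendsto_W (h : RenewalEq p a b B K L C δ U W) : Tendsto W atTop (𝓝 0) := by
  have h1 : Tendsto (fun t : ℝ => C * Real.exp (-δ * t)) atTop (𝓝 0) := by
    have : Tendsto (fun t : ℝ => -δ * t) atTop atBot :=
      tendsto_id.const_mul_atTop_of_neg (by linarith [h.δ_pos])
    simpa using (Real.tendsto_exp_atBot.comp this).const_mul C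
  exact squeeze_zero_norm' ((eventually_ge_atTop 0).mono fun t ht => h.decay t ht) h1

lemma integral_norm_W_le (h : RenewalEq p a b B K L C δ U W) {t : ℝ} (ht : 0 ≤ t) :
    ∫ s in (0 : ℝ)..t, ‖W s‖ ≤ C / δ := by
  have hδ := h.δ_pos
  have h1 : ∫ s in (0 : ℝ)..t, ‖W s‖ ≤ ∫ s in (0 : ℝ)..t, C * Real.exp (-δ * s) :=
    intervalIntegral.integral_mono_on ht (h.continuous_W.norm.intervalIntegrable _ _)
      (Continuous.intervalIntegrable (by fun_prop) _ _) fun s hs => h.decay s hs.1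
  have h2 : ∫ s in (0 : ℝ)..t, C * Real.exp (-δ * s) = C / δ - C / δ * Real.exp (-δ * t) := by
    have hne : -δ ≠ 0 := by linarith
    rw [intervalIntegral.integral_const_mul,
      intervalIntegral.integral_comp_mul_left (fun x => Real.exp x) hne, integral_exp]
    simp only [smul_eq_mul, mul_zero, Real.exp_zero]
    field_simp
    ring
  have h3 : 0 ≤ C / δ * Real.exp (-δ * t) := mul_nonneg (div_nonneg h.C_nonneg hδ.le) (Real.exp_nonneg _)
  linarith

/-- The key estimate: the values reached by the two jumps approach each other. -/
lemma tendsto_sub (h : RenewalEq p a b B K L C δ U W) :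
    Tendsto (fun t => U (t - a) - U (t - b)) atTop (𝓝 0) := by
  have hp0 := h.p_mem.1
  have hq : 0 < 1 - p := sub_pos.2 h.p_mem.2
  have hcU := h.continuous_U
  have hK := h.K_nonneg
  have hL := h.L_nonneg
  have hB : 0 < B := h.a_pos.trans_le h.a_le
  set φ : ℝ → ℝ := fun t => ‖U (t - a) - U (t - b)‖ ^ 2 with hφ
  have hcφ : Continuous φ := by fun_prop
  have hsq : Continuous fun t => ‖U t‖ ^ 2 := by fun_prop
  have hbd : ∀ t, 0 ≤ t → ‖U (t - a) - U (t - b)‖ ≤ 2 * K := fun t ht => by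
    have e1 := h.bound (t - a) (by linarith [h.a_le])
    have e2 := h.bound (t - b) (by linarith [h.b_le])
    linarith [norm_sub_le (U (t - a)) (U (t - b))]
  have hlim : Tendsto φ atTop (𝓝 0) := by
    -- The total energy loss is at most the window energy at time 0 plus the energy fed in by W,
    -- which is at most 2K ∫ |W|. Division by p(1 - p) undoes the weight of the loss.
    refine tendsto_zero_of_integral_bounded hcφ (L := 4 * K * (2 * L))
      (M := ((p * (∫ s in (0 - a)..0, ‖U s‖ ^ 2) + (1 - p) * ∫ s in (0 - b)..0, ‖U s‖ ^ 2) +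
        2 * K * (C / δ)) / (p * (1 - p))) (fun t _ => sq_nonneg _) ?_ ?_
    · intro s t hs ht
      have e1 := h.lip (s - a) (t - a) (by linarith [h.a_le]) (by linarith [h.a_le])
      have e2 := h.lip (s - b) (t - b) (by linarith [h.b_le]) (by linarith [h.b_le])
      rw [sub_sub_sub_cancel_right] at e1 e2
      have e3 : |‖U (s - a) - U (s - b)‖ - ‖U (t - a) - U (t - b)‖| ≤ 2 * L * |s - t| := by
        refine (abs_norm_sub_norm_le _ _).trans ?_
        have : U (s - a) - U (s - b) - (U (t - a) - U (t - b)) =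
          (U (s - a) - U (t - a)) - (U (s - b) - U (t - b)) := by ring
        rw [this]
        linarith [norm_sub_le (U (s - a) - U (t - a)) (U (s - b) - U (t - b))]
      have e4 := hbd s hs
      have e5 := hbd t ht
      simp only [hφ]
      rw [sq_sub_sq, abs_mul, abs_of_nonneg (by positivity), mul_assoc (4 * K)]
      exact mul_le_mul (by linarith) e3 (abs_nonneg _) (by positivity)
    · intro t ht
      have hw := window_integral_sub hsq p a b 0 t
      simp only [smul_eq_mul] at hw
      have hnn : ∀ d, 0 < d → 0 ≤ ∫ s in (t - d)..t, ‖U s‖ ^ 2 := fun d hd =>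
        intervalIntegral.integral_nonneg (by linarith) fun _ _ => sq_nonneg _
      have hle : ∫ s in (0 : ℝ)..t, (‖U s‖ ^ 2 - p * ‖U (s - a)‖ ^ 2 - (1 - p) * ‖U (s - b)‖ ^ 2) ≤
          ∫ s in (0 : ℝ)..t, (2 * K * ‖W s‖ - p * (1 - p) * φ s) := by
        have hcW := h.continuous_W
        refine intervalIntegral.integral_mono_on ht (Continuous.intervalIntegrable (by fun_prop) _ _)
          (Continuous.intervalIntegrable (by fun_prop) _ _) fun s hs => ?_
        have e1 : U s - W s = p * U (s - a) + (1 - p) * U (s - b) := by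
          rw [h.eq s]; ring
        have e2 := norm_sq_convex_comb p (U (s - a)) (U (s - b))
        have e3 := norm_sq_sub_ge (U s) (W s)
        rw [e1, e2] at e3
        have e4 := h.bound s (by linarith [hs.1])
        have e5 := mul_le_mul_of_nonneg_right e4 (norm_nonneg (W s))
        simp only [hφ]
        linarith
      have hcW := h.continuous_W
      have hr : ∫ s in (0 : ℝ)..t, (2 * K * ‖W s‖ - p * (1 - p) * φ s) =
          2 * K * (∫ s in (0 : ℝ)..t, ‖W s‖) - p * (1 - p) * ∫ s in (0 : ℝ)..t, φ s := by
        rw [intervalIntegral.integral_sub (Continuous.intervalIntegrable (by fun_prop) _ _)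
          (Continuous.intervalIntegrable (by fun_prop) _ _), intervalIntegral.integral_const_mul,
          intervalIntegral.integral_const_mul]
      rw [hr] at hle
      have e6 := mul_le_mul_of_nonneg_left (h.integral_norm_W_le ht) (show 0 ≤ 2 * K by positivity)
      have e7 := mul_nonneg hp0.le (hnn a h.a_pos)
      have e8 := mul_nonneg hq.le (hnn b h.b_pos)
      rw [le_div_iff₀ (by positivity)]
      linarith
  have h2 : Tendsto (fun t => ‖U (t - a) - U (t - b)‖) atTop (𝓝 0) := by
    have := hlim.sqrt
    simpa [hφ, Real.sqrt_sq (norm_nonneg _)] using this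
  exact tendsto_zero_iff_norm_tendsto_zero.2 h2

lemma tendsto_sub_shift_a (h : RenewalEq p a b B K L C δ U W) :
    Tendsto (fun t => U t - U (t - a)) atTop (𝓝 0) := by
  have h1 := (h.tendsto_sub.const_mul (-(1 - p : ℂ))).add h.tendsto_W
  rw [mul_zero, add_zero] at h1
  refine h1.congr fun t => ?_
  rw [h.eq t]; ring

lemma tendsto_sub_shift_b (h : RenewalEq p a b B K L C δ U W) :
    Tendsto (fun t => U t - U (t - b)) atTop (𝓝 0) := by
  have h1 := (h.tendsto_sub.const_mul (p : ℂ)).add h.tendsto_W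
  rw [mul_zero, add_zero] at h1
  refine h1.congr fun t => ?_
  rw [h.eq t]; ring

end RenewalEq

/-- The group of asymptotic periods of a function. -/
def asympPeriods (U : ℝ → ℂ) : AddSubgroup ℝ where
  carrier := {x | Tendsto (fun t => U (t + x) - U t) atTop (𝓝 0)}
  zero_mem' := by simp
  add_mem' := by
    intro x y hx hy
    have h1 := (hx.comp (tendsto_atTop_add_const_right _ y tendsto_id)).add hy
    simp only [Function.comp_def, id, add_zero] at h1
    refine h1.congr fun t => ?_
    rw [show t + (x + y) = t + y + x by ring]; ring
  neg_mem' := by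
    intro x hx
    have h1 := (hx.comp (tendsto_atTop_add_const_right _ (-x) tendsto_id)).neg
    simp only [Function.comp_def, id, neg_zero] at h1
    refine h1.congr fun t => ?_
    rw [show t + -x + x = t by ring]; ring

lemma mem_asympPeriods {U : ℝ → ℂ} {x : ℝ} :
    x ∈ asympPeriods U ↔ Tendsto (fun t => U (t + x) - U t) atTop (𝓝 0) := Iff.rfl

namespace RenewalEq

variable {p a b B K L C δ : ℝ} {U W : ℝ → ℂ}

lemma a_mem_asympPeriods (h : RenewalEq p a b B K L C δ U W) : a ∈ asympPeriods U := by
  have h1 := h.tendsto_sub_shift_a.comp (tendsto_atTop_add_const_right _ a tendsto_id)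
  simpa [mem_asympPeriods, Function.comp_def] using h1

lemma b_mem_asympPeriods (h : RenewalEq p a b B K L C δ U W) : b ∈ asympPeriods U := by
  have h1 := h.tendsto_sub_shift_b.comp (tendsto_atTop_add_const_right _ b tendsto_id)
  simpa [mem_asympPeriods, Function.comp_def] using h1

/-- A Lipschitz function changes little, uniformly in t, when a shift is replaced by a nearby
asymptotic period. -/
lemma asympPeriods_isClosed (h : RenewalEq p a b B K L C δ U W) :
    IsClosed (asympPeriods U : Set ℝ) := by
  have hL := h.L_nonneg
  have hB : 0 < B := h.a_pos.trans_le h.a_le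
  refine isClosed_of_closure_subset fun x hx => ?_
  rw [SetLike.mem_coe, mem_asympPeriods, Metric.tendsto_atTop]
  intro ε hε
  obtain ⟨y, hy, hxy⟩ := Metric.mem_closure_iff.1 hx (ε / (2 * (L + 1))) (by positivity)
  obtain ⟨N, hN⟩ := Metric.tendsto_atTop.1 (mem_asympPeriods.1 hy) (ε / 2) (by positivity)
  -- For such t both t + x and t + y are nonnegative, where the Lipschitz bound is available.
  refine ⟨max N (max (-x) (-y)), fun t ht => ?_⟩
  have t1 := (le_max_left _ _).trans ht
  have t2 := ((le_max_left _ _).trans (le_max_right _ _)).trans ht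
  have t3 := ((le_max_right _ _).trans (le_max_right _ _)).trans ht
  have h1 := hN t t1
  have h2 := h.lip (t + x) (t + y) (by linarith) (by linarith)
  rw [dist_zero_right] at h1 ⊢
  have h3 : L * |t + x - (t + y)| < ε / 2 := by
    rw [add_sub_add_left_eq_sub, ← Real.dist_eq]
    calc L * dist x y ≤ L * (ε / (2 * (L + 1))) := mul_le_mul_of_nonneg_left hxy.le hL
      _ < ε / 2 := by
        rw [← mul_div_assoc, div_lt_div_iff₀ (by positivity) (by positivity)]; nlinarith
  calc ‖U (t + x) - U t‖ = ‖(U (t + x) - U (t + y)) + (U (t + y) - U t)‖ := by congr 1; ring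
    _ ≤ _ := norm_add_le _ _
    _ < ε := by linarith

/-- The group generated by a and b is dense when a / b is irrational, and the periods form a closed
set. -/
lemma asympPeriods_eq_top (h : RenewalEq p a b B K L C δ U W) (hirr : Irrational (a / b)) (x : ℝ) :
    x ∈ asympPeriods U := by
  have hd := dense_addSubgroupClosure_pair_iff.2 hirr
  have hle : AddSubgroup.closure {a, b} ≤ asympPeriods U := by
    rw [AddSubgroup.closure_le]
    rintro y (rfl | rfl)
    · exact h.a_mem_asympPeriods
    · exact h.b_mem_asympPeriods
  have := (hd.mono (show ((AddSubgroup.closure {a, b} : AddSubgroup ℝ) : Set ℝ) ⊆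
    (asympPeriods U : Set ℝ) from hle)).closure_eq
  rw [h.asympPeriods_isClosed.closure_eq] at this
  exact Set.eq_univ_iff_forall.1 this x

/-- All shifts are asymptotic periods, so U(t + x) - U(t) tends to 0 for each x in [-d, 0].
Dominated convergence does the rest. -/
lemma tendsto_window (h : RenewalEq p a b B K L C δ U W) (hirr : Irrational (a / b)) {d : ℝ}
    (hd : 0 ≤ d) :
    Tendsto (fun t => (∫ s in (t - d)..t, U s) - d * U t) atTop (𝓝 0) := by
  have hcU := h.continuous_U
  have hB : 0 < B := h.a_pos.trans_le h.a_le
  have h1 : Tendsto (fun t => ∫ x in (-d)..0, (U (t + x) - U t)) atTop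
      (𝓝 (∫ _ in (-d)..0, (0 : ℂ))) := by
    refine intervalIntegral.tendsto_integral_filter_of_dominated_convergence (fun _ => 2 * K)
      (Eventually.of_forall fun t => Continuous.aestronglyMeasurable (by fun_prop)) ?_
      (by simp) (ae_of_all _ fun x _ => h.asympPeriods_eq_top hirr x)
    filter_upwards [eventually_ge_atTop d] with t ht
    refine ae_of_all _ fun x hx => ?_
    rw [Set.uIoc_of_le (by linarith)] at hx
    have e1 := h.bound (t + x) (by linarith [hx.1])
    have e2 := h.bound t (by linarith)
    linarith [norm_sub_le (U (t + x)) (U t)]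
  simp only [intervalIntegral.integral_zero] at h1
  refine h1.congr fun t => ?_
  rw [intervalIntegral.integral_sub (Continuous.intervalIntegrable (by fun_prop) _ _)
    (Continuous.intervalIntegrable (by fun_prop) _ _), intervalIntegral.integral_const,
    intervalIntegral.integral_comp_add_left (fun x => U x)]
  simp [sub_eq_add_neg]

/-- The renewal theorem, nonarithmetic case. -/
theorem tendsto_of_irrational (h : RenewalEq p a b B K L C δ U W) (hirr : Irrational (a / b))
    {J : ℂ} (hJ : Tendsto (fun t => (p : ℂ) * (∫ s in (t - a)..t, U s) +
      (1 - p) * ∫ s in (t - b)..t, U s) atTop (𝓝 J)) :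
    Tendsto U atTop (𝓝 (J / ((p * a + (1 - p) * b : ℝ) : ℂ))) := by
  have hp0 := h.p_mem.1
  have hq : 0 < 1 - p := sub_pos.2 h.p_mem.2
  have hh : ((p * a + (1 - p) * b : ℝ) : ℂ) ≠ 0 := by
    have := h.a_pos; have := h.b_pos
    exact_mod_cast (by positivity : 0 < p * a + (1 - p) * b).ne'
  have h1 := ((h.tendsto_window hirr h.a_pos.le).const_mul (p : ℂ)).add
    ((h.tendsto_window hirr h.b_pos.le).const_mul (1 - p : ℂ))
  have h2 := (hJ.sub h1).div_const ((p * a + (1 - p) * b : ℝ) : ℂ)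
  simp only [mul_zero, add_zero, sub_zero] at h2
  refine h2.congr fun t => ?_
  rw [div_eq_iff hh]
  push_cast
  ring

end RenewalEq

/-! ### Absolute convergence of Fourier series of Lipschitz functions -/

section Circle

set_option linter.unusedSectionVars false

open AddCircle

variable {T : ℝ} [hT : Fact (0 < T)]

lemma fourier_add_apply (n : ℤ) (x y : AddCircle T) :
    fourier n (x + y) = fourier n x * fourier n y := by
  simp only [fourier_apply, smul_add, toCircle_add, Circle.coe_mul]

lemma fourierCoeff_comp_add (f : AddCircle T → ℂ) (y : AddCircle T) (n : ℤ) :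
    fourierCoeff (fun x => f (x + y)) n = fourier n y * fourierCoeff f n := by
  unfold fourierCoeff
  rw [← integral_add_right_eq_self (μ := haarAddCircle) (fun x => fourier (-n) x • f x) y,
    ← integral_const_mul]
  refine integral_congr_ae (ae_of_all _ fun x => ?_)
  have h : fourier n y * fourier (-n) y = (1 : ℂ) := by
    rw [← fourier_add, add_neg_cancel, fourier_zero]
  simp only [smul_eq_mul]
  rw [fourier_add_apply]
  calc _ = (fourier n y * fourier (-n) y : ℂ) * (fourier (-n) x * f (x + y)) := by rw [h, one_mul]
    _ = _ := by ring

/-- Parseval's identity, with the L² norm bounded by the supremum over a probability space. -/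
lemma sum_sq_fourierCoeff_le (f : C(AddCircle T, ℂ)) {K : ℝ} (hK : ∀ x, ‖f x‖ ≤ K)
    (F : Finset ℤ) : ∑ n ∈ F, ‖fourierCoeff f n‖ ^ 2 ≤ K ^ 2 := by
  have h := hasSum_sq_fourierCoeff (ContinuousMap.toLp (E := ℂ) 2 haarAddCircle ℂ f)
  simp_rw [fourierCoeff_toLp] at h
  refine (sum_le_hasSum F (fun _ _ => sq_nonneg _) h).trans ?_
  have h2 : ∫ t : AddCircle T, ‖(ContinuousMap.toLp (E := ℂ) 2 haarAddCircle ℂ f) t‖ ^ 2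
      ∂haarAddCircle ≤ ∫ _ : AddCircle T, K ^ 2 ∂haarAddCircle := by
    refine integral_mono_of_nonneg (ae_of_all _ fun _ => sq_nonneg _) (integrable_const _) ?_
    filter_upwards [ContinuousMap.coeFn_toLp (p := 2) (𝕜 := ℂ) haarAddCircle f] with t ht
    simp only [ht]
    exact pow_le_pow_left₀ (norm_nonneg _) (hK t) 2
  simpa using h2

/-- The Fourier coefficients of a Lipschitz function are summable. -/
theorem summable_fourierCoeff_of_lipschitz (f : C(AddCircle T, ℂ)) {L : ℝ}
    (hL : ∀ s t : ℝ, ‖f s - f t‖ ≤ L * |s - t|) : Summable (fourierCoeff f) := by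
  have hT0 : 0 < T := hT.out
  have key : ∀ F : Finset ℤ,
      ∑ n ∈ F, ‖2 * Real.pi * Complex.I * n / T‖ ^ 2 * ‖fourierCoeff f n‖ ^ 2 ≤ L ^ 2 := by
    intro F
    -- Parseval for the difference f(· + y) - f, whose coefficients are those of f times e_n(y) - 1.
    -- Dividing by y² and letting y tend to 0 yields the square summability of the formal
    -- derivative, although f need not be differentiable.
    have h1 : ∀ y : ℝ, ∑ n ∈ F, ‖fourier n (y : AddCircle T) - 1‖ ^ 2 * ‖fourierCoeff f n‖ ^ 2 ≤
        (L * |y|) ^ 2 := fun y => by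
      set g : C(AddCircle T, ℂ) := f.comp (ContinuousMap.addRight (y : AddCircle T)) - f with hg
      have e : ∀ n, fourierCoeff g n = (fourier n (y : AddCircle T) - 1) * fourierCoeff f n := by
        intro n
        rw [sub_mul, one_mul, ← fourierCoeff_comp_add]
        have i1 : ∀ u : C(AddCircle T, ℂ),
            Integrable (fun x => fourier (-n) x • u x) haarAddCircle := fun u =>
          ((map_continuous (fourier (-n))).smul u.continuous).integrable_of_hasCompactSupport
            (HasCompactSupport.of_compactSpace _)
        simp only [fourierCoeff]
        refine Eq.trans ?_ (integral_sub
          (i1 (f.comp (ContinuousMap.addRight (y : AddCircle T)))) (i1 f))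
        refine integral_congr_ae (ae_of_all _ fun x => ?_)
        simp [hg, mul_sub]
      have := sum_sq_fourierCoeff_le g (K := L * |y|) (fun x => by
        induction x using QuotientAddGroup.induction_on with
        | H x =>
          have := hL (x + y) x
          rw [add_sub_cancel_left] at this
          simpa [hg] using this) F
      simpa only [e, norm_mul, mul_pow] using this
    have h2 : Tendsto (fun y : ℝ => ∑ n ∈ F, ‖y⁻¹ • (fourier n ((0 + y : ℝ) : AddCircle T) -
        fourier n ((0 : ℝ) : AddCircle T))‖ ^ 2 * ‖fourierCoeff f n‖ ^ 2) (𝓝[≠] 0)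
        (𝓝 (∑ n ∈ F, ‖2 * Real.pi * Complex.I * n / T * fourier n ((0 : ℝ) : AddCircle T)‖ ^ 2 *
          ‖fourierCoeff f n‖ ^ 2)) :=
      tendsto_finsetSum _ fun n _ =>
        (((hasDerivAt_iff_tendsto_slope_zero.1 (hasDerivAt_fourier T n 0)).norm).pow 2).mul_const _
    have h0 : ∀ n : ℤ, (fourier n ((0 : ℝ) : AddCircle T) : ℂ) = 1 := fun n => by
      exact_mod_cast fourier_eval_zero n
    simp only [h0, mul_one, zero_add] at h2
    refine le_of_tendsto h2 ?_
    filter_upwards [self_mem_nhdsWithin] with y hy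
    have hy0 : 0 < |y| := abs_pos.2 hy
    have h3 := h1 y
    calc _ = (∑ n ∈ F, ‖fourier n (y : AddCircle T) - 1‖ ^ 2 * ‖fourierCoeff f n‖ ^ 2) / |y| ^ 2 := by
          rw [Finset.sum_div]
          refine Finset.sum_congr rfl fun n _ => ?_
          rw [norm_smul, norm_inv, Real.norm_eq_abs]
          field_simp
      _ ≤ (L * |y|) ^ 2 / |y| ^ 2 := by gcongr
      _ = L ^ 2 := by field_simp
  have hs : Summable fun n : ℤ => ‖2 * Real.pi * Complex.I * n / T‖ ^ 2 * ‖fourierCoeff f n‖ ^ 2 :=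
    summable_of_sum_le (fun n => by positivity) key
  have hs2 : Summable fun n : ℤ => (T / (2 * Real.pi)) ^ 2 * (1 / (n : ℝ) ^ 2) :=
    (Real.summable_one_div_int_pow.2 (by norm_num : 1 < 2)).mul_left _
  refine Summable.of_norm_bounded_eventually (hs.add hs2) ?_
  rw [Filter.eventually_cofinite]
  refine (Set.finite_singleton (0 : ℤ)).subset fun n hn => ?_
  by_contra h0
  apply hn
  have hn0 : (n : ℝ) ≠ 0 := by exact_mod_cast h0
  have e : ‖2 * Real.pi * Complex.I * n / T‖ = 2 * Real.pi * |(n : ℝ)| / T := by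
    simp [abs_of_pos Real.pi_pos, abs_of_pos hT0]
  have hn1 : 0 < |(n : ℝ)| := abs_pos.2 hn0
  set ω := 2 * Real.pi * |(n : ℝ)| / T with hω
  have hω0 : 0 < ω := by have := Real.pi_pos; positivity
  have e2 : (T / (2 * Real.pi)) ^ 2 * (1 / (n : ℝ) ^ 2) = (1 / ω) ^ 2 := by
    rw [hω, ← sq_abs (n : ℝ)]
    have := Real.pi_pos
    field_simp
  rw [e, e2]
  -- The elementary inequality xy ≤ x² + y² with x = ω |c_n| and y = 1/ω. Only n = 0, where ω = 0,
  -- is excluded.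
  have h4 : ‖fourierCoeff f n‖ = (ω * ‖fourierCoeff f n‖) * (1 / ω) := by field_simp
  nlinarith [sq_nonneg (ω * ‖fourierCoeff f n‖ - 1 / ω), sq_nonneg (ω * ‖fourierCoeff f n‖),
    sq_nonneg (1 / ω)]

end Circle

/-! ### Renewal equation: the arithmetic case -/

namespace RenewalEq

variable {p a b B K L C δ : ℝ} {U W : ℝ → ℂ}

/-- Bézout: the span lam is an integer combination of a and b. -/
lemma span_mem_asympPeriods (h : RenewalEq p a b B K L C δ U W) {r l : ℕ} {lam : ℝ}
    (hrl : r.Coprime l) (ha : a = r * lam) (hb : b = l * lam) : lam ∈ asympPeriods U := by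
  have h1 := Nat.gcd_eq_gcd_ab r l
  rw [Nat.Coprime.gcd_eq_one hrl] at h1
  have h2 : lam = r.gcdA l • a + r.gcdB l • b := by
    have h3 : (1 : ℝ) = r * (r.gcdA l : ℝ) + l * (r.gcdB l : ℝ) := by exact_mod_cast h1
    rw [ha, hb, zsmul_eq_mul, zsmul_eq_mul]
    linear_combination lam * h3
  rw [h2]
  exact add_mem (zsmul_mem h.a_mem_asympPeriods _) (zsmul_mem h.b_mem_asympPeriods _)

/-- The sum over the lattice points of the window. -/
noncomputable def latticeSum (p lam : ℝ) (r l : ℕ) (U : ℝ → ℂ) (t : ℝ) : ℂ :=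
  p * ∑ j ∈ Finset.range r, U (t - j * lam) + (1 - p) * ∑ j ∈ Finset.range l, U (t - j * lam)

lemma sum_shift_sub (U : ℝ → ℂ) (lam t : ℝ) (r : ℕ) :
    ∑ j ∈ Finset.range r, U (t - j * lam) - ∑ j ∈ Finset.range r, U (t - lam - j * lam) =
      U t - U (t - r * lam) := by
  have h := Finset.sum_range_sub' (fun j : ℕ => U (t - j * lam)) r
  rw [← Finset.sum_sub_distrib]
  simp only [Nat.cast_zero, zero_mul, sub_zero] at h
  rw [← h]
  refine Finset.sum_congr rfl fun j _ => ?_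
  congr 2
  push_cast; ring

/-- Each sum telescopes under a shift by lam, leaving U(t) - U(t - a) and U(t) - U(t - b). This is
the discrete form of the conservation law. -/
lemma latticeSum_sub (h : RenewalEq p a b B K L C δ U W) {r l : ℕ} {lam : ℝ}
    (ha : a = r * lam) (hb : b = l * lam) (t : ℝ) :
    latticeSum p lam r l U t - latticeSum p lam r l U (t - lam) = W t := by
  have e1 := sum_shift_sub U lam t r
  have e2 := sum_shift_sub U lam t l
  rw [← ha] at e1
  rw [← hb] at e2
  have e3 := h.eq t
  unfold latticeSum
  linear_combination (p : ℂ) * e1 + (1 - p : ℂ) * e2 + e3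

/-- Shifts by multiples of lam do not matter asymptotically, so every point of the window
contributes about U(t). -/
lemma tendsto_latticeSum_sub {p : ℝ} {U : ℝ → ℂ} {r l : ℕ} {lam : ℝ}
    (hlam : lam ∈ asympPeriods U) :
    Tendsto (fun t => latticeSum p lam r l U t - ((p * r + (1 - p) * l : ℝ) : ℂ) * U t) atTop
      (𝓝 0) := by
  have h1 : ∀ j : ℕ, Tendsto (fun t => U (t - j * lam) - U t) atTop (𝓝 0) := fun j => by
    have := mem_asympPeriods.1 (neg_mem (nsmul_mem hlam j))
    simpa only [nsmul_eq_mul, ← sub_eq_add_neg] using this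
  have h2 : ∀ m : ℕ, Tendsto (fun t => ∑ j ∈ Finset.range m, (U (t - j * lam) - U t)) atTop
      (𝓝 0) := fun m => by simpa using tendsto_finsetSum (Finset.range m) fun j _ => h1 j
  have h3 := ((h2 r).const_mul (p : ℂ)).add ((h2 l).const_mul (1 - p : ℂ))
  simp only [mul_zero, add_zero] at h3
  refine h3.congr fun t => ?_
  simp only [Finset.sum_sub_distrib, Finset.sum_const, Finset.card_range, nsmul_eq_mul, latticeSum]
  push_cast
  ring

lemma dist_latticeSum_le (h : RenewalEq p a b B K L C δ U W) {r l : ℕ} {lam : ℝ} (hlam : 0 < lam)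
    (ha : a = r * lam) (hb : b = l * lam) {t : ℝ} (ht : 0 ≤ t) (n : ℕ) :
    dist (latticeSum p lam r l U (t + n * lam)) (latticeSum p lam r l U (t + (n + 1 : ℕ) * lam)) ≤
      C * Real.exp (-δ * t) * Real.exp (-δ * lam) ^ n := by
  have e := h.latticeSum_sub ha hb (t + (n + 1 : ℕ) * lam)
  rw [show t + (n + 1 : ℕ) * lam - lam = t + n * lam by push_cast; ring] at e
  rw [dist_comm, dist_eq_norm, e]
  have hd := h.decay (t + (n + 1 : ℕ) * lam) (by positivity)
  refine hd.trans ?_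
  rw [mul_assoc]
  refine mul_le_mul_of_nonneg_left ?_ h.C_nonneg
  rw [← Real.exp_nat_mul, ← Real.exp_add, Real.exp_le_exp]
  push_cast
  nlinarith [mul_pos h.δ_pos hlam]

/-- In the arithmetic case a solution is asymptotic to a periodic function. -/
lemma exists_periodic (h : RenewalEq p a b B K L C δ U W) {r l : ℕ} {lam : ℝ} (hlam : 0 < lam)
    (hrl : r.Coprime l) (ha : a = r * lam) (hb : b = l * lam) :
    ∃ ψ : ℝ → ℂ, (∀ t, Tendsto (fun n : ℕ => U (t + n * lam)) atTop (𝓝 (ψ t))) ∧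
      Tendsto (fun t => U t - ψ t) atTop (𝓝 0) := by
  have hp0 := h.p_mem.1
  have hq : 0 < 1 - p := sub_pos.2 h.p_mem.2
  have hmem := h.span_mem_asympPeriods hrl ha hb
  have hr0 : (0 : ℝ) < r := by
    have := h.a_pos; rw [ha] at this; exact (mul_pos_iff_of_pos_right hlam).1 this
  set κ : ℂ := ((p * r + (1 - p) * l : ℝ) : ℂ) with hκ
  have hκ0 : κ ≠ 0 := by
    rw [hκ]; exact_mod_cast (by positivity : 0 < p * r + (1 - p) * (l : ℝ)).ne'
  have hx1 : Real.exp (-δ * lam) < 1 := by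
    rw [Real.exp_lt_one_iff]; nlinarith [mul_pos h.δ_pos hlam]
  have hseq : ∀ t : ℝ, Tendsto (fun n : ℕ => t + n * lam) atTop atTop := fun t =>
    tendsto_atTop_add_const_left _ t (tendsto_natCast_atTop_atTop.atTop_mul_const hlam)
  have hS := tendsto_latticeSum_sub (p := p) (r := r) (l := l) hmem
  have hnn : ∀ t : ℝ, 0 ≤ t → ∃ σ,
      Tendsto (fun n : ℕ => latticeSum p lam r l U (t + n * lam)) atTop (𝓝 σ) := fun t ht =>
    cauchySeq_tendsto_of_complete
      (cauchySeq_of_le_geometric _ _ hx1 fun n => h.dist_latticeSum_le hlam ha hb ht n)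
  have hU : ∀ t σ, Tendsto (fun n : ℕ => latticeSum p lam r l U (t + n * lam)) atTop (𝓝 σ) →
      Tendsto (fun n : ℕ => U (t + n * lam)) atTop (𝓝 (σ / κ)) := fun t σ hσ => by
    have h2 := (hσ.sub (hS.comp (hseq t))).div_const κ
    rw [sub_zero] at h2
    refine h2.congr fun n => ?_
    simp only [Function.comp_apply]
    field_simp
    ring
  -- The decay of W is known on [0, ∞) only, so a negative t is first moved there by a multiple of
  -- lam.
  have hex : ∀ t, ∃ y, Tendsto (fun n : ℕ => U (t + n * lam)) atTop (𝓝 y) := fun t => by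
    obtain ⟨m, hm⟩ := exists_nat_ge (-t / lam)
    rw [div_le_iff₀ hlam] at hm
    obtain ⟨σ, hσ⟩ := hnn (t + m * lam) (by linarith)
    refine ⟨σ / κ, (tendsto_add_atTop_iff_nat m).1 ((hU _ _ hσ).congr fun n => ?_)⟩
    congr 1; push_cast; ring
  choose ψ hψ using hex
  refine ⟨ψ, hψ, ?_⟩
  -- The pointwise limits along t + n lam are upgraded to a limit in t by the geometric tail, whose
  -- size is C exp(-δ t) up to a constant.
  have hrate : Tendsto (fun t : ℝ => latticeSum p lam r l U t - κ * ψ t) atTop (𝓝 0) := by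
    have h1 : Tendsto (fun t : ℝ => C * Real.exp (-δ * t) / (1 - Real.exp (-δ * lam))) atTop
        (𝓝 0) := by
      have : Tendsto (fun t : ℝ => -δ * t) atTop atBot :=
        tendsto_id.const_mul_atTop_of_neg (by linarith [h.δ_pos])
      simpa using ((Real.tendsto_exp_atBot.comp this).const_mul C).div_const
        (1 - Real.exp (-δ * lam))
    refine squeeze_zero_norm' ((eventually_ge_atTop 0).mono fun t ht => ?_) h1
    obtain ⟨σ, hσ⟩ := hnn t ht
    have e1 : ψ t = σ / κ := tendsto_nhds_unique (hψ t) (hU t σ hσ)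
    have e2 := dist_le_of_le_geometric_of_tendsto₀ _ _ hx1
      (fun n => h.dist_latticeSum_le hlam ha hb ht n) hσ
    simp only [Nat.cast_zero, zero_mul, add_zero] at e2
    rw [e1, mul_div_cancel₀ _ hκ0, ← dist_eq_norm]
    exact e2
  have h2 := (hrate.sub hS).div_const κ
  simp only [sub_zero, zero_div] at h2
  refine h2.congr fun t => ?_
  field_simp
  ring

/-- The renewal theorem, arithmetic case. -/
theorem tendsto_of_rational (h : RenewalEq p a b B K L C δ U W) {r l : ℕ} {lam : ℝ} (hlam : 0 < lam)
    (hrl : r.Coprime l) (ha : a = r * lam) (hb : b = l * lam) {J : ℤ → ℂ}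
    (hJ : ∀ k : ℤ, Tendsto (fun t : ℝ =>
      (p : ℂ) * (∫ s in (t - a)..t, U s * Complex.exp (-(2 * Real.pi * Complex.I * k * s / lam))) +
      (1 - p) * ∫ s in (t - b)..t, U s * Complex.exp (-(2 * Real.pi * Complex.I * k * s / lam)))
      atTop (𝓝 (J k))) :
    Summable (fun k => ‖J k‖) ∧ Tendsto (fun t : ℝ => U t - ((p * a + (1 - p) * b : ℝ) : ℂ)⁻¹ *
      ∑' k : ℤ, J k * Complex.exp (2 * Real.pi * Complex.I * k * t / lam)) atTop (𝓝 0) := by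
  obtain ⟨ψ, hψ, hUψ⟩ := h.exists_periodic hlam hrl ha hb
  have : Fact (0 < lam) := ⟨hlam⟩
  have hp0 := h.p_mem.1
  have hq : 0 < 1 - p := sub_pos.2 h.p_mem.2
  have hB : 0 < B := h.a_pos.trans_le h.a_le
  have hh : ((p * a + (1 - p) * b : ℝ) : ℂ) ≠ 0 := by
    have := h.a_pos; have := h.b_pos
    exact_mod_cast (by positivity : 0 < p * a + (1 - p) * b).ne'
  have hseq : ∀ t : ℝ, Tendsto (fun n : ℕ => t + n * lam) atTop atTop := fun t =>
    tendsto_atTop_add_const_left _ t (tendsto_natCast_atTop_atTop.atTop_mul_const hlam)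
  have hper : Function.Periodic ψ lam := fun t => by
    have h1 := (tendsto_add_atTop_iff_nat 1).2 (hψ t)
    refine tendsto_nhds_unique ((hψ (t + lam)).congr fun n => ?_) h1
    congr 1; push_cast; ring
  have hlip : ∀ s t, ‖ψ s - ψ t‖ ≤ L * |s - t| := fun s t => by
    refine le_of_tendsto ((hψ s).sub (hψ t)).norm ?_
    filter_upwards [(hseq s).eventually_ge_atTop (-B), (hseq t).eventually_ge_atTop (-B)] with n h1 h2
    have := h.lip _ _ h1 h2
    rwa [add_sub_add_right_eq_sub] at this
  have hcont : Continuous ψ := by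
    have : LipschitzWith L.toNNReal ψ := LipschitzWith.of_dist_le_mul fun s t => by
      rw [dist_eq_norm, Real.dist_eq, Real.coe_toNNReal _ h.L_nonneg]; exact hlip s t
    exact this.continuous
  have hcirc : Continuous hper.lift := continuous_coinduced_dom.2 hcont
  set f : C(AddCircle lam, ℂ) := ⟨hper.lift, hcirc⟩ with hf
  have hfψ : ∀ t : ℝ, f t = ψ t := fun t => rfl
  have hsum : Summable (fourierCoeff f) :=
    summable_fourierCoeff_of_lipschitz f (L := L) fun s t => by rw [hfψ, hfψ]; exact hlip s t
  have hcoef : ∀ k, J k = ((p * a + (1 - p) * b : ℝ) : ℂ) * fourierCoeff f k := by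
    intro k
    set e : ℝ → ℂ := fun s => Complex.exp (-(2 * Real.pi * Complex.I * k * s / lam)) with he
    have hce : Continuous e := by fun_prop
    have hef : ∀ s : ℝ, e s = fourier (-k) (s : AddCircle lam) := fun s => by
      rw [fourier_coe_apply]; simp only [he]; congr 1; push_cast; ring
    have heper : Function.Periodic e lam := fun s => by
      rw [hef, hef]; congr 1; simp
    have hepern : ∀ (n : ℕ) s, e (s + n * lam) = e s := fun n s => heper.nat_mul n s
    have hnorm : ∀ s, ‖e s‖ = 1 := fun s => by
      rw [hef, fourier_apply, Circle.norm_coe]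
    have hint : ∀ m : ℕ, Tendsto (fun n : ℕ => ∫ s in (0 + n * lam - m * lam)..(0 + n * lam), U s * e s)
        atTop (𝓝 (m * ∫ s in (0 : ℝ)..lam, ψ s * e s)) := by
      intro m
      have hcU := h.continuous_U
      have h1 : Tendsto (fun n : ℕ => ∫ s in (-(m * lam))..0, U (s + n * lam) * e s) atTop
          (𝓝 (∫ s in (-(m * lam))..0, ψ s * e s)) := by
        refine intervalIntegral.tendsto_integral_filter_of_dominated_convergence (fun _ => K)
          (Eventually.of_forall fun n => Continuous.aestronglyMeasurable (by fun_prop)) ?_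
          (by simp) (ae_of_all _ fun x _ => (hψ x).mul_const _)
        filter_upwards [(hseq 0).eventually_ge_atTop (m * lam)] with n hn
        refine ae_of_all _ fun x hx => ?_
        rw [Set.uIoc_of_le (by simp only [Left.neg_nonpos_iff]; positivity)] at hx
        rw [norm_mul, hnorm, mul_one]
        exact h.bound _ (by linarith [hx.1])
      have h2 : Function.Periodic (fun s => ψ s * e s) lam := hper.mul heper
      have h3 : ∫ s in (-(m * lam))..0, ψ s * e s = m * ∫ s in (0 : ℝ)..lam, ψ s * e s := by
        have h4 := h2.intervalIntegral_add_zsmul_eq m (-(m * lam))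
          fun _ _ => Continuous.intervalIntegrable (by fun_prop) _ _
        rw [h2.intervalIntegral_add_eq _ 0, zero_add] at h4
        simp only [zsmul_eq_mul, Int.cast_natCast, neg_add_cancel] at h4
        exact h4
      rw [h3] at h1
      refine h1.congr fun n => ?_
      have h5 := intervalIntegral.integral_comp_add_right (a := -(m * lam)) (b := 0)
        (fun s => U s * e s) (n * lam)
      simp only [hepern] at h5
      rw [h5]
      congr 1; ring
    have h6 := ((hint r).const_mul (p : ℂ)).add ((hint l).const_mul (1 - p : ℂ))
    -- The limit over real t is evaluated along t = n lam. There the exponential does not depend on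
    -- n, and the windows cover exactly r and l periods.
    have h7 := tendsto_nhds_unique ((hJ k).comp (hseq 0)) (by
      simp only [Function.comp_def, ha, hb]; exact h6)
    rw [h7, fourierCoeff_eq_intervalIntegral f k 0, zero_add]
    have h8 : ∫ x in (0 : ℝ)..lam, fourier (-k) (x : AddCircle lam) • f x =
        ∫ s in (0 : ℝ)..lam, ψ s * e s :=
      intervalIntegral.integral_congr fun s _ => by
        simp only [smul_eq_mul]; rw [hfψ, ← hef, mul_comm]
    rw [h8, ha, hb, Complex.real_smul]
    have : (lam : ℂ) ≠ 0 := by exact_mod_cast hlam.ne'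
    push_cast
    field_simp
  refine ⟨by simpa only [hcoef, norm_mul] using hsum.norm.mul_left _, ?_⟩
  refine hUψ.congr fun t => ?_
  have h9 := has_pointwise_sum_fourier_series_of_summable hsum (t : AddCircle lam)
  rw [hfψ] at h9
  congr 1
  rw [← h9.tsum_eq, ← tsum_mul_left]
  refine tsum_congr fun k => ?_
  rw [hcoef, fourier_coe_apply, smul_eq_mul]
  field_simp

end RenewalEq

/-! ### Bounds for the Poisson generating function -/

/-- Boundedness of subsolutions of the renewal inequality. -/
lemma renewal_bound {p a b B C δ K : ℝ} (hp : p ∈ Set.Ioo (0 : ℝ) 1) (ha : 0 < a) (hb : 0 < b)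
    (haB : a ≤ B) (hbB : b ≤ B) (hC : 0 ≤ C) (hδ : 0 < δ) :
    ∃ M, ∀ φ : ℝ → ℝ, (∀ τ, -B ≤ τ → τ ≤ 0 → φ τ ≤ K) →
      (∀ τ, 0 ≤ τ → φ τ ≤ p * φ (τ - a) + (1 - p) * φ (τ - b) + C * Real.exp (-δ * τ)) →
      ∀ τ, -B ≤ τ → φ τ ≤ M := by
  have hp0 := hp.1
  have hq : 0 < 1 - p := sub_pos.2 hp.2
  have hga : 1 < Real.exp (δ * a) := Real.one_lt_exp_iff.2 (by positivity)
  have hgb : 1 < Real.exp (δ * b) := Real.one_lt_exp_iff.2 (by positivity)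
  -- With D G = C, the function K + D exp(δB) - D exp(-δτ) solves the renewal equation with source C
  -- exp(-δτ), and it dominates K on [-B, 0]. The resulting bound does not depend on φ, as is needed
  -- to treat all horizontal lines at once.
  set G := p * Real.exp (δ * a) + (1 - p) * Real.exp (δ * b) - 1 with hG
  have hG0 : 0 < G := by nlinarith
  set D := C / G with hD
  have hD0 : 0 ≤ D := by positivity
  refine ⟨K + D * Real.exp (δ * B), fun φ h0 h1 => ?_⟩
  have hm : 0 < min a b := lt_min ha hb
  have key : ∀ n : ℕ, ∀ τ, -B ≤ τ → τ ≤ n * min a b →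
      φ τ ≤ K + D * Real.exp (δ * B) - D * Real.exp (-δ * τ) := by
    intro n
    induction n with
    | zero =>
      intro τ h2 h3
      have h4 := h0 τ h2 (by simpa using h3)
      have h5 : Real.exp (-δ * τ) ≤ Real.exp (δ * B) := Real.exp_le_exp.2 (by nlinarith)
      nlinarith
    | succ n ih =>
      intro τ h2 h3
      push_cast at h3
      by_cases hτ : 0 ≤ τ
      · have e1 := ih (τ - a) (by linarith) (by linarith [min_le_left a b])
        have e2 := ih (τ - b) (by linarith) (by linarith [min_le_right a b])
        have e3 := h1 τ hτ
        have f1 : Real.exp (-δ * (τ - a)) = Real.exp (δ * a) * Real.exp (-δ * τ) := by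
          rw [← Real.exp_add]; ring_nf
        have f2 : Real.exp (-δ * (τ - b)) = Real.exp (δ * b) * Real.exp (-δ * τ) := by
          rw [← Real.exp_add]; ring_nf
        rw [f1] at e1
        rw [f2] at e2
        have g1 := mul_le_mul_of_nonneg_left e1 hp0.le
        have g2 := mul_le_mul_of_nonneg_left e2 hq.le
        have g3 : D * G = C := by rw [hD]; field_simp
        have g4 : D * (p * Real.exp (δ * a) + (1 - p) * Real.exp (δ * b) - 1) *
          Real.exp (-δ * τ) = C * Real.exp (-δ * τ) := by rw [← hG, g3]
        nlinarith
      · exact ih τ h2 ((not_le.1 hτ).le.trans (by positivity))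
  intro τ hτ
  obtain ⟨n, hn⟩ := exists_nat_ge (τ / min a b)
  rw [div_le_iff₀ hm] at hn
  have := key n τ hτ hn
  nlinarith [Real.exp_pos (-δ * τ)]

/-- A holomorphic function that is bounded in a half-strip is Lipschitz in a smaller one. -/
lemma lipschitz_of_bounded_strip {U : ℂ → ℂ} (hU : Differentiable ℂ U) {B K θ : ℝ} (hθ : 0 < θ)
    (hK : ∀ t : ℂ, -(B + 1) ≤ t.re → |t.im| ≤ θ → ‖U t‖ ≤ K) :
    ∃ L, ∀ s t : ℂ, -B ≤ s.re → |s.im| ≤ θ / 2 → -B ≤ t.re → |t.im| ≤ θ / 2 →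
      ‖U s - U t‖ ≤ L * ‖s - t‖ := by
  -- Discs of radius ρ about points of the smaller half-strip stay in the larger one, so Cauchy's
  -- estimate bounds the derivative by K / ρ.
  set ρ := min (θ / 2) 1 with hρ
  have hρ0 : 0 < ρ := lt_min (by linarith) one_pos
  refine ⟨K / ρ, fun s t hs1 hs2 ht1 ht2 => ?_⟩
  set S : Set ℂ := {z | -B ≤ z.re} ∩ {z | |z.im| ≤ θ / 2} with hS
  have hconv : Convex ℝ S := by
    refine (convex_halfSpace_re_ge _).inter ?_
    have : {z : ℂ | |z.im| ≤ θ / 2} = {z : ℂ | -(θ / 2) ≤ z.im} ∩ {z : ℂ | z.im ≤ θ / 2} := by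
      ext z; simp [abs_le]
    rw [this]
    exact (convex_halfSpace_im_ge _).inter (convex_halfSpace_im_le _)
  refine hconv.norm_image_sub_le_of_norm_deriv_le (𝕜 := ℂ) (fun z _ => hU z) (fun z hz => ?_)
    ⟨ht1, ht2⟩ ⟨hs1, hs2⟩
  refine Complex.norm_deriv_le_of_forall_mem_sphere_norm_le hρ0 hU.diffContOnCl fun w hw => ?_
  rw [mem_sphere_iff_norm] at hw
  have h1 := (abs_le.1 ((Complex.abs_re_le_norm (w - z)).trans hw.le)).1
  have h2 := (Complex.abs_im_le_norm (w - z)).trans hw.le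
  rw [Complex.sub_re] at h1
  rw [Complex.sub_im] at h2
  have h3 : ρ ≤ 1 := min_le_right _ _
  have h4 : ρ ≤ θ / 2 := min_le_left _ _
  have h5 : -B ≤ z.re := hz.1
  have h6 : |z.im| ≤ θ / 2 := hz.2
  refine hK w (by linarith) ?_
  calc |w.im| = |(w.im - z.im) + z.im| := by ring_nf
    _ ≤ _ := abs_add_le _ _
    _ ≤ θ := by linarith

/-- The normalised Poisson generating function, in logarithmic coordinates. -/
noncomputable def stripFun (A : ℂ → ℂ) (κ : ℝ) (t : ℂ) : ℂ :=
  Complex.exp (-Complex.exp t) * A (Complex.exp t) * Complex.exp (-t) - κ * t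

/-- The normalised toll function, in logarithmic coordinates. -/
noncomputable def stripToll (g : ℂ → ℂ) (c : ℝ) (t : ℂ) : ℂ :=
  g (Complex.exp t) * Complex.exp (-t) - c

lemma differentiable_stripFun {A : ℂ → ℂ} (hA : Differentiable ℂ A) (κ : ℝ) :
    Differentiable ℂ (stripFun A κ) := by
  unfold stripFun
  have : Differentiable ℂ fun t => A (Complex.exp t) := hA.comp Complex.differentiable_exp
  fun_prop

lemma continuous_stripToll {g : ℂ → ℂ} (hg : Continuous g) (c : ℝ) :
    Continuous (stripToll g c) := by
  unfold stripToll; fun_prop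

lemma entropy_pos {p : ℝ} (hp : p ∈ Set.Ioo (0 : ℝ) 1) : 0 < entropy p := by
  have h1 := Real.log_neg hp.1 hp.2
  have h2 := Real.log_neg (sub_pos.2 hp.2) (by linarith [hp.1])
  unfold entropy
  nlinarith [hp.1, hp.2]

lemma exp_add_log {r : ℝ} (hr : 0 < r) (t : ℂ) :
    Complex.exp (t - ((-Real.log r : ℝ) : ℂ)) = r * Complex.exp t := by
  rw [Complex.ofReal_neg, sub_neg_eq_add, Complex.exp_add, ← Complex.ofReal_exp, Real.exp_log hr,
    mul_comm]

/-- Scaling z by p or 1 - p is a shift of log z. The linear term contributes κ t - pκ(t - a) - (1 -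
p)κ(t - b) = κ h, and κ = c / h makes this equal to c. -/
lemma stripFun_eq {p c : ℝ} (hp : p ∈ Set.Ioo (0 : ℝ) 1) {A g : ℂ → ℂ}
    (hfun : ∀ z, A z = A (p * z) * Complex.exp ((1 - p) * z) +
      A ((1 - p) * z) * Complex.exp (p * z) + Complex.exp z * g z) (t : ℂ) :
    stripFun A (c / entropy p) t =
      p * stripFun A (c / entropy p) (t - ((-Real.log p : ℝ) : ℂ)) +
      (1 - p) * stripFun A (c / entropy p) (t - ((-Real.log (1 - p) : ℝ) : ℂ)) +
      stripToll g c t := by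
  have hq : 0 < 1 - p := sub_pos.2 hp.2
  have hh := (entropy_pos hp).ne'
  have e1 := exp_add_log hp.1 t
  have e2 := exp_add_log hq t
  have e3 : (p : ℂ) * Complex.exp (-(t - ((-Real.log p : ℝ) : ℂ))) = Complex.exp (-t) := by
    rw [Complex.exp_neg, e1, Complex.exp_neg]
    have : (p : ℂ) ≠ 0 := by exact_mod_cast hp.1.ne'
    field_simp
  have e4 : (1 - p : ℂ) * Complex.exp (-(t - ((-Real.log (1 - p) : ℝ) : ℂ))) =
      Complex.exp (-t) := by
    rw [Complex.exp_neg, e2, Complex.exp_neg]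
    have : (1 - p : ℂ) ≠ 0 := by exact_mod_cast hq.ne'
    push_cast
    field_simp
  have e5 : (c : ℂ) = ((c / entropy p : ℝ) : ℂ) * (p * ((-Real.log p : ℝ) : ℂ) +
      (1 - p) * ((-Real.log (1 - p) : ℝ) : ℂ)) := by
    have : c = c / entropy p * (p * -Real.log p + (1 - p) * -Real.log (1 - p)) := by
      rw [show p * -Real.log p + (1 - p) * -Real.log (1 - p) = entropy p by unfold entropy; ring]
      field_simp
    exact_mod_cast this
  have e6 := hfun (Complex.exp t)
  set z := Complex.exp t
  have e7 : Complex.exp (-z) * Complex.exp ((1 - p) * z) = Complex.exp (-(p * z)) := by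
    rw [← Complex.exp_add]; congr 1; ring
  have e8 : Complex.exp (-z) * Complex.exp (p * z) = Complex.exp (-((1 - p) * z)) := by
    rw [← Complex.exp_add]; congr 1; ring
  have e9 : Complex.exp (-z) * Complex.exp z = 1 := by
    rw [← Complex.exp_add]; simp
  have e2' : Complex.exp (t - ((-Real.log (1 - p) : ℝ) : ℂ)) = (1 - p) * z := by
    rw [e2]; push_cast; rfl
  unfold stripFun stripToll
  rw [e1, e2', e6]
  linear_combination (A (p * z) * Complex.exp (-t)) * e7 +
    (A ((1 - p) * z) * Complex.exp (-t)) * e8 + (g z * Complex.exp (-t)) * e9 -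
    (Complex.exp (-(p * z)) * A (p * z)) * e3 -
    (Complex.exp (-((1 - p) * z)) * A ((1 - p) * z)) * e4 + e5

/-- A sector becomes a horizontal strip under the logarithm. The condition θ < π makes Im t the
principal argument of exp t. -/
lemma norm_stripToll_le {g : ℂ → ℂ} {θ c C δ : ℝ} (hθ : θ < Real.pi)
    (hsec : ∀ z : ℂ, 1 ≤ ‖z‖ → |z.arg| ≤ θ → ‖g z - c * z‖ ≤ C * ‖z‖ ^ (1 - δ)) {t : ℂ}
    (ht : 0 ≤ t.re) (hti : |t.im| ≤ θ) : ‖stripToll g c t‖ ≤ C * Real.exp (-δ * t.re) := by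
  have h1 : ‖Complex.exp t‖ = Real.exp t.re := Complex.norm_exp t
  have harg : (Complex.exp t).arg = t.im := by
    rw [Complex.arg_exp, toIocMod_eq_self]
    have := abs_le.1 hti
    constructor <;> linarith
  have h2 := hsec (Complex.exp t) (by rw [h1]; exact Real.one_le_exp ht) (by rwa [harg])
  have h3 : stripToll g c t = (g (Complex.exp t) - c * Complex.exp t) * Complex.exp (-t) := by
    unfold stripToll
    rw [sub_mul, mul_assoc, ← Complex.exp_add]; simp
  rw [h3, norm_mul, Complex.norm_exp (-t), Complex.neg_re]
  rw [h1, ← Real.exp_mul] at h2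
  calc _ ≤ C * Real.exp (t.re * (1 - δ)) * Real.exp (-t.re) := by gcongr
    _ = _ := by rw [mul_assoc, ← Real.exp_add]; ring_nf

/-- The normalised generating function is bounded and Lipschitz in a strip. -/
theorem exists_strip_bounds {p θ c C δ : ℝ} (hp : p ∈ Set.Ioo (0 : ℝ) 1) {A g : ℂ → ℂ}
    (hA : Differentiable ℂ A)
    (hfun : ∀ z, A z = A (p * z) * Complex.exp ((1 - p) * z) +
      A ((1 - p) * z) * Complex.exp (p * z) + Complex.exp z * g z)
    (hθ0 : 0 < θ) (hθ : θ < Real.pi) (hC : 0 ≤ C) (hδ : 0 < δ)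
    (hsec : ∀ z : ℂ, 1 ≤ ‖z‖ → |z.arg| ≤ θ → ‖g z - c * z‖ ≤ C * ‖z‖ ^ (1 - δ)) {B : ℝ}
    (haB : -Real.log p ≤ B) (hbB : -Real.log (1 - p) ≤ B) :
    ∃ K L, (∀ t : ℂ, -B ≤ t.re → |t.im| ≤ θ → ‖stripFun A (c / entropy p) t‖ ≤ K) ∧
      ∀ s t : ℂ, -B ≤ s.re → |s.im| ≤ θ / 2 → -B ≤ t.re → |t.im| ≤ θ / 2 →
        ‖stripFun A (c / entropy p) s - stripFun A (c / entropy p) t‖ ≤ L * ‖s - t‖ := by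
  have hq : 0 < 1 - p := sub_pos.2 hp.2
  have ha : 0 < -Real.log p := by linarith [Real.log_neg hp.1 hp.2]
  have hb : 0 < -Real.log (1 - p) := by linarith [Real.log_neg hq (by linarith [hp.1])]
  set U := stripFun A (c / entropy p) with hU
  have hdU : Differentiable ℂ U := differentiable_stripFun hA _
  have hcomp : IsCompact (Set.Icc (-(B + 1)) 0 ×ℂ Set.Icc (-θ) θ) :=
    isCompact_Icc.reProdIm isCompact_Icc
  obtain ⟨K₀, hK₀⟩ := hcomp.exists_bound_of_continuousOn hdU.continuous.continuousOn
  obtain ⟨M, hM⟩ := renewal_bound (K := K₀) hp ha hb (show _ ≤ B + 1 by linarith)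
    (show _ ≤ B + 1 by linarith) hC hδ
  have hbd : ∀ t : ℂ, -(B + 1) ≤ t.re → |t.im| ≤ θ → ‖U t‖ ≤ M := by
    intro t ht hti
    -- The shifts are real, so the renewal inequality holds along each horizontal line, with initial
    -- values on a compact rectangle.
    have h1 := hM (fun τ => ‖U (⟨τ, t.im⟩)‖) (fun τ h2 h3 => hK₀ _
      (Complex.mem_reProdIm.2 ⟨⟨h2, h3⟩, abs_le.1 hti⟩)) (fun τ hτ => by
        have e := stripFun_eq (c := c) hp hfun ⟨τ, t.im⟩
        have s1 : ∀ d : ℝ, (⟨τ, t.im⟩ : ℂ) - (d : ℂ) = ⟨τ - d, t.im⟩ := fun d => by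
          apply Complex.ext <;> simp
        rw [s1, s1, ← hU] at e
        rw [e]
        refine norm_add₃_le.trans ?_
        have n1 : ‖(p : ℂ)‖ = p := by rw [Complex.norm_real, Real.norm_of_nonneg hp.1.le]
        have n2 : ‖(1 - p : ℂ)‖ = 1 - p := by
          rw [← Complex.ofReal_one, ← Complex.ofReal_sub, Complex.norm_real,
            Real.norm_of_nonneg hq.le]
        rw [norm_mul, norm_mul, n1, n2]
        exact add_le_add le_rfl (norm_stripToll_le (t := ⟨τ, t.im⟩) hθ hsec hτ hti)) t.re ht
    exact h1
  obtain ⟨L, hL⟩ := lipschitz_of_bounded_strip hdU hθ0 hbd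
  exact ⟨M, L, fun t ht => hbd t (by linarith), hL⟩

/-- The bound outside a sector. -/
theorem exists_outer_bound {p θ C ε : ℝ} (hp : p ∈ Set.Ioo (0 : ℝ) 1) {A g : ℂ → ℂ}
    (hA : Continuous A)
    (hfun : ∀ z, A z = A (p * z) * Complex.exp ((1 - p) * z) +
      A ((1 - p) * z) * Complex.exp (p * z) + Complex.exp z * g z)
    (hθ0 : 0 < θ) (hθ : θ < Real.pi / 2) (hε : 0 < ε)
    (hout : ∀ z : ℂ, 1 ≤ ‖z‖ → θ ≤ |z.arg| →
      ‖Complex.exp z * g z‖ ≤ C * Real.exp ((1 - ε) * ‖z‖)) :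
    ∃ ε' > 0, ∃ C', 0 ≤ C' ∧ ∀ z : ℂ, θ ≤ |z.arg| → ‖A z‖ ≤ C' * Real.exp ((1 - ε') * ‖z‖) := by
  have hp0 := hp.1
  have hq : 0 < 1 - p := sub_pos.2 hp.2
  have hcos0 : 0 < Real.cos θ := Real.cos_pos_of_mem_Ioo ⟨by linarith, hθ⟩
  have hcos1 : Real.cos θ < 1 := by
    rw [← Real.cos_zero]
    exact Real.cos_lt_cos_of_nonneg_of_le_pi le_rfl (by linarith [Real.pi_pos]) hθ0
  -- Outside the sector Re z ≤ (1 - 2η)|z|. As e ≤ η, each product A(xz) exp(yz) gains a factor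
  -- exp(-yη|z|) over the bound to be proved.
  set η := (1 - Real.cos θ) / 2 with hη
  have hη0 : 0 < η := by linarith
  set e := min ε η with he
  have he0 : 0 < e := lt_min hε hη0
  have heη : e ≤ η := min_le_right _ _
  have heε : e ≤ ε := min_le_left _ _
  have hre : ∀ z : ℂ, θ ≤ |z.arg| → z.re ≤ ‖z‖ * Real.cos θ := fun z hz => by
    rw [← Complex.norm_mul_cos_arg z, ← Real.cos_abs]
    exact mul_le_mul_of_nonneg_left (Real.cos_le_cos_of_nonneg_of_le_pi hθ0.le
      (Complex.abs_arg_le_pi z) hz) (norm_nonneg z)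
  have hlim : Tendsto (fun r : ℝ => Real.exp (-((1 - p) * η) * r) + Real.exp (-(p * η) * r)) atTop
      (𝓝 0) := by
    have h1 : ∀ x : ℝ, 0 < x → Tendsto (fun r : ℝ => Real.exp (-x * r)) atTop (𝓝 0) := fun x hx =>
      Real.tendsto_exp_atBot.comp (tendsto_id.const_mul_atTop_of_neg (by linarith))
    simpa using (h1 _ (mul_pos hq hη0)).add (h1 _ (mul_pos hp0 hη0))
  obtain ⟨R₀, hR₀⟩ := eventually_atTop.1 (hlim.eventually (ge_mem_nhds (show (0 : ℝ) < 1 / 2 by norm_num)))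
  set R := max R₀ 1 with hR
  obtain ⟨K, hK⟩ := (isCompact_closedBall (0 : ℂ) R).exists_bound_of_continuousOn hA.continuousOn
  have hK0 : 0 ≤ K := (norm_nonneg _).trans (hK 0 (by simp [hR]))
  -- Beyond R₀ the two gained factors sum to at most 1/2. The other half of C' pays for the toll,
  -- and K for the disc.
  set C' := K + 2 * |C| with hC'
  have hC'0 : 0 ≤ C' := by positivity
  refine ⟨e, he0, C', hC'0, ?_⟩
  set μ := max p (1 - p) with hμ
  have hμ0 : 0 < μ := lt_max_of_lt_left hp0
  have hμ1 : μ < 1 := max_lt hp.2 (by linarith)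
  -- Induction on the number of scalings by at most μ that bring z into the disc of radius R.
  -- Positive scalings preserve the argument.
  have key : ∀ n : ℕ, ∀ z : ℂ, θ ≤ |z.arg| → ‖z‖ * μ ^ n ≤ R →
      ‖A z‖ ≤ C' * Real.exp ((1 - e) * ‖z‖) := by
    intro n
    have base : ∀ z : ℂ, ‖z‖ ≤ R → ‖A z‖ ≤ C' * Real.exp ((1 - e) * ‖z‖) := fun z hz => by
      have h1 := hK z (by simpa using hz)
      have h2 : 1 ≤ Real.exp ((1 - e) * ‖z‖) :=
        Real.one_le_exp (mul_nonneg (by linarith) (norm_nonneg _))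
      nlinarith [abs_nonneg C]
    induction n with
    | zero => exact fun z _ hz => base z (by simpa using hz)
    | succ n ih =>
      intro z hz hzn
      by_cases hzR : ‖z‖ ≤ R
      · exact base z hzR
      · push Not at hzR
        have hmul : ∀ x y : ℝ, 0 < x → 0 < y → x + y = 1 → x ≤ μ →
            ‖A (x * z) * Complex.exp (y * z)‖ ≤
              C' * Real.exp ((1 - e) * ‖z‖) * Real.exp (-(y * η) * ‖z‖) := by
          intro x y hx hy hxy hxμ
          have nx : ‖(x : ℂ) * z‖ = x * ‖z‖ := by
            rw [norm_mul, Complex.norm_real, Real.norm_of_nonneg hx.le]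
          have h1 := ih (x * z) (by rwa [Complex.arg_real_mul z hx]) (by
            rw [nx]
            refine le_trans ?_ hzn
            rw [pow_succ]
            nlinarith [mul_nonneg (norm_nonneg z) (pow_pos hμ0 n).le])
          rw [nx] at h1
          have h2 : ‖Complex.exp (y * z)‖ ≤ Real.exp (y * (‖z‖ * Real.cos θ)) := by
            rw [Complex.norm_exp, Complex.re_ofReal_mul, Real.exp_le_exp]
            exact mul_le_mul_of_nonneg_left (hre z hz) hy.le
          rw [norm_mul]
          calc _ ≤ C' * Real.exp ((1 - e) * (x * ‖z‖)) * Real.exp (y * (‖z‖ * Real.cos θ)) :=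
                mul_le_mul h1 h2 (norm_nonneg _) (by positivity)
            _ ≤ _ := by
                rw [mul_assoc, mul_assoc, ← Real.exp_add, ← Real.exp_add]
                refine mul_le_mul_of_nonneg_left (Real.exp_le_exp.2 ?_) hC'0
                have hc : Real.cos θ = 1 - 2 * η := by rw [hη]; ring
                have hx' : x = 1 - y := by linarith
                rw [hc, hx']
                nlinarith [mul_nonneg hy.le (norm_nonneg z)]
        have h1 := hmul p (1 - p) hp0 hq (by ring) (le_max_left _ _)
        have h2 := hmul (1 - p) p hq hp0 (by ring) (le_max_right _ _)
        have h3 := hout z ((le_max_right _ _).trans hzR.le) hz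
        have h4 := hR₀ ‖z‖ ((le_max_left _ _).trans hzR.le)
        have h5 : C * Real.exp ((1 - ε) * ‖z‖) ≤ |C| * Real.exp ((1 - e) * ‖z‖) := by
          refine mul_le_mul (le_abs_self C) (Real.exp_le_exp.2 ?_) (Real.exp_nonneg _) (abs_nonneg C)
          exact mul_le_mul_of_nonneg_right (by linarith) (norm_nonneg z)
        push_cast at h1 h2
        rw [hfun z]
        refine norm_add₃_le.trans ?_
        have h6 : 0 < Real.exp ((1 - e) * ‖z‖) := Real.exp_pos _
        have h7 := mul_le_mul_of_nonneg_left h4 (mul_nonneg hC'0 h6.le)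
        have h8 : |C| ≤ C' / 2 := by rw [hC']; linarith
        have h9 := mul_le_mul_of_nonneg_right h8 h6.le
        linarith
  intro z hz
  have h1 : Tendsto (fun n : ℕ => ‖z‖ * μ ^ n) atTop (𝓝 0) := by
    simpa using (tendsto_pow_atTop_nhds_zero_of_lt_one hμ0.le hμ1).const_mul ‖z‖
  obtain ⟨n, hn⟩ := (h1.eventually (ge_mem_nhds (show (0 : ℝ) < R by
    exact lt_of_lt_of_le one_pos (le_max_right _ _)))).exists
  exact key n z hz hn

/-! ### Depoissonization -/

lemma integral_exp_int_mul_I (m : ℤ) :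
    ∫ φ in (-Real.pi)..Real.pi, Complex.exp (m * Complex.I * φ) =
      if m = 0 then 2 * (Real.pi : ℂ) else 0 := by
  split_ifs with h
  · subst h
    simp
    ring
  · have hm : (m : ℂ) * Complex.I ≠ 0 := mul_ne_zero (by exact_mod_cast h) Complex.I_ne_zero
    rw [integral_exp_mul_complex hm, div_eq_zero_iff]
    left
    rw [sub_eq_zero, Complex.exp_eq_exp_iff_exists_int]
    exact ⟨m, by push_cast; ring⟩

/-- Cauchy's coefficient estimate, in integral form. -/
lemma norm_coeff_mul_pow_le {b : ℕ → ℂ} {F : ℂ → ℂ} (hF : ∀ z, HasSum (fun k => b k * z ^ k) (F z))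
    {R : ℝ} (hR : 0 ≤ R) (n : ℕ) :
    ‖b n‖ * R ^ n ≤ (2 * Real.pi)⁻¹ *
      ∫ φ in (-Real.pi)..Real.pi, ‖F (R * Complex.exp (φ * Complex.I))‖ := by
  have hπ := Real.pi_pos
  have hs : Summable fun k => ‖b k‖ * R ^ k := by
    have := (hF R).summable.norm
    simpa [norm_mul, norm_pow, abs_of_nonneg hR] using this
  have h1 : HasSum (fun k => ∫ φ in (-Real.pi)..Real.pi,
      b k * (R * Complex.exp (φ * Complex.I)) ^ k * Complex.exp (-(n * Complex.I * φ)))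
      (∫ φ in (-Real.pi)..Real.pi, F (R * Complex.exp (φ * Complex.I)) *
        Complex.exp (-(n * Complex.I * φ))) := by
    refine intervalIntegral.hasSum_integral_of_dominated_convergence (fun k _ => ‖b k‖ * R ^ k)
      (fun k => Continuous.aestronglyMeasurable (by fun_prop)) (fun k => ae_of_all _ fun φ _ => ?_)
      (ae_of_all _ fun _ _ => hs) (by simp) (ae_of_all _ fun φ _ => (hF _).mul_right _)
    have e1 : ‖Complex.exp (-(n * Complex.I * φ))‖ = 1 := by
      rw [show -(n * Complex.I * φ) = ((-(n * φ) : ℝ) : ℂ) * Complex.I by push_cast; ring,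
        Complex.norm_exp_ofReal_mul_I]
    rw [norm_mul, norm_mul, norm_pow, norm_mul, e1, Complex.norm_exp_ofReal_mul_I,
      Complex.norm_real, Real.norm_of_nonneg hR, mul_one, mul_one]
  have h2 : ∀ k : ℕ, ∫ φ in (-Real.pi)..Real.pi,
      b k * (R * Complex.exp (φ * Complex.I)) ^ k * Complex.exp (-(n * Complex.I * φ)) =
      if k = n then b n * R ^ n * (2 * Real.pi) else 0 := fun k => by
    have e : ∀ φ : ℝ, b k * (R * Complex.exp (φ * Complex.I)) ^ k *
        Complex.exp (-(n * Complex.I * φ)) =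
        b k * R ^ k * Complex.exp (((k - n : ℤ) : ℂ) * Complex.I * φ) := fun φ => by
      have e1 : Complex.exp (((k - n : ℤ) : ℂ) * Complex.I * φ) =
          Complex.exp (k * (φ * Complex.I)) * Complex.exp (-(n * Complex.I * φ)) := by
        rw [← Complex.exp_add]; congr 1; push_cast; ring
      rw [mul_pow, ← Complex.exp_nat_mul, e1]
      ring
    simp_rw [e]
    rw [intervalIntegral.integral_const_mul, integral_exp_int_mul_I]
    by_cases hkn : k = n
    · simp [hkn]
    · rw [if_neg hkn, if_neg (by omega), mul_zero]
  simp_rw [h2] at h1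
  have h3 := h1.unique (hasSum_ite_eq n (b n * R ^ n * (2 * Real.pi)))
  have h4 : ‖b n * R ^ n * (2 * Real.pi)‖ = ‖b n‖ * R ^ n * (2 * Real.pi) := by
    rw [norm_mul, norm_mul, norm_pow, Complex.norm_real, Real.norm_of_nonneg hR]
    simp [abs_of_pos hπ]
  have h5 : ‖b n‖ * R ^ n * (2 * Real.pi) ≤
      ∫ φ in (-Real.pi)..Real.pi, ‖F (R * Complex.exp (φ * Complex.I))‖ := by
    rw [← h4, ← h3]
    refine (intervalIntegral.norm_integral_le_integral_norm (by linarith)).trans (le_of_eq ?_)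
    refine intervalIntegral.integral_congr fun φ _ => ?_
    have e1 : ‖Complex.exp (-(n * Complex.I * φ))‖ = 1 := by
      rw [show -(n * Complex.I * φ) = ((-(n * φ) : ℝ) : ℂ) * Complex.I by push_cast; ring,
        Complex.norm_exp_ofReal_mul_I]
    rw [norm_mul, e1, mul_one]
  rw [inv_mul_eq_div, le_div_iff₀ (by positivity)]
  exact h5

lemma integral_abs_mul_exp_neg_sq_le {k : ℝ} (hk : 0 < k) (r : ℝ) :
    ∫ φ in (-r)..r, |φ| * Real.exp (-k * φ ^ 2) ≤ 1 / k := by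
  wlog hr : 0 ≤ r
  · rw [intervalIntegral.integral_symm]
    have h1 : 0 ≤ ∫ φ in r..(-r), |φ| * Real.exp (-k * φ ^ 2) :=
      intervalIntegral.integral_nonneg (by linarith) fun _ _ => by positivity
    have : 0 < 1 / k := by positivity
    linarith
  have hc : Continuous fun φ : ℝ => |φ| * Real.exp (-k * φ ^ 2) := by fun_prop
  have h1 : ∫ φ in (0 : ℝ)..r, |φ| * Real.exp (-k * φ ^ 2) ≤ 1 / (2 * k) := by
    have h2 : ∫ φ in (0 : ℝ)..r, |φ| * Real.exp (-k * φ ^ 2) =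
        ∫ φ in (0 : ℝ)..r, φ * Real.exp (-k * φ ^ 2) :=
      intervalIntegral.integral_congr fun φ hφ => by
        rw [Set.uIcc_of_le hr] at hφ
        simp only [abs_of_nonneg hφ.1]
    have h3 : ∀ φ ∈ Set.uIcc 0 r, HasDerivAt (fun φ : ℝ => -(1 / (2 * k)) * Real.exp (-k * φ ^ 2))
        (φ * Real.exp (-k * φ ^ 2)) φ := fun φ _ => by
      have := (((hasDerivAt_pow 2 φ).const_mul (-k)).exp).const_mul (-(1 / (2 * k)))
      refine this.congr_deriv ?_
      simp
      field_simp
    rw [h2, intervalIntegral.integral_eq_sub_of_hasDerivAt h3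
      (Continuous.intervalIntegrable (by fun_prop) _ _)]
    have : 0 ≤ 1 / (2 * k) * Real.exp (-k * r ^ 2) := by positivity
    simp
    field_simp at this ⊢
    linarith [Real.exp_pos (-(k * r ^ 2))]
  have h4 : ∫ φ in (-r)..0, |φ| * Real.exp (-k * φ ^ 2) =
      ∫ φ in (0 : ℝ)..r, |φ| * Real.exp (-k * φ ^ 2) := by
    have := intervalIntegral.integral_comp_neg (a := 0) (b := r)
      (fun φ : ℝ => |φ| * Real.exp (-k * φ ^ 2))
    simpa using this.symm
  rw [← intervalIntegral.integral_add_adjacent_intervals (hc.intervalIntegrable (-r) 0)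
    (hc.intervalIntegrable 0 r), h4]
  have : 1 / k = 1 / (2 * k) + 1 / (2 * k) := by field_simp; norm_num
  linarith

/-- The Stirling sequence converges, hence is bounded. The constant also absorbs its factor √2. -/
lemma exists_factorial_le : ∃ S : ℝ, 0 < S ∧ ∀ n : ℕ, 1 ≤ n →
    (n.factorial : ℝ) ≤ S * Real.sqrt n * (n ^ n * Real.exp (-n)) := by
  obtain ⟨S, hS⟩ := Stirling.tendsto_stirlingSeq_sqrt_pi.bddAbove_range
  refine ⟨|S| * Real.sqrt 2 + 1, by positivity, fun n hn => ?_⟩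
  have h1 : Stirling.stirlingSeq n ≤ |S| := (hS ⟨n, rfl⟩).trans (le_abs_self S)
  have hn0 : (0 : ℝ) < n := by exact_mod_cast hn
  unfold Stirling.stirlingSeq at h1
  rw [div_le_iff₀ (by positivity)] at h1
  refine h1.trans ?_
  have e1 : ((n : ℝ) / Real.exp 1) ^ n = n ^ n * Real.exp (-n) := by
    rw [div_pow, ← Real.exp_nat_mul, mul_one, Real.exp_neg, div_eq_mul_inv]
  rw [e1, Real.sqrt_mul (by norm_num)]
  have : 0 ≤ Real.sqrt n * (n ^ n * Real.exp (-n)) := by positivity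
  nlinarith

lemma mul_exp_neg_le {x y : ℝ} (hy : 0 < y) : x * Real.exp (-y * x) ≤ 1 / y := by
  have h1 := Real.add_one_le_exp (y * x)
  rw [neg_mul, Real.exp_neg, ← div_eq_mul_inv, div_le_div_iff₀ (Real.exp_pos _) hy]
  nlinarith

set_option maxHeartbeats 1000000 in
/-- Depoissonization: the coefficients are approximated by the values of the normalised generating
function. -/
theorem depoissonization {A : ℂ → ℂ} {x : ℕ → ℝ} {κ θ K L C ε : ℝ}
    (hA : Continuous A)
    (hsum : ∀ z, HasSum (fun n : ℕ => (x n : ℂ) / (n.factorial : ℂ) * z ^ n) (A z))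
    (hθ0 : 0 < θ) (hθ : θ < Real.pi / 2) (hε : 0 < ε) (hC : 0 ≤ C)
    (hK : ∀ t : ℂ, 0 ≤ t.re → |t.im| ≤ θ → ‖stripFun A κ t‖ ≤ K)
    (hL : ∀ s t : ℂ, 0 ≤ s.re → |s.im| ≤ θ → 0 ≤ t.re → |t.im| ≤ θ →
      ‖stripFun A κ s - stripFun A κ t‖ ≤ L * ‖s - t‖)
    (hout : ∀ z : ℂ, θ ≤ |z.arg| → ‖A z‖ ≤ C * Real.exp ((1 - ε) * ‖z‖)) :
    Tendsto (fun n : ℕ => ((x n : ℂ) / n) - (stripFun A κ (Real.log n) + κ * Real.log n)) atTop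
      (𝓝 0) := by
  have hπ := Real.pi_pos
  have hK0 : 0 ≤ K := (norm_nonneg _).trans (hK 0 le_rfl (by simpa using hθ0.le))
  have hL0 : 0 ≤ L := by
    simpa using (norm_nonneg _).trans (hL 1 0 (by simp) (by simpa using hθ0.le) le_rfl
      (by simpa using hθ0.le))
  obtain ⟨S, hS0, hS⟩ := exists_factorial_le
  set η := 1 - Real.cos θ with hη
  have hη0 : 0 < η := by
    rw [hη, sub_pos, ← Real.cos_zero]
    exact Real.cos_lt_cos_of_nonneg_of_le_pi le_rfl (by linarith) hθ0
  set M := K + L + 2 * |κ| with hM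
  have hM0 : 0 ≤ M := by positivity
  -- The first term comes from the Gaussian integral over the arc with k = 2n/π², since n/k = π²/2.
  -- The second is 2π times the bound for the rest of the circle.
  set Q := M * (Real.pi ^ 2 / 2) + 2 * Real.pi * (C + M / η) with hQ
  have hQ0 : 0 ≤ Q := by positivity
  have key : ∀ n : ℕ, 1 ≤ n →
      ‖((x n : ℂ) / n) - (stripFun A κ (Real.log n) + κ * Real.log n)‖ ≤
        S * (2 * Real.pi)⁻¹ * Q * ((1 + Real.log n) / Real.sqrt n) := by
    intro n hn
    have hn1 : (1 : ℝ) ≤ n := by exact_mod_cast hn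
    have hn0 : (0 : ℝ) < n := by linarith
    have hnc : (n : ℂ) ≠ 0 := by exact_mod_cast hn0.ne'
    have hlog : 0 ≤ Real.log n := Real.log_nonneg hn1
    set ℓ := 1 + Real.log n with hℓ
    have hℓ1 : 1 ≤ ℓ := by linarith
    set U₀ := stripFun A κ (Real.log n) + κ * Real.log n with hU₀
    have hexpn : Complex.exp ((Real.log n : ℝ) : ℂ) = n := by
      rw [← Complex.ofReal_exp, Real.exp_log hn0]; simp
    have hU₀A : Complex.exp (-n) * A n = n * U₀ := by
      rw [hU₀]; unfold stripFun
      rw [hexpn, Complex.exp_neg ((Real.log n : ℝ) : ℂ), hexpn]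
      field_simp
      ring
    have hU₀n : ‖U₀‖ ≤ M * ℓ := by
      have h1 := hK (Real.log n : ℝ) (by rw [Complex.ofReal_re]; exact hlog) (by rw [Complex.ofReal_im, abs_zero]; exact hθ0.le)
      refine (norm_add_le _ _).trans ?_
      rw [norm_mul, Complex.norm_real, Complex.norm_real, Real.norm_eq_abs,
        Real.norm_of_nonneg hlog]
      nlinarith [abs_nonneg κ, mul_nonneg (abs_nonneg κ) hlog, mul_nonneg hK0 hlog,
        mul_nonneg hL0 hlog]
    -- The k-th coefficient of F is (x_k - n U₀)/k!, so Cauchy's estimate at k = n bounds exactly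
    -- the error sought. Moreover F(n) = 0.
    set F : ℂ → ℂ := fun z => A z - n * U₀ * Complex.exp z with hF
    have hFsum : ∀ z, HasSum (fun k : ℕ => (((x k : ℂ) - n * U₀) / (k.factorial : ℂ)) * z ^ k)
        (F z) := fun z => by
      have h2 : HasSum (fun k : ℕ => z ^ k / (k.factorial : ℂ)) (Complex.exp z) := by
        rw [Complex.exp_eq_exp_ℂ]; exact NormedSpace.expSeries_div_hasSum_exp z
      refine ((hsum z).sub (h2.mul_left (n * U₀))).congr_fun fun k => ?_
      ring
    have hcF : Continuous F := by fun_prop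
    have hco := norm_coeff_mul_pow_le hFsum hn0.le n
    have hpt : ∀ φ ∈ Set.Icc (-Real.pi) Real.pi, ‖F ((n : ℝ) * Complex.exp (φ * Complex.I))‖ ≤
        Real.exp n * (n * (M * ℓ) * (|φ| * Real.exp (-(2 * n / Real.pi ^ 2) * φ ^ 2)) +
          ℓ * (C + M / η)) := by
      intro φ hφ
      have hφπ : |φ| ≤ Real.pi := abs_le.2 hφ
      set z : ℂ := (n : ℝ) * Complex.exp (φ * Complex.I) with hz
      have hzn : ‖z‖ = n := by
        rw [hz, norm_mul, Complex.norm_exp_ofReal_mul_I, Complex.norm_real,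
          Real.norm_of_nonneg hn0.le, mul_one]
      have hzre : z.re = n * Real.cos φ := by
        rw [hz, Complex.re_ofReal_mul, Complex.exp_ofReal_mul_I_re]
      have hez : ‖Complex.exp z‖ = Real.exp (n * Real.cos φ) := by rw [Complex.norm_exp, hzre]
      rcases le_or_gt |φ| θ with hφθ | hφθ
      · set t : ℂ := Real.log n + φ * Complex.I with ht
        have htz : Complex.exp t = z := by
          rw [ht, Complex.exp_add, hexpn, hz]; simp
        have htre : t.re = Real.log n := by
          rw [ht, Complex.add_re, Complex.ofReal_re]; simp
        have htim : t.im = φ := by rw [ht, Complex.add_im, Complex.ofReal_im]; simp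
        have hz0 : z ≠ 0 := by rw [← norm_ne_zero_iff, hzn]; exact hn0.ne'
        have hAz : A z = Complex.exp z * (z * (stripFun A κ t + κ * t)) := by
          unfold stripFun
          rw [htz, Complex.exp_neg t, htz, Complex.exp_neg]
          have := Complex.exp_ne_zero z
          field_simp
          ring
        -- On the arc near the axis both U(t) - U(log n) and z - n are of first order in φ. Against
        -- the Gaussian this saves a factor √n more than a mere bound on F would.
        have h1 : F z = Complex.exp z * (z * ((stripFun A κ t - stripFun A κ (Real.log n)) +
            κ * (φ * Complex.I)) + (z - n) * U₀) := by
          simp only [hF]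
          rw [hAz, hU₀, ht]
          ring
        have h2 : ‖z - n‖ ≤ n * |φ| := by
          have : z - n = n * (Complex.exp (Complex.I * φ) - 1) := by
            rw [hz, mul_comm (φ : ℂ)]; push_cast; ring
          rw [this, norm_mul, Complex.norm_natCast]
          exact mul_le_mul_of_nonneg_left (Real.norm_exp_I_mul_ofReal_sub_one_le (x := φ)) hn0.le
        have h3 := hL t (Real.log n : ℝ) (by rw [htre]; exact hlog) (by rwa [htim])
          (by rw [Complex.ofReal_re]; exact hlog) (by rw [Complex.ofReal_im, abs_zero]; exact hθ0.le)
        have h4 : ‖t - (Real.log n : ℝ)‖ = |φ| := by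
          rw [ht, add_sub_cancel_left, norm_mul, Complex.norm_I, Complex.norm_real, mul_one,
            Real.norm_eq_abs]
        rw [h4] at h3
        have h5 : ‖z * ((stripFun A κ t - stripFun A κ (Real.log n)) +
            κ * (φ * Complex.I)) + (z - n) * U₀‖ ≤ n * (M * ℓ) * |φ| * 1 := by
          refine (norm_add_le _ _).trans ?_
          rw [norm_mul z, norm_mul (z - n), hzn]
          have h6 : ‖stripFun A κ t - stripFun A κ (Real.log n) + κ * (φ * Complex.I)‖ ≤
              (L + |κ|) * |φ| := by
            refine (norm_add_le _ _).trans ?_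
            rw [norm_mul, norm_mul, Complex.norm_I, Complex.norm_real, Complex.norm_real, mul_one,
              Real.norm_eq_abs, Real.norm_eq_abs]
            linarith
          have h7 : ‖U₀‖ ≤ (K + |κ|) * ℓ := by
            have h1 := hK (Real.log n : ℝ) (by rw [Complex.ofReal_re]; exact hlog) (by rw [Complex.ofReal_im, abs_zero]; exact hθ0.le)
            refine (norm_add_le _ _).trans ?_
            rw [norm_mul, Complex.norm_real, Complex.norm_real, Real.norm_eq_abs,
              Real.norm_of_nonneg hlog]
            nlinarith [abs_nonneg κ, mul_nonneg (abs_nonneg κ) hlog, mul_nonneg hK0 hlog]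
          have h8 : (L + |κ|) ≤ (L + |κ|) * ℓ := le_mul_of_one_le_right (by positivity) hℓ1
          calc n * ‖stripFun A κ t - stripFun A κ (Real.log n) + κ * (φ * Complex.I)‖ +
                ‖z - n‖ * ‖U₀‖ ≤ n * ((L + |κ|) * ℓ * |φ|) + n * |φ| * ((K + |κ|) * ℓ) := by
                refine add_le_add (mul_le_mul_of_nonneg_left (h6.trans ?_) hn0.le)
                  (mul_le_mul h2 h7 (norm_nonneg _) (by positivity))
                exact mul_le_mul_of_nonneg_right h8 (abs_nonneg φ)
            _ = _ := by rw [hM]; ring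
        have h9 : Real.exp (n * Real.cos φ) ≤
            Real.exp n * Real.exp (-(2 * n / Real.pi ^ 2) * φ ^ 2) := by
          rw [← Real.exp_add, Real.exp_le_exp]
          have := mul_le_mul_of_nonneg_left (Real.cos_le_one_sub_mul_cos_sq hφπ) hn0.le
          calc _ ≤ _ := this
            _ = _ := by ring
        rw [h1, norm_mul, hez]
        have h10 : 0 ≤ ℓ * (C + M / η) := by positivity
        calc _ ≤ Real.exp n * Real.exp (-(2 * n / Real.pi ^ 2) * φ ^ 2) *
              (n * (M * ℓ) * |φ| * 1) := mul_le_mul h9 h5 (norm_nonneg _) (by positivity)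
          _ = Real.exp n * (n * (M * ℓ) * (|φ| * Real.exp (-(2 * n / Real.pi ^ 2) * φ ^ 2))) := by
              ring
          _ ≤ _ := mul_le_mul_of_nonneg_left (by linarith) (Real.exp_nonneg _)
      · have h1 : θ ≤ |z.arg| := by
          -- At the endpoint φ = -π the principal argument is π.
          rcases eq_or_lt_of_le hφ.1 with h0 | h0
          · have : z.arg = Real.pi := by
              rw [hz, Complex.arg_real_mul _ hn0, ← h0, Complex.ofReal_neg, neg_mul, Complex.exp_neg,
                Complex.exp_pi_mul_I]
              norm_num
            rw [this, abs_of_pos hπ]; linarith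
          · have : z.arg = φ := by
              rw [hz, Complex.arg_real_mul _ hn0, Complex.arg_exp_mul_I, toIocMod_eq_self]
              exact ⟨h0, by linarith [hφ.2]⟩
            rw [this]; exact hφθ.le
        have h2 := hout z h1
        rw [hzn] at h2
        have h3 : Real.cos φ ≤ Real.cos θ := by
          rw [← Real.cos_abs φ]
          exact Real.cos_le_cos_of_nonneg_of_le_pi hθ0.le hφπ hφθ.le
        have h4 : C * Real.exp ((1 - ε) * n) ≤ Real.exp n * (ℓ * C) := by
          have : Real.exp ((1 - ε) * n) ≤ Real.exp n := Real.exp_le_exp.2 (by nlinarith)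
          nlinarith [mul_le_mul_of_nonneg_left this hC, mul_nonneg hC (Real.exp_nonneg n),
            mul_nonneg (mul_nonneg hC (Real.exp_nonneg n)) hlog]
        have h5 : ‖n * U₀ * Complex.exp z‖ ≤ Real.exp n * (ℓ * (M / η)) := by
          rw [norm_mul, norm_mul, Complex.norm_natCast, hez]
          have e1 : Real.exp (n * Real.cos φ) ≤ Real.exp n * Real.exp (-η * n) := by
            rw [← Real.exp_add, Real.exp_le_exp, hη]; nlinarith
          calc n * ‖U₀‖ * Real.exp (n * Real.cos φ) ≤
                n * (M * ℓ) * (Real.exp n * Real.exp (-η * n)) :=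
                mul_le_mul (mul_le_mul_of_nonneg_left hU₀n hn0.le) e1 (Real.exp_nonneg _)
                  (by positivity)
            _ = Real.exp n * (ℓ * M) * (n * Real.exp (-η * n)) := by ring
            _ ≤ Real.exp n * (ℓ * M) * (1 / η) :=
                mul_le_mul_of_nonneg_left (mul_exp_neg_le hη0) (by positivity)
            _ = _ := by ring
        have h6 : 0 ≤ n * (M * ℓ) * (|φ| * Real.exp (-(2 * n / Real.pi ^ 2) * φ ^ 2)) := by
          positivity
        calc ‖F z‖ ≤ ‖A z‖ + ‖n * U₀ * Complex.exp z‖ := norm_sub_le _ _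
          _ ≤ Real.exp n * (ℓ * C) + Real.exp n * (ℓ * (M / η)) := add_le_add (h2.trans h4) h5
          _ = Real.exp n * (0 + ℓ * (C + M / η)) := by ring
          _ ≤ _ := mul_le_mul_of_nonneg_left (by linarith) (Real.exp_nonneg _)
    have hint : ∫ φ in (-Real.pi)..Real.pi, ‖F ((n : ℝ) * Complex.exp (φ * Complex.I))‖ ≤
        Real.exp n * (ℓ * Q) := by
      refine (intervalIntegral.integral_mono_on (by linarith)
        (Continuous.intervalIntegrable (by fun_prop) _ _)
        (Continuous.intervalIntegrable (by fun_prop) _ _) hpt).trans ?_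
      rw [intervalIntegral.integral_const_mul, intervalIntegral.integral_add
        (Continuous.intervalIntegrable (by fun_prop) _ _)
        (Continuous.intervalIntegrable (by fun_prop) _ _), intervalIntegral.integral_const_mul,
        intervalIntegral.integral_const, smul_eq_mul]
      refine mul_le_mul_of_nonneg_left ?_ (Real.exp_nonneg _)
      have h1 := integral_abs_mul_exp_neg_sq_le (k := 2 * n / Real.pi ^ 2) (by positivity) Real.pi
      have h2 := mul_le_mul_of_nonneg_left h1 (show 0 ≤ n * (M * ℓ) by positivity)
      have h3 : n * (M * ℓ) * (1 / (2 * n / Real.pi ^ 2)) = ℓ * (M * (Real.pi ^ 2 / 2)) := by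
        field_simp
      rw [h3] at h2
      rw [hQ]
      linarith
    have h1 : ‖((x n : ℂ) - n * U₀) / (n.factorial : ℂ)‖ = ‖(x n : ℂ) - n * U₀‖ / n.factorial := by
      rw [norm_div, Complex.norm_natCast]
    rw [h1] at hco
    have h2 : ‖(x n : ℂ) - n * U₀‖ ≤ S * Real.sqrt n * ((2 * Real.pi)⁻¹ * (ℓ * Q)) := by
      have hfac : (0 : ℝ) < n.factorial := by exact_mod_cast n.factorial_pos
      have hnn : (0 : ℝ) < (n : ℝ) ^ n := by positivity
      have h3 : ‖(x n : ℂ) - n * U₀‖ * n ^ n ≤ (2 * Real.pi)⁻¹ * (Real.exp n * (ℓ * Q)) *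
          n.factorial := by
        have h4 := hco.trans (mul_le_mul_of_nonneg_left hint (by positivity))
        rw [div_mul_eq_mul_div, div_le_iff₀ hfac] at h4
        exact h4
      have h5 := mul_le_mul_of_nonneg_left (hS n hn)
        (show 0 ≤ (2 * Real.pi)⁻¹ * (Real.exp n * (ℓ * Q)) by positivity)
      have h6 : (2 * Real.pi)⁻¹ * (Real.exp n * (ℓ * Q)) *
          (S * Real.sqrt n * (n ^ n * Real.exp (-n))) =
          S * Real.sqrt n * ((2 * Real.pi)⁻¹ * (ℓ * Q)) * n ^ n := by
        rw [Real.exp_neg]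
        field_simp
      rw [h6] at h5
      exact le_of_mul_le_mul_right (h3.trans h5) hnn
    have h3 : (x n : ℂ) / n - U₀ = ((x n : ℂ) - n * U₀) / n := by field_simp
    rw [h3, norm_div, Complex.norm_natCast, div_le_iff₀ hn0]
    refine h2.trans (le_of_eq ?_)
    have h4 : (n : ℝ) = Real.sqrt n * Real.sqrt n := (Real.mul_self_sqrt hn0.le).symm
    have h5 : 0 < Real.sqrt n := Real.sqrt_pos.2 hn0
    calc _ = S * (2 * Real.pi)⁻¹ * Q * (ℓ / Real.sqrt n) * (Real.sqrt n * Real.sqrt n) := by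
          field_simp
      _ = _ := by rw [← h4]
  have hlim : Tendsto (fun n : ℕ => (1 + Real.log n) / Real.sqrt n) atTop (𝓝 0) := by
    have h1 : Tendsto (fun y : ℝ => (1 + Real.log y) / Real.sqrt y) atTop (𝓝 0) := by
      have h2 : Tendsto (fun y : ℝ => Real.log y / Real.sqrt y) atTop (𝓝 0) := by
        have := (isLittleO_log_rpow_atTop (show (0 : ℝ) < 1 / 2 by norm_num)).tendsto_div_nhds_zero
        simpa only [Real.sqrt_eq_rpow] using this
      have h3 : Tendsto (fun y : ℝ => 1 / Real.sqrt y) atTop (𝓝 0) := by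
        simp only [one_div]
        exact Real.tendsto_sqrt_atTop.inv_tendsto_atTop
      simpa [add_div] using h3.add h2
    exact h1.comp tendsto_natCast_atTop_atTop
  refine squeeze_zero_norm' ((eventually_ge_atTop 1).mono fun n hn => key n hn) ?_
  simpa using hlim.const_mul (S * (2 * Real.pi)⁻¹ * Q)

/-! ### Continuation of the Mellin transform -/

/-- The logarithmic power is o((1 + x)^(α' - α)). The small constant in the proof compensates 1 + x
≤ 2x. -/
lemma eventually_rpow_mul_log_rpow_le {α α' : ℝ} (β : ℝ) (h : α < α') :
    ∀ᶠ x : ℝ in atTop, x ^ α * Real.log (1 + x) ^ β ≤ x ^ α' := by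
  have h1 := ((isLittleO_log_rpow_rpow_atTop β (sub_pos.2 h)).comp_tendsto
    (tendsto_atTop_add_const_left atTop (1 : ℝ) tendsto_id)).bound
    (show (0 : ℝ) < (2 ^ (α' - α))⁻¹ by positivity)
  filter_upwards [h1, eventually_ge_atTop 1] with x hx h1x
  have hx0 : 0 < x := by linarith
  simp only [Function.comp_apply, id] at hx
  have h2 : (1 + x) ^ (α' - α) ≤ 2 ^ (α' - α) * x ^ (α' - α) := by
    rw [← Real.mul_rpow (by norm_num) hx0.le]
    exact Real.rpow_le_rpow (by linarith) (by linarith) (by linarith)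
  rw [Real.norm_of_nonneg (show (0 : ℝ) ≤ (1 + x) ^ (α' - α) by positivity)] at hx
  have h3 : Real.log (1 + x) ^ β ≤ x ^ (α' - α) := by
    refine (le_abs_self _).trans (hx.trans ?_)
    rw [inv_mul_le_iff₀ (by positivity)]
    exact h2
  calc x ^ α * Real.log (1 + x) ^ β ≤ x ^ α * x ^ (α' - α) := by gcongr
    _ = x ^ α' := by rw [← Real.rpow_add hx0]; ring_nf

/-- The restriction of `g` to the positive axis, with its linear part at infinity removed. -/
noncomputable def mellinRem (g : ℂ → ℂ) (c : ℝ) (x : ℝ) : ℂ :=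
  g x - Set.indicator (Set.Ioi 1) (fun y : ℝ => (c : ℂ) * y) x

/-- The growth conditions on the positive axis that give the strip of the Mellin transform. -/
structure AxisBounds (g : ℂ → ℂ) (c α β : ℝ) : Prop where
  differentiable : Differentiable ℂ g
  zero : ∃ C, ∀ z : ℂ, ‖z‖ ≤ 1 → ‖g z‖ ≤ C * ‖z‖ ^ 2
  infty : ∃ C R : ℝ, ∀ x : ℝ, R ≤ x → ‖g x - c * x‖ ≤ C * (x ^ α * Real.log (1 + x) ^ β)

section Mellin

variable {g : ℂ → ℂ} {c α β : ℝ}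

lemma AxisBounds.locallyIntegrableOn (h : AxisBounds g c α β) :
    LocallyIntegrableOn (mellinRem g c) (Set.Ioi 0) := by
  have h1 : LocallyIntegrable (fun x : ℝ => g x) :=
    (h.differentiable.continuous.comp Complex.continuous_ofReal).locallyIntegrable
  have h2 : LocallyIntegrable (fun x : ℝ => (c : ℂ) * x) :=
    Continuous.locallyIntegrable (by fun_prop)
  exact (h1.sub (h2.indicator measurableSet_Ioi)).locallyIntegrableOn _

lemma AxisBounds.isBigO_zero (h : AxisBounds g c α β) :
    mellinRem g c =O[𝓝[>] 0] fun x : ℝ => x ^ (-(-2 : ℝ)) := by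
  obtain ⟨C, hC⟩ := h.zero
  refine Asymptotics.IsBigO.of_bound C ?_
  filter_upwards [Ioo_mem_nhdsGT (show (0 : ℝ) < 1 by norm_num)] with x hx
  have h1 : mellinRem g c x = g x := by
    unfold mellinRem
    rw [Set.indicator_of_notMem (by simpa using hx.2.le), sub_zero]
  have h2 := hC (x : ℂ) (by simpa [abs_of_pos hx.1] using hx.2.le)
  rw [h1, neg_neg, Real.norm_of_nonneg (Real.rpow_nonneg hx.1.le _), Real.rpow_two]
  rwa [Complex.norm_real, Real.norm_of_nonneg hx.1.le] at h2

lemma AxisBounds.isBigO_infty (h : AxisBounds g c α β) {a : ℝ} (ha : a < -α) :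
    mellinRem g c =O[atTop] fun x : ℝ => x ^ (-a) := by
  obtain ⟨C, R, hC⟩ := h.infty
  refine Asymptotics.IsBigO.of_bound |C| ?_
  filter_upwards [eventually_gt_atTop 1, eventually_ge_atTop R,
    eventually_rpow_mul_log_rpow_le β (show α < -a by linarith)] with x hx hR hl
  have hx0 : 0 < x := by linarith
  have hlog : 0 < Real.log (1 + x) := Real.log_pos (by linarith)
  have h1 : mellinRem g c x = g x - c * x := by
    unfold mellinRem
    rw [Set.indicator_of_mem (by simpa using hx)]
  rw [h1, Real.norm_of_nonneg (Real.rpow_nonneg hx0.le _)]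
  refine (hC x hR).trans ?_
  have h2 : 0 ≤ x ^ α * Real.log (1 + x) ^ β := by positivity
  nlinarith [le_abs_self C, abs_nonneg C]

lemma AxisBounds.mellinConvergent_rem (h : AxisBounds g c α β) {s : ℂ} (h1 : -2 < s.re)
    (h2 : s.re < -α) : MellinConvergent (mellinRem g c) s := by
  obtain ⟨a, ha1, ha2⟩ := exists_between h2
  exact mellinConvergent_of_isBigO_rpow h.locallyIntegrableOn (h.isBigO_infty ha2) ha1
    h.isBigO_zero h1

lemma AxisBounds.differentiableAt_mellin_rem (h : AxisBounds g c α β) {s : ℂ} (h1 : -2 < s.re)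
    (h2 : s.re < -α) : DifferentiableAt ℂ (mellin (mellinRem g c)) s := by
  obtain ⟨a, ha1, ha2⟩ := exists_between h2
  exact mellin_differentiableAt_of_isBigO_rpow h.locallyIntegrableOn (h.isBigO_infty ha2) ha1
    h.isBigO_zero h1

/-- The part cut off at 1 has the explicit transform c ∫_1^∞ y^s dy, whose continuation carries the
pole at -1. -/
lemma hasMellin_linear (c : ℝ) {s : ℂ} (hs : s.re < -1) :
    HasMellin (Set.indicator (Set.Ioi 1) (fun y : ℝ => (c : ℂ) * y)) s (-c / (s + 1)) := by
  have e : ∀ t ∈ Set.Ioi (0 : ℝ), (t : ℂ) ^ (s - 1) •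
      Set.indicator (Set.Ioi 1) (fun y : ℝ => (c : ℂ) * y) t =
      Set.indicator (Set.Ioi 1) (fun y : ℝ => (c : ℂ) * (y : ℂ) ^ s) t := fun t ht => by
    have ht0 : (t : ℂ) ≠ 0 := by exact_mod_cast (ne_of_gt ht)
    by_cases h1 : t ∈ Set.Ioi (1 : ℝ)
    · rw [Set.indicator_of_mem h1, Set.indicator_of_mem h1, smul_eq_mul,
        Complex.cpow_sub _ _ ht0, Complex.cpow_one]
      field_simp
    · rw [Set.indicator_of_notMem h1, Set.indicator_of_notMem h1, smul_zero]
  have hsub : Set.Ioi (0 : ℝ) ∩ Set.Ioi 1 = Set.Ioi 1 :=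
    Set.inter_eq_right.2 (Set.Ioi_subset_Ioi zero_le_one)
  constructor
  · unfold MellinConvergent
    rw [integrableOn_congr_fun e measurableSet_Ioi]
    rw [IntegrableOn, integrable_indicator_iff measurableSet_Ioi, IntegrableOn,
      Measure.restrict_restrict measurableSet_Ioi, Set.inter_comm, hsub]
    exact (integrableOn_Ioi_cpow_of_lt hs one_pos).const_mul _
  · unfold mellin
    rw [setIntegral_congr_fun measurableSet_Ioi e, setIntegral_indicator measurableSet_Ioi, hsub,
      integral_const_mul, integral_Ioi_cpow_of_lt hs one_pos]
    simp
    ring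

/-- The meromorphic continuation of the Mellin transform. -/
theorem AxisBounds.exists_continuation (h : AxisBounds g c α β) (hα : α < 1) :
    ∃ G : ℂ → ℂ, IsMellinContinuation g (-2) (-1) (-α) G ∧
      (c = 0 → IsMellinContinuation g (-2) (-α) (-α) G) ∧
      (∀ s : ℂ, -2 < s.re → s.re < -α → (s ≠ -1 ∨ c = 0) →
        G s = mellin (mellinRem g c) s - c / (s + 1)) ∧
      Tendsto (fun s : ℂ => G s + (c : ℂ) / (s + 1)) (𝓝[≠] (-1))
        (𝓝 (mellin (mellinRem g c) (-1))) := by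
  set S : Set ℂ := {s : ℂ | -2 < s.re ∧ s.re < -α} with hS
  have hSo : IsOpen S := (isOpen_lt continuous_const Complex.continuous_re).inter
    (isOpen_lt Complex.continuous_re continuous_const)
  set M := mellin (mellinRem g c) with hM
  set G₀ : ℂ → ℂ := fun s => M s - c / (s + 1) with hG₀
  have hMan : AnalyticOnNhd ℂ M S := DifferentiableOn.analyticOnNhd (fun s hs =>
    (h.differentiableAt_mellin_rem hs.1 hs.2).differentiableWithinAt) hSo
  have han : ∀ s ∈ S, (s ≠ -1 ∨ c = 0) → AnalyticAt ℂ G₀ s := fun s hs hs1 => by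
    rcases hs1 with hs1 | hc
    · refine (hMan s hs).sub (analyticAt_const.div (analyticAt_id.add analyticAt_const) ?_)
      intro h0
      exact hs1 (eq_neg_of_add_eq_zero_left h0)
    -- For c = 0 the quotient is 0 even at s = -1, so no pole has to be avoided.
    · have : G₀ = M := by ext; simp [hG₀, hc]
      rw [this]; exact hMan s hs
  have hmer : MeromorphicOn G₀ S := fun s hs =>
    (hMan s hs).meromorphicAt.sub ((MeromorphicAt.const _ _).div
      ((MeromorphicAt.id _).add (MeromorphicAt.const _ _)))
  -- Passing to the normal form leaves G₀ unchanged wherever it is analytic, so only the value at a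
  -- pole at -1 can change.
  set G := toMeromorphicNFOn G₀ S with hG
  have hGeq : ∀ s ∈ S, (s ≠ -1 ∨ c = 0) → G s = G₀ s := fun s hs hs1 => by
    rw [hG, toMeromorphicNFOn_eq_toMeromorphicNFAt hmer hs,
      toMeromorphicNFAt_eq_self.2 (han s hs hs1).meromorphicNFAt]
  have hNF : MeromorphicNFOn G S := meromorphicNFOn_toMeromorphicNFOn G₀ S
  have hm1 : (-1 : ℂ) ∈ S := by
    constructor
    · simp
    · simp; linarith
  have hfun : ∀ t : ℝ, g t = mellinRem g c t +
      Set.indicator (Set.Ioi 1) (fun y : ℝ => (c : ℂ) * y) t := fun t => by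
    unfold mellinRem; ring
  refine ⟨G, ⟨fun s h1 h2 => ?_, hNF⟩, fun hc => ⟨fun s h1 h2 => ?_, hNF⟩,
    fun s h1 h2 h3 => hGeq s ⟨h1, h2⟩ h3, ?_⟩
  · have h3 : s.re < -α := by linarith
    have h4 : s ≠ -1 := fun h0 => by rw [h0] at h2; simp at h2
    have hl := hasMellin_linear c h2
    have hadd := hasMellin_add (h.mellinConvergent_rem h1 h3) hl.1
    rw [hl.2] at hadd
    simp_rw [hfun]
    refine ⟨hadd.1, ?_⟩
    rw [hadd.2, hGeq s ⟨h1, h3⟩ (Or.inl h4)]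
    simp only [hG₀, hM]
    ring
  · have hfun' : (fun t : ℝ => g t) = mellinRem g c := by
      ext t; rw [hfun t]; simp [hc, Set.indicator_apply]
    rw [hfun']
    refine ⟨h.mellinConvergent_rem h1 h2, ?_⟩
    rw [hGeq s ⟨h1, h2⟩ (Or.inr hc)]
    simp [hG₀, hM, hc]
  · have h5 : Tendsto M (𝓝[≠] (-1)) (𝓝 (M (-1))) :=
      ((hMan (-1) hm1).continuousAt.tendsto).mono_left nhdsWithin_le_nhds
    refine h5.congr' ?_
    filter_upwards [self_mem_nhdsWithin, nhdsWithin_le_nhds (hSo.mem_nhds hm1)] with s h6 h7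
    rw [hGeq s h7 (Or.inl h6)]
    simp [hG₀]

/-- The Mellin transform on the line `Re s = -1`, in logarithmic coordinates. -/
lemma AxisBounds.mellin_rem_eq {δ C₁ : ℝ} (h : AxisBounds g c α β) (hδ : 0 < δ)
    (hdec : ∀ t : ℝ, 0 ≤ t → ‖stripToll g c t‖ ≤ C₁ * Real.exp (-δ * t)) (ω : ℝ) :
    IntegrableOn (fun t : ℝ => stripToll g 0 t * Complex.exp (-(ω * Complex.I * t))) (Set.Iic 0) ∧
    IntegrableOn (fun t : ℝ => stripToll g c t * Complex.exp (-(ω * Complex.I * t))) (Set.Ioi 0) ∧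
    mellin (mellinRem g c) (-1 - ω * Complex.I) =
      (∫ t in Set.Iic 0, stripToll g 0 (t : ℝ) * Complex.exp (-(ω * Complex.I * t))) +
      ∫ t in Set.Ioi 0, stripToll g c (t : ℝ) * Complex.exp (-(ω * Complex.I * t)) := by
  have hcg := h.differentiable.continuous
  have hcs : ∀ c', Continuous fun t : ℝ =>
      stripToll g c' t * Complex.exp (-(ω * Complex.I * t)) := fun c' => by
    have := (continuous_stripToll hcg c').comp Complex.continuous_ofReal
    exact this.mul (by fun_prop)
  have hne : ∀ t : ℝ, ‖Complex.exp (-(ω * Complex.I * t))‖ = 1 := fun t => by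
    rw [show -(ω * Complex.I * t) = ((-(ω * t) : ℝ) : ℂ) * Complex.I by push_cast; ring,
      Complex.norm_exp_ofReal_mul_I]
  obtain ⟨C, hC⟩ := h.zero
  have i1 : IntegrableOn (fun t : ℝ => stripToll g 0 t * Complex.exp (-(ω * Complex.I * t)))
      (Set.Iic 0) := by
    refine Integrable.mono' ((integrableOn_exp_Iic 0).const_mul C)
      (hcs 0).aestronglyMeasurable ?_
    refine (ae_restrict_iff' measurableSet_Iic).2 (ae_of_all _ fun t ht => ?_)
    have ht0 : t ≤ 0 := ht
    have e1 : ‖Complex.exp (t : ℂ)‖ = Real.exp t := by rw [Complex.norm_exp]; simp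
    have e2 := hC (Complex.exp t) (by rw [e1]; exact Real.exp_le_one_iff.2 ht0)
    rw [norm_mul, hne, mul_one]
    unfold stripToll
    rw [Complex.ofReal_zero, sub_zero, norm_mul, Complex.norm_exp (-(t : ℂ))]
    rw [e1] at e2
    calc _ ≤ C * Real.exp t ^ 2 * Real.exp (-(t : ℂ)).re := by gcongr
      _ = C * Real.exp t := by
        rw [sq]; simp only [Complex.neg_re, Complex.ofReal_re, Real.exp_neg]; field_simp
  have i2 : IntegrableOn (fun t : ℝ => stripToll g c t * Complex.exp (-(ω * Complex.I * t)))
      (Set.Ioi 0) := by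
    refine Integrable.mono' ((integrableOn_exp_mul_Ioi (neg_lt_zero.2 hδ) 0).const_mul C₁)
      (hcs c).aestronglyMeasurable ?_
    refine (ae_restrict_iff' measurableSet_Ioi).2 (ae_of_all _ fun t ht => ?_)
    rw [norm_mul, hne, mul_one]
    exact hdec t (le_of_lt ht)
  refine ⟨i1, i2, ?_⟩
  -- For t ≤ 0 the linear part is cut off, since exp t ≤ 1. This is why the two half-lines carry the
  -- tolls with slopes 0 and c. The substitution x = exp t then turns the Mellin integral into a
  -- Fourier integral.
  set Φ : ℝ → ℂ := fun t => mellinRem g c (Real.exp t) * Complex.exp (-t) *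
    Complex.exp (-(ω * Complex.I * t)) with hΦ
  have hΦ1 : ∀ t ∈ Set.Iic (0 : ℝ),
      stripToll g 0 (t : ℝ) * Complex.exp (-(ω * Complex.I * t)) = Φ t := fun t ht => by
    have : Real.exp t ∉ Set.Ioi (1 : ℝ) := by
      simpa using Real.exp_le_one_iff.2 (show t ≤ 0 from ht)
    simp only [hΦ, stripToll, mellinRem, Set.indicator_of_notMem this]
    push_cast; ring
  have hΦ2 : ∀ t ∈ Set.Ioi (0 : ℝ),
      stripToll g c (t : ℝ) * Complex.exp (-(ω * Complex.I * t)) = Φ t := fun t ht => by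
    have : Real.exp t ∈ Set.Ioi (1 : ℝ) := by
      simpa using (show 0 < t from ht)
    simp only [hΦ, stripToll, mellinRem, Set.indicator_of_mem this]
    have e : Complex.exp (t : ℂ) * Complex.exp (-t) = 1 := by rw [← Complex.exp_add]; simp
    push_cast
    linear_combination (c * Complex.exp (-(ω * Complex.I * t))) * e
  rw [setIntegral_congr_fun measurableSet_Iic hΦ1, setIntegral_congr_fun measurableSet_Ioi hΦ2]
  rw [integrableOn_congr_fun hΦ1 measurableSet_Iic] at i1
  rw [integrableOn_congr_fun hΦ2 measurableSet_Ioi] at i2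
  rw [intervalIntegral.integral_Iic_add_Ioi i1 i2]
  have himg : Real.exp '' Set.univ = Set.Ioi 0 := by rw [Set.image_univ, Real.range_exp]
  unfold mellin
  rw [← himg, integral_image_eq_integral_abs_deriv_smul MeasurableSet.univ
    (fun x _ => (Real.hasDerivAt_exp x).hasDerivWithinAt) Real.exp_injective.injOn,
    Measure.restrict_univ]
  refine integral_congr_ae (ae_of_all _ fun t => ?_)
  simp only [hΦ]
  have e0 : ((Real.exp t : ℝ) : ℂ) ≠ 0 := by exact_mod_cast (Real.exp_pos t).ne'
  rw [abs_of_pos (Real.exp_pos t), Complex.cpow_def_of_ne_zero e0, ← Complex.ofReal_log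
    (Real.exp_pos t).le, Real.log_exp, Complex.real_smul, smul_eq_mul, Complex.ofReal_exp]
  have e1 : Complex.exp t * Complex.exp (t * (-1 - ω * Complex.I - 1)) =
      Complex.exp (-t) * Complex.exp (-(ω * Complex.I * t)) := by
    rw [← Complex.exp_add, ← Complex.exp_add]; congr 1; ring
  linear_combination (mellinRem g c (Real.exp t)) * e1

end Mellin

/-! ### Limits of the window sums -/

/-- The weighted sum of the integrals of `φ` over the windows `[t - a, t]` and `[t - b, t]`. -/
noncomputable def windowSum (p a b : ℝ) (φ : ℝ → ℂ) (t : ℝ) : ℂ :=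
  (p : ℂ) * (∫ s in (t - a)..t, φ s) + (1 - p) * ∫ s in (t - b)..t, φ s

lemma windowSum_sub {φ : ℝ → ℂ} (hφ : Continuous φ) (p a b T t : ℝ) :
    windowSum p a b φ t - windowSum p a b φ T =
      ∫ s in T..t, (φ s - p * φ (s - a) - (1 - p) * φ (s - b)) := by
  have := window_integral_sub hφ p a b T t
  simp only [Complex.real_smul, Complex.ofReal_sub, Complex.ofReal_one] at this
  unfold windowSum
  exact this

lemma windowSum_add_smul {φ ψ : ℝ → ℂ} (hφ : Continuous φ) (hψ : Continuous ψ) (p a b : ℝ) (κ : ℂ)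
    (t : ℝ) : windowSum p a b (fun s => φ s + κ * ψ s) t =
      windowSum p a b φ t + κ * windowSum p a b ψ t := by
  unfold windowSum
  have h : ∀ u v : ℝ, ∫ s in u..v, (φ s + κ * ψ s) = (∫ s in u..v, φ s) + κ * ∫ s in u..v, ψ s :=
    fun u v => by
      rw [intervalIntegral.integral_add (hφ.intervalIntegrable _ _)
        (Continuous.intervalIntegrable (by fun_prop) _ _), intervalIntegral.integral_const_mul]
  rw [h, h]; ring

lemma tendsto_windowSum_atBot {φ : ℝ → ℂ} {C : ℝ} (hφ : ∀ s ≤ 0, ‖φ s‖ ≤ C * Real.exp s)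
    {p a b : ℝ} (ha : 0 ≤ a) (hb : 0 ≤ b) :
    Tendsto (windowSum p a b φ) atBot (𝓝 0) := by
  have hC : 0 ≤ C := by simpa using (norm_nonneg _).trans (hφ 0 le_rfl)
  have h : ∀ d : ℝ, 0 ≤ d → Tendsto (fun t : ℝ => ∫ s in (t - d)..t, φ s) atBot (𝓝 0) :=
    fun d hd => by
      have h2 : Tendsto (fun t => C * Real.exp t * d) atBot (𝓝 0) := by
        simpa using (Real.tendsto_exp_atBot.const_mul C).mul_const d
      refine squeeze_zero_norm' ?_ h2
      filter_upwards [eventually_le_atBot 0] with t ht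
      have := intervalIntegral.norm_integral_le_of_norm_le_const (a := t - d) (b := t) (f := φ)
        (C := C * Real.exp t) (fun s hs => by
          rw [Set.uIoc_of_le (by linarith)] at hs
          exact (hφ s (hs.2.trans ht)).trans (by gcongr; exact hs.2))
      rwa [show t - (t - d) = d by ring, abs_of_nonneg hd] at this
  unfold windowSum
  simpa using ((h a ha).const_mul (p : ℂ)).add ((h b hb).const_mul (1 - p : ℂ))

lemma norm_exp_neg_mul_I (ω t : ℝ) : ‖Complex.exp (-(ω * Complex.I * t))‖ = 1 := by
  rw [show -(ω * Complex.I * t) = ((-(ω * t) : ℝ) : ℂ) * Complex.I by push_cast; ring,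
    Complex.norm_exp_ofReal_mul_I]

/-- Frequencies having both jumps as periods are those for which the twisted function still solves
the renewal equation. -/
lemma exp_neg_mul_I_sub {ω d : ℝ} (h : Complex.exp (ω * Complex.I * d) = 1) (t : ℝ) :
    Complex.exp (-(ω * Complex.I * (t - d : ℝ))) = Complex.exp (-(ω * Complex.I * t)) := by
  rw [show -(ω * Complex.I * (t - d : ℝ)) = -(ω * Complex.I * t) + ω * Complex.I * d by
    push_cast; ring, Complex.exp_add, h, mul_one]

lemma stripFun_zero_le {A : ℂ → ℂ} {C : ℝ} (hA : ∀ z, ‖z‖ ≤ 1 → ‖A z‖ ≤ C * ‖z‖ ^ 2)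
    {t : ℝ} (ht : t ≤ 0) : ‖stripFun A 0 t‖ ≤ Real.exp 1 * C * Real.exp t := by
  have e1 : ‖Complex.exp (t : ℂ)‖ = Real.exp t := by rw [Complex.norm_exp]; simp
  have h1 : Real.exp t ≤ 1 := Real.exp_le_one_iff.2 ht
  have e2 := hA (Complex.exp t) (by rwa [e1])
  have e3 : ‖Complex.exp (-Complex.exp (t : ℂ))‖ ≤ Real.exp 1 := by
    refine (Complex.norm_exp_le_exp_norm _).trans ?_
    rw [norm_neg, e1]
    exact Real.exp_le_exp.2 h1
  unfold stripFun
  rw [Complex.ofReal_zero, zero_mul, sub_zero, norm_mul, norm_mul, Complex.norm_exp (-(t : ℂ))]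
  rw [e1] at e2
  calc _ ≤ Real.exp 1 * (C * Real.exp t ^ 2) * Real.exp (-(t : ℂ)).re := by gcongr
    _ = _ := by
      rw [sq]; simp only [Complex.neg_re, Complex.ofReal_re, Real.exp_neg]; field_simp

/-- The limit of the exponentially weighted window sums of the normalised generating function. -/
theorem tendsto_windowSum_stripFun {p c α β δ C₁ : ℝ} (hp : p ∈ Set.Ioo (0 : ℝ) 1) {A g : ℂ → ℂ}
    (hA : Differentiable ℂ A)
    (hfun : ∀ z, A z = A (p * z) * Complex.exp ((1 - p) * z) +
      A ((1 - p) * z) * Complex.exp (p * z) + Complex.exp z * g z)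
    (hA0 : ∃ C, 0 ≤ C ∧ ∀ z, ‖z‖ ≤ 1 → ‖A z‖ ≤ C * ‖z‖ ^ 2)
    (h : AxisBounds g c α β) (hδ : 0 < δ)
    (hdec : ∀ t : ℝ, 0 ≤ t → ‖stripToll g c t‖ ≤ C₁ * Real.exp (-δ * t)) {ω : ℝ}
    (ha : Complex.exp (ω * Complex.I * (-Real.log p : ℝ)) = 1)
    (hb : Complex.exp (ω * Complex.I * (-Real.log (1 - p) : ℝ)) = 1) :
    Tendsto (windowSum p (-Real.log p) (-Real.log (1 - p))
        (fun s => stripFun A (c / entropy p) s * Complex.exp (-(ω * Complex.I * s)))) atTop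
      (𝓝 (mellin (mellinRem g c) (-1 - ω * Complex.I) - (c / entropy p : ℝ) *
        windowSum p (-Real.log p) (-Real.log (1 - p))
          (fun s => s * Complex.exp (-(ω * Complex.I * s))) 0)) := by
  obtain ⟨C, hC, hAC⟩ := hA0
  have ha0 : 0 ≤ -Real.log p := by linarith [Real.log_neg hp.1 hp.2]
  have hb0 : 0 ≤ -Real.log (1 - p) := by
    linarith [Real.log_neg (sub_pos.2 hp.2) (show 1 - p < 1 by linarith [hp.1])]
  have hcont : ∀ κ : ℝ, Continuous fun s : ℝ =>
      stripFun A κ s * Complex.exp (-(ω * Complex.I * s)) := fun κ =>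
    ((differentiable_stripFun hA κ).continuous.comp Complex.continuous_ofReal).mul (by fun_prop)
  have hwin : ∀ c' T t : ℝ,
      windowSum p (-Real.log p) (-Real.log (1 - p))
        (fun s => stripFun A (c' / entropy p) s * Complex.exp (-(ω * Complex.I * s))) t -
      windowSum p (-Real.log p) (-Real.log (1 - p))
        (fun s => stripFun A (c' / entropy p) s * Complex.exp (-(ω * Complex.I * s))) T =
      ∫ s in T..t, stripToll g c' (s : ℝ) * Complex.exp (-(ω * Complex.I * s)) := fun c' T t => by
    rw [windowSum_sub (hcont _)]
    refine intervalIntegral.integral_congr fun s _ => ?_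
    have e := stripFun_eq (c := c') hp hfun s
    simp only [exp_neg_mul_I_sub ha, exp_neg_mul_I_sub hb]
    rw [Complex.ofReal_sub, Complex.ofReal_sub]
    linear_combination Complex.exp (-(ω * Complex.I * s)) * e
  obtain ⟨i1, i2, i3⟩ := h.mellin_rem_eq hδ hdec ω
  set J := windowSum p (-Real.log p) (-Real.log (1 - p)) with hJ
  -- The window sum tends to 0 at -∞ only for slope 0, since the linear term of the normalised
  -- function does not decay there. So slope 0 is used up to time 0 and slope c / h afterwards.
  have hneg : J (fun s => stripFun A 0 s * Complex.exp (-(ω * Complex.I * s))) 0 =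
      ∫ t in Set.Iic 0, stripToll g 0 (t : ℝ) * Complex.exp (-(ω * Complex.I * t)) := by
    have l1 := intervalIntegral_tendsto_integral_Iic 0 i1 tendsto_id
    have l2 : Tendsto (J fun s => stripFun A 0 s * Complex.exp (-(ω * Complex.I * s)))
        atBot (𝓝 0) := tendsto_windowSum_atBot (C := Real.exp 1 * C) (fun s hs => by
          rw [norm_mul, norm_exp_neg_mul_I, mul_one]
          exact stripFun_zero_le hAC hs) ha0 hb0
    have l3 := l2.const_sub (J (fun s => stripFun A 0 s * Complex.exp (-(ω * Complex.I * s))) 0)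
    rw [sub_zero] at l3
    refine tendsto_nhds_unique l3 (l1.congr fun T => ?_)
    have := hwin 0 T 0
    rw [zero_div] at this
    exact this.symm
  have hsplit : J (fun s => stripFun A 0 s * Complex.exp (-(ω * Complex.I * s))) 0 =
      J (fun s => stripFun A (c / entropy p) s * Complex.exp (-(ω * Complex.I * s))) 0 +
      (c / entropy p : ℝ) * J (fun s => s * Complex.exp (-(ω * Complex.I * s))) 0 := by
    rw [hJ, ← windowSum_add_smul (hcont _) (by fun_prop)]
    congr 1
    ext s
    unfold stripFun
    push_cast; ring
  have l4 := (intervalIntegral_tendsto_integral_Ioi 0 i2 tendsto_id).const_add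
    (J (fun s => stripFun A (c / entropy p) s * Complex.exp (-(ω * Complex.I * s))) 0)
  have e : mellin (mellinRem g c) (-1 - ω * Complex.I) - (c / entropy p : ℝ) *
        J (fun s => s * Complex.exp (-(ω * Complex.I * s))) 0 =
      J (fun s => stripFun A (c / entropy p) s * Complex.exp (-(ω * Complex.I * s))) 0 +
      ∫ t in Set.Ioi 0, stripToll g c (t : ℝ) * Complex.exp (-(ω * Complex.I * t)) := by
    rw [i3, ← hneg, hsplit]; ring
  rw [e]
  refine l4.congr fun t => ?_
  rw [id, ← hwin c 0 t]; ring

lemma integral_mul_exp_neg_mul_I {ω d : ℝ} (hω : ω ≠ 0)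
    (h : Complex.exp (ω * Complex.I * d) = 1) :
    ∫ s in (0 - d)..0, (s : ℂ) * Complex.exp (-(ω * Complex.I * s)) = -(d / (ω * Complex.I)) := by
  have hc : (-(ω * Complex.I) : ℂ) ≠ 0 :=
    neg_ne_zero.2 (mul_ne_zero (by exact_mod_cast hω) Complex.I_ne_zero)
  set k : ℂ := -(ω * Complex.I) with hk
  have hd : ∀ s : ℝ, HasDerivAt (fun s : ℝ => ((s : ℂ) / k - 1 / k ^ 2) * Complex.exp (k * s))
      ((s : ℂ) * Complex.exp (k * s)) s := fun s => by
    have h1 : HasDerivAt (fun s : ℝ => (s : ℂ)) 1 s := Complex.ofRealCLM.hasDerivAt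
    have h2 := ((h1.div_const k).sub_const (1 / k ^ 2)).mul (h1.const_mul k).cexp
    refine h2.congr_deriv ?_
    field_simp
    ring
  have hexp : ∀ s : ℝ, -(ω * Complex.I * s) = k * s := fun s => by rw [hk]; ring
  simp_rw [hexp]
  rw [intervalIntegral.integral_eq_sub_of_hasDerivAt (fun s _ => hd s)
    (Continuous.intervalIntegrable (by fun_prop) _ _)]
  have e1 : Complex.exp (k * ((0 - d : ℝ) : ℂ)) = 1 := by
    rw [← h, hk]; congr 1; push_cast; ring
  rw [e1, show (ω * Complex.I : ℂ) = -k by rw [hk]; ring]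
  simp
  ring

/-- The correction for the linear term is exactly the polar part c / (s + 1) at s = -1 - iω.
Subtracting it turns the transform of the remainder into the continued transform. -/
lemma windowSum_id_of_ne_zero {p c ω : ℝ} (hp : p ∈ Set.Ioo (0 : ℝ) 1) (hω : ω ≠ 0)
    (ha : Complex.exp (ω * Complex.I * (-Real.log p : ℝ)) = 1)
    (hb : Complex.exp (ω * Complex.I * (-Real.log (1 - p) : ℝ)) = 1) :
    (c / entropy p : ℝ) * windowSum p (-Real.log p) (-Real.log (1 - p))
      (fun s => s * Complex.exp (-(ω * Complex.I * s))) 0 = c / (-1 - ω * Complex.I + 1) := by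
  unfold windowSum
  rw [integral_mul_exp_neg_mul_I hω ha, integral_mul_exp_neg_mul_I hω hb]
  have h1 : (entropy p : ℂ) ≠ 0 := by exact_mod_cast (entropy_pos hp).ne'
  have h2 : (entropy p : ℂ) = p * (-Real.log p : ℝ) + (1 - p) * (-Real.log (1 - p) : ℝ) := by
    unfold entropy; push_cast; ring
  have h3 : (ω : ℂ) ≠ 0 := by exact_mod_cast hω
  have h4 : (ω * Complex.I : ℂ) ≠ 0 := mul_ne_zero h3 Complex.I_ne_zero
  rw [show (-1 - ω * Complex.I + 1 : ℂ) = -(ω * Complex.I) by ring]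
  rw [show ∀ x y : ℂ, (p : ℂ) * -(x / (ω * Complex.I)) + (1 - p) * -(y / (ω * Complex.I)) =
    -((p * x + (1 - p) * y) / (ω * Complex.I)) from fun x y => by ring, ← h2]
  push_cast
  field_simp

/-- At frequency 0 the correction is minus half the second moment of the jump, the source of the
extra constant in `h0`. -/
lemma windowSum_id_zero (p : ℝ) (a b : ℝ) :
    windowSum p a b (fun s => s * Complex.exp (-((0 : ℝ) * Complex.I * s))) 0 =
      ((-(p * a ^ 2 + (1 - p) * b ^ 2) / 2 : ℝ) : ℂ) := by
  have h : ∀ d : ℝ, ∫ s in (0 - d)..0, (s : ℂ) * Complex.exp (-((0 : ℝ) * Complex.I * s)) =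
      ((-d ^ 2 / 2 : ℝ) : ℂ) := fun d => by
    simp only [Complex.ofReal_zero, zero_mul, neg_zero, Complex.exp_zero, mul_one]
    rw [intervalIntegral.integral_ofReal, integral_id]
    congr 1; ring
  unfold windowSum
  rw [h, h]; push_cast; ring

/-! ### From admissibility to the renewal equation -/

lemma JSAdmissibleWith.linearInSector {α β : ℝ} {g : ℂ → ℂ} (h : JSAdmissibleWith α β g) :
    ∃ θ ∈ Set.Ioo (0 : ℝ) (Real.pi / 2), LinearInSector θ 0 α β g := by
  obtain ⟨-, θ, h1, h2, ⟨C, hC⟩, -⟩ := h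
  exact ⟨θ, ⟨h1, h2⟩, C, 1, fun z hz ha => by simpa using hC z hz ha⟩

/-- Logarithmic factors, and the restriction to large `|z|`, are absorbed in the exponent. -/
lemma LinearInSector.exists_rpow_bound {θ c α β : ℝ} {g : ℂ → ℂ} (h : LinearInSector θ c α β g)
    (hg : Continuous g) (hα : α < 1) : ∃ δ : ℝ, 0 < δ ∧ ∃ C : ℝ, 0 ≤ C ∧
      ∀ z : ℂ, 1 ≤ ‖z‖ → |z.arg| ≤ θ → ‖g z - c * z‖ ≤ C * ‖z‖ ^ (1 - δ) := by
  obtain ⟨C, R, hC⟩ := h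
  -- With α' ≥ 0 the power is at least 1 for |z| ≥ 1, so a constant can absorb the compact part.
  obtain ⟨α', h1, h2⟩ := exists_between (max_lt hα one_pos)
  have hα0 : 0 ≤ α' := (le_max_right _ _).trans h1.le
  obtain ⟨R', hR'⟩ := eventually_atTop.1
    (eventually_rpow_mul_log_rpow_le β ((le_max_left α 0).trans_lt h1))
  obtain ⟨D, hD⟩ := (isCompact_closedBall (0 : ℂ) (max R R')).exists_bound_of_continuousOn
    (f := fun z => g z - c * z) (by fun_prop)
  refine ⟨1 - α', by linarith, |C| + |D|, by positivity, fun z hz ha => ?_⟩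
  rw [sub_sub_cancel]
  have hp : 0 ≤ ‖z‖ ^ α' := by positivity
  by_cases hb : ‖z‖ ≤ max R R'
  · have h3 := hD z (by simpa using hb)
    have h4 := Real.one_le_rpow hz hα0
    nlinarith [le_abs_self D, abs_nonneg D, abs_nonneg C]
  · rw [not_le, max_lt_iff] at hb
    have h3 := hC z hb.1.le ha
    have h4 := hR' _ hb.2.le
    have hlog : 0 < Real.log (1 + ‖z‖) := Real.log_pos (by linarith)
    have h5 : 0 ≤ ‖z‖ ^ α * Real.log (1 + ‖z‖) ^ β := by positivity
    nlinarith [le_abs_self C, abs_nonneg D, abs_nonneg C]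

/-- The angle in the growth condition `(O)` may be taken as small as one likes. -/
lemma JSAdmissible.exists_outer_bound {g : ℂ → ℂ} (h : JSAdmissible g) {φ : ℝ} (hφ0 : 0 < φ)
    (hφ : φ ≤ Real.pi) : ∃ ε : ℝ, 0 < ε ∧ ∃ C : ℝ, 0 ≤ C ∧ ∀ z : ℂ, 1 ≤ ‖z‖ → φ ≤ |z.arg| →
      ‖Complex.exp z * g z‖ ≤ C * Real.exp ((1 - ε) * ‖z‖) := by
  obtain ⟨α, β, hd, θ, -, -, ⟨C₁, h1⟩, ε₁, hε₁, C₂, h2⟩ := h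
  have hcos : Real.cos φ < 1 := by
    rw [← Real.cos_zero]
    exact Real.cos_lt_cos_of_nonneg_of_le_pi le_rfl hφ hφ0
  have hcos' := Real.neg_one_le_cos φ
  -- Between the two angles Re z ≤ (1 - 2η)|z|, and the polynomial growth of g costs only exp(η|z|).
  set η := (1 - Real.cos φ) / 2 with hη
  have hη0 : 0 < η := by linarith
  have hη1 : η ≤ 1 := by linarith
  have hlim : ∀ᶠ x : ℝ in atTop, x ^ α * Real.log (1 + x) ^ β ≤ Real.exp (η * x) := by
    filter_upwards [eventually_rpow_mul_log_rpow_le β (show α < α + 1 by linarith),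
      (isLittleO_rpow_exp_pos_mul_atTop (α + 1) hη0).bound one_pos] with x hx hx'
    rw [one_mul, Real.norm_of_nonneg (Real.exp_pos _).le] at hx'
    exact hx.trans ((le_abs_self _).trans hx')
  obtain ⟨R, hR⟩ := eventually_atTop.1 hlim
  obtain ⟨D, hD⟩ := (isCompact_closedBall (0 : ℂ) R).exists_bound_of_continuousOn
    (f := fun z => Complex.exp z * g z) ((Complex.continuous_exp.mul hd.continuous).continuousOn)
  refine ⟨min ε₁ η, lt_min hε₁ hη0, |C₁| + |C₂| + |D|, by positivity, fun z hz ha => ?_⟩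
  have e1 : Real.exp ((1 - ε₁) * ‖z‖) ≤ Real.exp ((1 - min ε₁ η) * ‖z‖) := by
    gcongr; exact min_le_left _ _
  have e2 : Real.exp ((1 - η) * ‖z‖) ≤ Real.exp ((1 - min ε₁ η) * ‖z‖) := by
    gcongr; exact min_le_right _ _
  have e3 : 1 ≤ Real.exp ((1 - η) * ‖z‖) := Real.one_le_exp (by nlinarith)
  have k1 := abs_nonneg C₁
  have k2 := abs_nonneg C₂
  have k3 := abs_nonneg D
  by_cases hb : θ ≤ |z.arg|
  · have := h2 z hz hb
    nlinarith [le_abs_self C₂, Real.exp_pos ((1 - ε₁) * ‖z‖)]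
  by_cases hr : ‖z‖ ≤ R
  · have := hD z (by simpa using hr)
    nlinarith [le_abs_self D]
  have h3 := h1 z hz (not_le.1 hb).le
  have h4 := hR _ (not_le.1 hr).le
  have hre : z.re ≤ ‖z‖ * Real.cos φ := by
    rw [← Complex.norm_mul_cos_arg z, ← Real.cos_abs]
    exact mul_le_mul_of_nonneg_left (Real.cos_le_cos_of_nonneg_of_le_pi hφ0.le
      (Complex.abs_arg_le_pi z) ha) (norm_nonneg z)
  have hlog : 0 < Real.log (1 + ‖z‖) := Real.log_pos (by linarith)
  have h5 : ‖g z‖ ≤ |C₁| * Real.exp (η * ‖z‖) := by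
    refine h3.trans ((mul_le_mul_of_nonneg_right (le_abs_self C₁) ?_).trans ?_)
    · positivity
    · gcongr
  rw [norm_mul, Complex.norm_exp]
  calc _ ≤ Real.exp (‖z‖ * Real.cos φ) * (|C₁| * Real.exp (η * ‖z‖)) := by gcongr
    _ = |C₁| * Real.exp ((1 - η) * ‖z‖) := by
      rw [mul_left_comm, ← Real.exp_add]; congr 2; rw [hη]; ring
    _ ≤ _ := by nlinarith

lemma LinearInSector.axisBounds {θ c α β : ℝ} {g : ℂ → ℂ} {t : ℕ → ℝ} (hθ : 0 ≤ θ)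
    (h : LinearInSector θ c α β g) (hd : Differentiable ℂ g) (hg : IsPoissonGF t g)
    (ht0 : t 0 = 0) (ht1 : t 1 = 0) : AxisBounds g c α β := by
  refine ⟨hd, ?_, ?_⟩
  · obtain ⟨C, hC, h1⟩ := hg.norm_le_sq ht0 ht1
    refine ⟨Real.exp 1 * C, fun z hz => ?_⟩
    have h2 : g z = Complex.exp (-z) * (Complex.exp z * g z) := by
      rw [← mul_assoc, ← Complex.exp_add]; simp
    have h3 : ‖Complex.exp (-z)‖ ≤ Real.exp 1 := by
      refine (Complex.norm_exp_le_exp_norm _).trans (Real.exp_le_exp.2 ?_)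
      rwa [norm_neg]
    rw [h2, norm_mul, mul_assoc]
    exact mul_le_mul h3 (h1 z hz) (norm_nonneg _) (Real.exp_pos 1).le
  · obtain ⟨C, R, h1⟩ := h
    refine ⟨C, max R 0, fun x hx => ?_⟩
    have hx0 : 0 ≤ x := (le_max_right _ _).trans hx
    have hn : ‖(x : ℂ)‖ = x := by rw [Complex.norm_real, Real.norm_of_nonneg hx0]
    have := h1 x (by rw [hn]; exact (le_max_left _ _).trans hx)
      (by rw [Complex.arg_ofReal_of_nonneg hx0, abs_zero]; exact hθ)
    rwa [hn] at this

/-- The means are, up to `o (n)`, given by the solution of a renewal equation whose weighted window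
sums converge to values of a Mellin transform. -/
theorem exists_renewalEq {p θ c α β : ℝ} (hp : p ∈ Set.Ioo (0 : ℝ) 1) {x t : ℕ → ℝ}
    (hx0 : x 0 = 0) (hx1 : x 1 = 0) (ht0 : t 0 = 0) (ht1 : t 1 = 0)
    (hrec : ∀ n, x n = ∑ k ∈ Finset.range (n + 1), binWeight p n k * (x k + x (n - k)) + t n)
    {g : ℂ → ℂ} (hg : IsPoissonGF t g) (hθ : θ ∈ Set.Ioo (0 : ℝ) (Real.pi / 2)) (hα : α < 1)
    (hjs : JSAdmissible g) (hlin : LinearInSector θ c α β g) :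
    ∃ (B K L C δ : ℝ) (U W : ℝ → ℂ),
      RenewalEq p (-Real.log p) (-Real.log (1 - p)) B K L C δ U W ∧
      (∀ ω : ℝ, Complex.exp (ω * Complex.I * (-Real.log p : ℝ)) = 1 →
        Complex.exp (ω * Complex.I * (-Real.log (1 - p) : ℝ)) = 1 →
        Tendsto (windowSum p (-Real.log p) (-Real.log (1 - p))
          (fun s => U s * Complex.exp (-(ω * Complex.I * s)))) atTop
        (𝓝 (mellin (mellinRem g c) (-1 - ω * Complex.I) - (c / entropy p : ℝ) *
          windowSum p (-Real.log p) (-Real.log (1 - p))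
            (fun s => s * Complex.exp (-(ω * Complex.I * s))) 0))) ∧
      Tendsto (fun n : ℕ => (x n : ℂ) / n - (U (Real.log n) + (c / entropy p : ℝ) * Real.log n))
        atTop (𝓝 0) := by
  have hq : 0 < 1 - p := sub_pos.2 hp.2
  have ha : 0 < -Real.log p := by linarith [Real.log_neg hp.1 hp.2]
  have hb : 0 < -Real.log (1 - p) := by linarith [Real.log_neg hq (by linarith [hp.1])]
  have hd : Differentiable ℂ g := by
    obtain ⟨_, _, hd, -⟩ := hjs
    exact hd
  have hπ := Real.pi_pos
  have hax := hlin.axisBounds hθ.1.le hd hg ht0 ht1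
  obtain ⟨δ, hδ, C, hC, hsec⟩ := hlin.exists_rpow_bound hd.continuous hα
  -- The Lipschitz bound holds only in the strip of half width θ/2, so the outer estimate must start
  -- at the angle θ/2.
  obtain ⟨ε, hε, C₂, hC₂, hout⟩ := hjs.exists_outer_bound (half_pos hθ.1) (by linarith [hθ.2])
  obtain ⟨A, hA, hsum, hfun, hA0⟩ := exists_egf hp hx0 hx1 hrec hg
  obtain ⟨K, L, hK, hL⟩ := exists_strip_bounds hp hA hfun hθ.1 (by linarith [hθ.2]) hC hδ hsec
    (le_max_left (-Real.log p) (-Real.log (1 - p))) (le_max_right _ _)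
  obtain ⟨ε', hε', C', hC', hAout⟩ := TrieMean.exists_outer_bound hp hA.continuous hfun
    (half_pos hθ.1) (by linarith [hθ.2]) hε hout
  have hB : 0 < max (-Real.log p) (-Real.log (1 - p)) := ha.trans_le (le_max_left _ _)
  have hdec : ∀ t : ℝ, 0 ≤ t → ‖stripToll g c t‖ ≤ C * Real.exp (-δ * t) := fun t ht => by
    simpa using norm_stripToll_le (t := t) (by linarith [hθ.2]) hsec (by simpa using ht)
      (by simpa using hθ.1.le)
  refine ⟨max (-Real.log p) (-Real.log (1 - p)), K, L, C, δ,
    fun t => stripFun A (c / entropy p) t, fun t => stripToll g c t, ?_, fun ω h1 h2 =>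
      tendsto_windowSum_stripFun hp hA hfun hA0 hax hδ hdec h1 h2, ?_⟩
  · refine ⟨hp, ha, hb, le_max_left _ _, le_max_right _ _, hδ,
      (differentiable_stripFun hA _).continuous.comp Complex.continuous_ofReal,
      (continuous_stripToll hd.continuous c).comp Complex.continuous_ofReal, fun t => ?_,
      fun t ht => hK t (by simpa using ht) (by simpa using hθ.1.le), fun s t hs ht => ?_, hdec⟩
    · simpa using stripFun_eq (c := c) hp hfun t
    · have := hL s t (by simpa using hs) (by simpa using (half_pos hθ.1).le) (by simpa using ht)
        (by simpa using (half_pos hθ.1).le)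
      rwa [← Complex.ofReal_sub, Complex.norm_real] at this
  · exact depoissonization hA.continuous hsum (half_pos hθ.1) (by linarith [hθ.2]) hε' hC'
      (fun t ht hti => hK t (by linarith) (by linarith [hθ.1]))
      (fun s t hs hsi ht hti => hL s t (by linarith) hsi (by linarith) hti) hAout

/-! ### Identification of the limit -/

lemma exists_lattice {p : ℝ} (hp : p ∈ Set.Ioo (0 : ℝ) 1)
    (h : ¬ Irrational (Real.log p / Real.log (1 - p))) :
    ∃ (r l : ℕ) (lam : ℝ), 0 < lam ∧ r.Coprime l ∧ -Real.log p = r * lam ∧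
      -Real.log (1 - p) = l * lam ∧ ratioNum p = r := by
  have ha := Real.log_neg hp.1 hp.2
  have hb := Real.log_neg (sub_pos.2 hp.2) (show 1 - p < 1 by linarith [hp.1])
  have h' : ∃ ρ : ℚ, (ρ : ℝ) = Real.log p / Real.log (1 - p) := not_not.1 h
  have hnum : ratioNum p = h'.choose.num := by unfold ratioNum; rw [dif_pos h']
  have hspec := h'.choose_spec
  set ρ := h'.choose
  have hρ : 0 < ρ := by
    have : (0 : ℝ) < ρ := by rw [hspec]; exact div_pos_of_neg_of_neg ha hb
    exact_mod_cast this
  have hden : (0 : ℝ) < ρ.den := by exact_mod_cast ρ.den_pos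
  have hn : ((ρ.num.natAbs : ℕ) : ℤ) = ρ.num := Int.natAbs_of_nonneg (Rat.num_nonneg.2 hρ.le)
  -- The span is b/ℓ, where r/ℓ is the reduced form of a/b.
  refine ⟨ρ.num.natAbs, ρ.den, -Real.log (1 - p) / ρ.den, div_pos (neg_pos.2 hb) hden,
    ρ.reduced, ?_, by field_simp, by rw [hnum, hn]⟩
  have h1 : ((ρ.num.natAbs : ℕ) : ℝ) = ρ.num := by
    rw [← Int.cast_natCast, hn]
  have h2 : (ρ : ℝ) = ρ.num / ρ.den := Rat.cast_def ρ
  rw [h2, div_eq_div_iff hden.ne' hb.ne] at hspec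
  rw [h1]
  field_simp
  linarith

variable {p c α : ℝ} {M G : ℂ → ℂ} {B K L C δ : ℝ} {U W : ℝ → ℂ}

lemma entropy_eq (p : ℝ) : p * -Real.log p + (1 - p) * -Real.log (1 - p) = entropy p := by
  unfold entropy; ring

lemma windowSum_limit_zero (hp : p ∈ Set.Ioo (0 : ℝ) 1) (c : ℝ) (M : ℂ → ℂ) :
    M (-1 - (0 : ℝ) * Complex.I) - (c / entropy p : ℝ) *
      windowSum p (-Real.log p) (-Real.log (1 - p))
        (fun s => s * Complex.exp (-((0 : ℝ) * Complex.I * s))) 0 =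
      entropy p * h0 p c (M (-1)) := by
  have hh : (entropy p : ℂ) ≠ 0 := by exact_mod_cast (entropy_pos hp).ne'
  rw [windowSum_id_zero]
  unfold h0
  push_cast
  rw [zero_mul, sub_zero]
  field_simp
  ring

theorem tendsto_h0_of_irrational (hirr : Irrational (Real.log p / Real.log (1 - p)))
    (h : RenewalEq p (-Real.log p) (-Real.log (1 - p)) B K L C δ U W)
    (hJ : ∀ ω : ℝ, Complex.exp (ω * Complex.I * (-Real.log p : ℝ)) = 1 →
        Complex.exp (ω * Complex.I * (-Real.log (1 - p) : ℝ)) = 1 →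
        Tendsto (windowSum p (-Real.log p) (-Real.log (1 - p))
          (fun s => U s * Complex.exp (-(ω * Complex.I * s)))) atTop
        (𝓝 (M (-1 - ω * Complex.I) - (c / entropy p : ℝ) *
          windowSum p (-Real.log p) (-Real.log (1 - p))
            (fun s => s * Complex.exp (-(ω * Complex.I * s))) 0))) :
    Tendsto U atTop (𝓝 (h0 p c (M (-1)))) := by
  have hh : (entropy p : ℂ) ≠ 0 := by exact_mod_cast (entropy_pos h.p_mem).ne'
  have h1 := hJ 0 (by simp) (by simp)
  rw [windowSum_limit_zero h.p_mem] at h1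
  rw [← neg_div_neg_eq] at hirr
  have h2 := h.tendsto_of_irrational hirr (J := entropy p * h0 p c (M (-1)))
    (h1.congr fun t => by simp [windowSum])
  rwa [entropy_eq, mul_div_cancel_left₀ _ hh] at h2

/-- The frequencies 2πk/lam have both jumps as periods, and log p = -r lam gives -1 + χ_k = -1 -
2πik/lam. -/
theorem tendsto_fluct_of_rational (hrat : ¬ Irrational (Real.log p / Real.log (1 - p)))
    (h : RenewalEq p (-Real.log p) (-Real.log (1 - p)) B K L C δ U W)
    (hJ : ∀ ω : ℝ, Complex.exp (ω * Complex.I * (-Real.log p : ℝ)) = 1 →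
        Complex.exp (ω * Complex.I * (-Real.log (1 - p) : ℝ)) = 1 →
        Tendsto (windowSum p (-Real.log p) (-Real.log (1 - p))
          (fun s => U s * Complex.exp (-(ω * Complex.I * s)))) atTop
        (𝓝 (M (-1 - ω * Complex.I) - (c / entropy p : ℝ) *
          windowSum p (-Real.log p) (-Real.log (1 - p))
            (fun s => s * Complex.exp (-(ω * Complex.I * s))) 0)))
    (hα : α < 1) (hG : ∀ s : ℂ, -2 < s.re → s.re < -α → (s ≠ -1 ∨ c = 0) →
      G s = M s - c / (s + 1)) :
    (Summable fun k : {k : ℤ // k ≠ 0} => ‖G (-1 + chi p k)‖) ∧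
    Tendsto (fun t : ℝ => U t - (h0 p c (M (-1)) +
      fluct p G (ratioNum p * (t / Real.log (1 / p))))) atTop (𝓝 0) := by
  have hp := h.p_mem
  have hh : (entropy p : ℂ) ≠ 0 := by exact_mod_cast (entropy_pos hp).ne'
  obtain ⟨r, l, lam, hlam, hrl, ha, hb, hr⟩ := exists_lattice hp hrat
  have hlamC : (lam : ℂ) ≠ 0 := by exact_mod_cast hlam.ne'
  have hr0 : (r : ℝ) ≠ 0 := fun h0 => by
    have := h.a_pos
    rw [ha, h0] at this
    simp at this
  have hr0C : (r : ℂ) ≠ 0 := by exact_mod_cast hr0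
  have hlog : (Real.log p : ℂ) = -(r * lam) := by
    have : Real.log p = -(r * lam) := by linarith
    rw [this]; push_cast; ring
  have hchi : ∀ k : ℤ, -1 + chi p k = -1 - (2 * Real.pi * k / lam : ℝ) * Complex.I := fun k => by
    unfold chi
    rw [hr, hlog]
    push_cast
    field_simp
    ring
  have hexp : ∀ (k : ℤ) (m : ℕ),
      Complex.exp ((2 * Real.pi * k / lam : ℝ) * Complex.I * (m * lam : ℝ)) = 1 := fun k m => by
    rw [Complex.exp_eq_one_iff]
    refine ⟨k * m, ?_⟩
    push_cast
    field_simp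
  -- The term k = 0 is set apart: G may have a pole at -1, and the limit there is h times the
  -- constant term.
  set J : ℤ → ℂ := fun k => if k = 0 then entropy p * h0 p c (M (-1)) else G (-1 + chi p k) with hJd
  have hJk : ∀ k : ℤ, k ≠ 0 → J k = G (-1 + chi p k) := fun k hk => by simp [hJd, hk]
  have key := h.tendsto_of_rational hlam hrl ha hb (J := J) (fun k => by
    have h1 := hJ (2 * Real.pi * k / lam) (by rw [ha]; exact hexp k r) (by rw [hb]; exact hexp k l)
    have e : M (-1 - (2 * Real.pi * k / lam : ℝ) * Complex.I) - (c / entropy p : ℝ) *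
        windowSum p (-Real.log p) (-Real.log (1 - p))
          (fun s => s * Complex.exp (-((2 * Real.pi * k / lam : ℝ) * Complex.I * s))) 0 = J k := by
      by_cases hk : k = 0
      · subst hk
        rw [show (2 * Real.pi * ((0 : ℤ) : ℝ) / lam) = 0 by simp, windowSum_limit_zero hp]
        simp [hJd]
      · have hω : 2 * Real.pi * k / lam ≠ 0 := by
          have : (k : ℝ) ≠ 0 := by exact_mod_cast hk
          have := Real.pi_pos
          positivity
        rw [windowSum_id_of_ne_zero hp hω (by rw [ha]; exact hexp k r)
          (by rw [hb]; exact hexp k l), hJk k hk, hchi, hG]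
        · simp
        · simp; linarith
        · left
          intro h0
          have h2 : ((2 * Real.pi * k / lam : ℝ) : ℂ) * Complex.I = 0 := by
            linear_combination -h0
          rw [mul_eq_zero, Complex.ofReal_eq_zero] at h2
          exact h2.elim hω Complex.I_ne_zero
    rw [e] at h1
    refine h1.congr fun t => ?_
    unfold windowSum
    have e2 : ∀ s : ℝ, -(2 * Real.pi * Complex.I * k * s / lam) =
        -((2 * Real.pi * k / lam : ℝ) * Complex.I * s) := fun s => by push_cast; ring
    simp_rw [e2])
  obtain ⟨hs, hlim⟩ := key
  refine ⟨(hs.comp_injective (Subtype.val_injective (p := fun k : ℤ => k ≠ 0))).congr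
    fun k => by simp only [Function.comp_apply]; rw [hJk k k.2], hlim.congr fun t => ?_⟩
  have hsum : Summable fun k : ℤ => J k * Complex.exp (2 * Real.pi * Complex.I * k * t / lam) := by
    refine Summable.of_norm (hs.congr fun k => ?_)
    rw [norm_mul, show 2 * Real.pi * Complex.I * k * t / lam =
      ((2 * Real.pi * k * t / lam : ℝ) : ℂ) * Complex.I by push_cast; ring,
      Complex.norm_exp_ofReal_mul_I, mul_one]
  set F : ℤ → ℂ := fun k => J k * Complex.exp (2 * Real.pi * Complex.I * k * t / lam) with hF
  have hsplit : F 0 + ∑' k : {k : ℤ // k ≠ 0}, F k = ∑' k, F k := by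
    rw [← hsum.tsum_subtype_add_tsum_subtype_compl {0}, tsum_singleton]
    rfl
  rw [← hsplit, entropy_eq]
  unfold fluct
  rw [if_neg hrat]
  -- Since log (1/p) = r lam, the argument r t / log (1/p) equals t / lam.
  have e3 : ∑' k : {k : ℤ // k ≠ 0}, F k =
      ∑' k : {k : ℤ // k ≠ 0}, G (-1 + chi p k) * Complex.exp (2 * ((k : ℤ) : ℂ) *
        Real.pi * Complex.I * (ratioNum p * (t / Real.log (1 / p)) : ℝ)) := by
    refine tsum_congr fun k : {k : ℤ // k ≠ 0} => ?_
    simp only [hF]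
    rw [hJk k k.2, hr, one_div, Real.log_inv, ha]
    congr 2
    push_cast
    field_simp
  rw [e3]
  have e4 : F 0 = entropy p * h0 p c (M (-1)) := by simp [hF, hJd]
  rw [e4]
  rw [mul_add, inv_mul_cancel_left₀ hh]

end TrieMean

theorem theorem1 (p : ℝ) (hp : p ∈ Set.Ioo (0 : ℝ) 1)
    {Ω : Type*} [MeasurableSpace Ω] (P : Measure Ω) [IsProbabilityMeasure P]
    (X Xs : ℕ → Ω → ℝ) (I : ℕ → Ω → ℕ) (T : ℕ → Ω → ℝ)
    (hX : TrieMean.TrieRecurrence P ⟨p, Set.Ioo_subset_Icc_self hp⟩ X Xs I T)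
    (hT : ∀ n, Integrable (T n) P)
    (g₁ : ℂ → ℂ) (hg₁ : TrieMean.IsPoissonGF (fun n => ∫ ω, T n ω ∂P) g₁)
    (θ α β c : ℝ) (hθ : θ ∈ Set.Ioo (0 : ℝ) (Real.pi / 2)) (hα : α < 1)
    (hg : (TrieMean.JSAdmissibleWith α β g₁ ∧ c = 0) ∨
      (TrieMean.JSAdmissible g₁ ∧ TrieMean.LinearInSector θ c α β g₁)) :
    (∀ n, Integrable (X n) P) ∧
    ∃ (G₁ : ℂ → ℂ) (c₀ d : ℂ),
      TrieMean.IsMellinContinuation g₁ (-2) (-1) (-α) G₁ ∧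
      (c = 0 → TrieMean.IsMellinContinuation g₁ (-2) (-α) (-α) G₁) ∧
      Tendsto (fun s : ℂ => G₁ s + (c : ℂ) / (s + 1)) (𝓝[≠] (-1)) (𝓝 c₀) ∧
      (c = 0 → d = G₁ (-1) / (TrieMean.entropy p : ℂ)) ∧
      (c ≠ 0 → d = TrieMean.h0 p c c₀) ∧
      (¬ Irrational (Real.log p / Real.log (1 - p)) →
        Summable fun k : {k : ℤ // k ≠ 0} => ‖G₁ (-1 + TrieMean.chi p k)‖) ∧
      Tendsto (fun n : ℕ =>
        (((∫ ω, X n ω ∂P) / n : ℝ) : ℂ) -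
          (((c / TrieMean.entropy p * Real.log n : ℝ) : ℂ) + d +
            TrieMean.fluct p G₁ (TrieMean.ratioNum p * Real.logb (1 / p) n)))
        atTop (𝓝 0) := by
  obtain ⟨hx0, hx1, ht0, ht1, hrec⟩ := hX.means hp hT
  -- Both alternatives become one: in the first, θ' is the angle of admissibility and c = 0.
  obtain ⟨θ', hθ', hlin, hjs⟩ : ∃ θ' ∈ Set.Ioo (0 : ℝ) (Real.pi / 2),
      TrieMean.LinearInSector θ' c α β g₁ ∧ TrieMean.JSAdmissible g₁ := by
    rcases hg with ⟨h, rfl⟩ | ⟨h1, h2⟩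
    · obtain ⟨θ', h1, h2⟩ := h.linearInSector
      exact ⟨θ', h1, h2, α, β, h⟩
    · exact ⟨θ, hθ, h2, h1⟩
  have hd : Differentiable ℂ g₁ := by
    obtain ⟨_, _, hd, -⟩ := hjs
    exact hd
  obtain ⟨G, hG1, hG2, hG3, hG4⟩ :=
    (hlin.axisBounds hθ'.1.le hd hg₁ ht0 ht1).exists_continuation hα
  obtain ⟨B, K, L, C, δ, U, W, hR, hJ, hlim⟩ :=
    TrieMean.exists_renewalEq hp hx0 hx1 ht0 ht1 hrec hg₁ hθ' hα hjs hlin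
  set M := mellin (TrieMean.mellinRem g₁ c) with hM
  have hmain : (¬ Irrational (Real.log p / Real.log (1 - p)) →
      Summable fun k : {k : ℤ // k ≠ 0} => ‖G (-1 + TrieMean.chi p k)‖) ∧
      Tendsto (fun t : ℝ => U t - (TrieMean.h0 p c (M (-1)) +
        TrieMean.fluct p G (TrieMean.ratioNum p * (t / Real.log (1 / p))))) atTop (𝓝 0) := by
    by_cases hirr : Irrational (Real.log p / Real.log (1 - p))
    · refine ⟨fun h => absurd hirr h, ?_⟩
      have := (TrieMean.tendsto_h0_of_irrational hirr hR hJ).sub_const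
        (TrieMean.h0 p c (M (-1)))
      rw [sub_self] at this
      refine this.congr fun t => ?_
      unfold TrieMean.fluct
      rw [if_pos hirr, add_zero]
    · obtain ⟨h1, h2⟩ := TrieMean.tendsto_fluct_of_rational hirr hR hJ hα hG3
      exact ⟨fun _ => h1, h2⟩
  -- One witness for d serves both cases: for c = 0 the second-moment term drops out, and G(-1) is
  -- the value of the transform of the remainder.
  refine ⟨fun n => hX.integrable (hp := hp) hT n, G, M (-1), TrieMean.h0 p c (M (-1)), hG1, hG2,
    hG4, fun hc => ?_, fun _ => rfl, hmain.1, ?_⟩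
  · have h1 : G (-1) = M (-1) - c / (-1 + 1) := hG3 (-1) (by simp) (by simp; linarith) (Or.inr hc)
    rw [h1]
    simp [TrieMean.h0, hc]
  · have h1 := hlim.add (hmain.2.comp (Real.tendsto_log_atTop.comp tendsto_natCast_atTop_atTop))
    rw [add_zero] at h1
    refine h1.congr fun n => ?_
    simp only [Function.comp_apply, Real.logb]
    push_cast
    ring
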